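/- **Radical membership on chordal networks.** Let $\mathbb K$ be a field, order the variables of $\mathbb K[X]=\mathbb K[x_0,\dots,x_{n-1}]$ by $x_0>\dots>x_{n-1}$, and let $G$ be a graph on $X$ for which this is a perfect elimination ordering: for every $l$ the set $X_l=\{x_l\}\cup\{x_m : m>l,\ x_m \text{ adjacent to } x_l\}$ is a clique. Let $\kappa$ be the clique number of $G$. The parent of $x_l$ is the largest variable of $X_l\setminus\{x_l\}$, if there is one. For a nonconstant polynomial $f$, $\mathrm{mvar}(f)$ is its greatest variable and $\mathrm{init}(f)$ its leading coefficient as a univariate polynomial in $\mathrm{mvar}(f)$. Varieties are taken over $\overline{\mathbb K}$. Call $f$ *$q$-reduced* if it has degree less than $q$ in each variable other than $\mathrm{mvar}(f)$. Let $F=\{f_1,\dots,f_m\}\subset\mathbb K[X]$ be supported on $G$ (two distinct variables occurring in the same $f_j$ are adjacent) and chordally $q$-dominated by $q$-reduced polynomials: for each maximal clique of $G$ of the form $X_l$ and each $x_i\in X_l$ there is a $q$-reduced $f\in F\cap\mathbb K[X_l]$ with $\mathrm{mvar}(f)=x_i$, $\mathrm{init}(f)=1$ and $\deg(f,x_i)\le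 q$. Let $\mathcal N$ be a triangular, squarefree $G$-chordal network that represents $F$, of width $W$. That is, $\mathcal N$ is a finite directed graph; each node has a rank $l\in\{0,\dots,n-1\}$ and carries a polynomial $f\in\mathbb K[X_l]$ with $f=0$ or $\mathrm{mvar}(f)=x_l$; if there is an arc from a node of rank $l$ to a node of rank $p$, then $x_p$ is the parent of $x_l$; $W$ is the largest number of nodes of a given rank. A chain is a choice of one node of each rank such that, whenever $x_p$ is the parent of $x_l$, the chosen nodes of ranks $l$ and $p$ are joined by an arc. The polynomials $t_0,\dots,t_{n-1}$ of every chain satisfy $\mathrm{mvar}(t_l)=x_l$ and $\mathrm{init}(t_l)=1$ and generate a radical ideal, and $\mathbf V(F)$ is the union of the varieties of the chains. Assume that the node polynomials are $q$-reduced. Let $h=\sum_{l} h_l$, where $h_l\in\mathbb K[X_l]$ has degree less than $q$ in every variable. Then there is a Monte Carlo algorithm that, given $F$, $\mathcal N$ and $h_0,\dots,h_{n-1}$, determines whether $h$ vanishes on $\mathbf V(F)$ in $\widetilde O(nWq^{2\kappa}+nW^2q^{\kappa})$ steps, where $\widetilde O$ ignores polynomial factors in $\kappa$. Precisely: there are a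 universal constant $c$ and a family of randomized algebraic computation trees, one for each possible discrete part of the input (the numbers $n,q,m$, the graph $G$, the ranked directed graph underlying $\mathcal N$, and the supports of the polynomials $f_j$, of the node polynomials and of the $h_l$; neither the field nor the coefficients enter), such that for every field $\mathbb K$ and every input as above, the tree of its discrete part, which receives the coefficients as its inputs, performs in the worst case at most $$c\,\kappa^{c}\,\bigl(nWq^{2\kappa}+nW^2q^{\kappa}\bigr)$$ steps (field operations, zero tests and random draws), and has the following property. Run it over any extension field $\mathbb L\supseteq\mathbb K$ (for instance $\mathbb L=\mathbb K$), with independent random scalars uniform in any nonempty finite set $S\subset\mathbb L$ with $|S|\ge 2nq$. If $h$ vanishes on $\mathbf V(F)$, it answers "True" with probability $1$; otherwise it answers "False" with probability at least $1/2$. -/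

import Mathlib

open scoped ENNReal

universe u v

namespace ChordalNet

/-! ### Chordal graphs on the ordered variables `x_0 > x_1 > ⋯ > x_{n-1}`

The variable `x_i` is the index `i : Fin n`; smaller indices are larger variables. -/

/-- `X_l`: the variable `x_l` together with its smaller neighbours (those of larger index). -/
def cliqueSet {n : ℕ} (G : SimpleGraph (Fin n)) (l : Fin n) : Set (Fin n) :=
  {m | m = l ∨ (l < m ∧ G.Adj l m)}

/-- `x_0 > ⋯ > x_{n-1}` is a perfect elimination ordering of `G` (so that `G` is chordal). -/
def IsPerfectElimination {n : ℕ} (G : SimpleGraph (Fin n)) : Prop :=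
  ∀ l : Fin n, G.IsClique (cliqueSet G l)

/-- `x_p` is the parent of `x_l` in the elimination tree: the largest variable among the
neighbours of `x_l` that are smaller than `x_l`. -/
def IsParent {n : ℕ} (G : SimpleGraph (Fin n)) (l p : Fin n) : Prop :=
  IsLeast {m : Fin n | l < m ∧ G.Adj l m} p

/-! ### Polynomial sets -/

section Poly

variable {K : Type u} [Field K] {n : ℕ}

/-- Two distinct variables that occur in a common member of `F` are adjacent in `G`, that is,
`G` contains the sparsity graph of `F`. -/
def SupportedOn (G : SimpleGraph (Fin n)) (F : Set (MvPolynomial (Fin n) K)) : Prop :=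
  ∀ f ∈ F, ∀ i ∈ f.vars, ∀ j ∈ f.vars, i ≠ j → G.Adj i j

/-- The variety of `F` in the affine space over the algebraic closure of `K`. -/
def variety (F : Set (MvPolynomial (Fin n) K)) : Set (Fin n → AlgebraicClosure K) :=
  {x | ∀ f ∈ F, MvPolynomial.aeval x f = 0}

/-- `mvar(f) = x_i`: the greatest variable (smallest index) that occurs in `f` is `x_i`. -/
def IsMainVar (f : MvPolynomial (Fin n) K) (i : Fin n) : Prop :=
  i ∈ f.vars ∧ ∀ j ∈ f.vars, i ≤ j

/-- The leading coefficient of `f`, viewed as a univariate polynomial in `x_i`. For the main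
variable `x_i = mvar(f)` this is the initial of `f`. -/
noncomputable def initialIn (i : Fin n) (f : MvPolynomial (Fin n) K) :
    MvPolynomial (Fin n) K :=
  ∑ e ∈ f.support with e i = f.degreeOf i, MvPolynomial.monomial (e.erase i) (f.coeff e)

/-- A polynomial set `F` in the variables `Y` is `q`-dominated. -/
def IsQDominated (q : ℕ) (Y : Set (Fin n)) (F : Set (MvPolynomial (Fin n) K)) : Prop :=
  ∀ i ∈ Y, ∃ f ∈ F, IsMainVar f i ∧ initialIn i f = 1 ∧ f.degreeOf i ≤ q

/-- `F` is chordally `q`-dominated: `F ∩ K[X_l]` is `q`-dominated for every maximal clique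
`X_l` of `G`. -/
def IsChordallyQDominated (G : SimpleGraph (Fin n)) (q : ℕ)
    (F : Set (MvPolynomial (Fin n) K)) : Prop :=
  ∀ l : Fin n, Maximal (fun s : Set (Fin n) => G.IsClique s) (cliqueSet G l) →
    IsQDominated q (cliqueSet G l)
      {f | f ∈ F ∧ f ∈ MvPolynomial.supported K (cliqueSet G l)}

/-- `f` has degree less than `q` in each variable other than its main variable. -/
def IsReduced (q : ℕ) (f : MvPolynomial (Fin n) K) : Prop :=
  ∀ i, IsMainVar f i → ∀ j, j ≠ i → f.degreeOf j < q

/-- `t_0, …, t_{n-1}` is a zero-dimensional triangular set. -/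
def IsTriangularSet (t : Fin n → MvPolynomial (Fin n) K) : Prop :=
  ∀ i, IsMainVar (t i) i ∧ initialIn i (t i) = 1

end Poly

/-! ### Chordal networks -/

/-- A `G`-chordal network with `N` nodes. Nodes are labelled, as distinct nodes may carry the
same polynomial set. -/
structure ChordalNetwork (K : Type u) [Field K] {n : ℕ} (G : SimpleGraph (Fin n)) (N : ℕ) where
  /-- the rank of a node -/
  rank : Fin N → Fin n
  /-- the polynomial set of a node -/
  polys : Fin N → Set (MvPolynomial (Fin n) K)
  /-- the arcs of the directed graph -/
  Arc : Fin N → Fin N → Prop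
  /-- nodes are supported on cliques -/
  supported : ∀ v, ∀ f ∈ polys v, f ∈ MvPolynomial.supported K (cliqueSet G (rank v))
  /-- arcs follow the elimination tree -/
  arc_parent : ∀ u v, Arc u v → IsParent G (rank u) (rank v)

namespace ChordalNetwork

variable {K : Type u} [Field K] {n : ℕ} {G : SimpleGraph (Fin n)} {N : ℕ}

/-- The width: the largest number of nodes of any given rank. -/
def width (𝒩 : ChordalNetwork K G N) : ℕ :=
  Finset.univ.sup fun l : Fin n => (Finset.univ.filter fun v : Fin N => 𝒩.rank v = l).card

/-- `(C 0, …, C (n-1))` is a chain. -/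
def IsChain (𝒩 : ChordalNetwork K G N) (C : Fin n → Fin N) : Prop :=
  (∀ l, 𝒩.rank (C l) = l) ∧ ∀ l p, IsParent G l p → 𝒩.Arc (C l) (C p)

/-- The union of the polynomial sets of the nodes of a chain. -/
def chainPolys (𝒩 : ChordalNetwork K G N) (C : Fin n → Fin N) :
    Set (MvPolynomial (Fin n) K) :=
  ⋃ l, 𝒩.polys (C l)

/-- The variety of a chordal network: the union of the varieties of its chains. -/
def variety (𝒩 : ChordalNetwork K G N) : Set (Fin n → AlgebraicClosure K) :=
  {x | ∃ C, 𝒩.IsChain C ∧ x ∈ ChordalNet.variety (𝒩.chainPolys C)}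

/-- The network is triangular and `f v` is the polynomial of the node `v`. -/
def IsTriangular (𝒩 : ChordalNetwork K G N) (f : Fin N → MvPolynomial (Fin n) K) : Prop :=
  ∀ v, 𝒩.polys v = {f v} ∧ (f v = 0 ∨ IsMainVar (f v) (𝒩.rank v))

/-- `𝒩` is a (triangular, squarefree) chordal network representation of `F`, with node
polynomials `f`: the network is triangular, every chain is a zero-dimensional triangular set
that generates a radical ideal, and the varieties agree. -/
structure Represents (𝒩 : ChordalNetwork K G N) (f : Fin N → MvPolynomial (Fin n) K)
    (F : Set (MvPolynomial (Fin n) K)) : Prop where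
  triangular : 𝒩.IsTriangular f
  chain_triangular : ∀ C, 𝒩.IsChain C → IsTriangularSet fun l => f (C l)
  chain_radical : ∀ C, 𝒩.IsChain C → (Ideal.span (𝒩.chainPolys C)).IsRadical
  variety_eq : 𝒩.variety = ChordalNet.variety F

end ChordalNetwork

/-! ### Randomized algebraic computation trees

An algorithm over an arbitrary field whose cost is its number of field operations. The field
elements it handles are opaque: they can only be combined arithmetically and compared to `0`.
-/

/-- The four field operations; division by zero returns zero. -/
inductive FieldOp where
  | add | sub | mul | div

/-- The result of a field operation. -/
def FieldOp.eval {L : Type v} [Field L] : FieldOp → L → L → L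
  | .add, a, b => a + b
  | .sub, a, b => a - b
  | .mul, a, b => a * b
  | .div, a, b => a / b

/-- An operand: an input, a register, or one of the constants `0`, `1`. -/
inductive Operand (ι : Type) where
  | input (i : ι)
  | reg (k : ℕ)
  | zero
  | one

/-- The value of an operand for given inputs and register contents. -/
def Operand.eval {ι : Type} {L : Type v} [Field L] (inp : ι → L) (mem : ℕ → L) :
    Operand ι → L
  | .input i => inp i
  | .reg k => mem k
  | .zero => 0
  | .one => 1

/-- A randomized algebraic computation tree with inputs indexed by `ι`: halt with an answer,
perform a field operation and store the result, store a random scalar, or branch on whether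
an operand is zero. -/
inductive CompTree (ι : Type) where
  | halt (answer : Bool)
  | compute (op : FieldOp) (a b : Operand ι) (dst : ℕ) (next : CompTree ι)
  | draw (dst : ℕ) (next : CompTree ι)
  | test (a : Operand ι) (ifZero ifNonzero : CompTree ι)

namespace CompTree

/-- The worst-case number of steps (field operations, random draws, and zero tests). -/
def cost {ι : Type} : CompTree ι → ℕ
  | .halt _ => 0
  | .compute _ _ _ _ t => t.cost + 1
  | .draw _ t => t.cost + 1
  | .test _ t₀ t₁ => max t₀.cost t₁.cost + 1

open Classical in
/-- The distribution of the answer when the tree is run over `L` on the inputs `inp`, from the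
register contents `mem`, with independent random scalars uniform in `S`. -/
noncomputable def runFrom {ι : Type} {L : Type v} [Field L] (S : Finset L) (hS : S.Nonempty)
    (inp : ι → L) : CompTree ι → (ℕ → L) → PMF Bool
  | .halt b, _ => PMF.pure b
  | .compute op a b dst t, mem =>
      runFrom S hS inp t
        (Function.update mem dst (op.eval (a.eval inp mem) (b.eval inp mem)))
  | .draw dst t, mem =>
      (PMF.uniformOfFinset S hS).bind fun s => runFrom S hS inp t (Function.update mem dst s)
  | .test a t₀ t₁, mem =>
      if a.eval inp mem = 0 then runFrom S hS inp t₀ mem else runFrom S hS inp t₁ mem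

/-- The distribution of the answer, starting from zero registers. -/
noncomputable def run {ι : Type} {L : Type v} [Field L] (t : CompTree ι) (S : Finset L)
    (hS : S.Nonempty) (inp : ι → L) : PMF Bool :=
  runFrom S hS inp t 0

end CompTree

/-! ### Inputs of the membership problem

Polynomials are given in sparse form: their exponents are discrete data, their coefficients
are field elements. -/

/-- The discrete part of an input, which involves no field: the graph, the network as a ranked
directed graph, and the supports of the polynomials of the system `F`, of the nodes of the
network, and of the summands `h_l`. -/
structure Shape where
  /-- number of variables -/
  n : ℕ
  /-- degree bound -/
  q : ℕ
  /-- number of polynomials in the system -/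
  m : ℕ
  /-- number of nodes of the network -/
  N : ℕ
  /-- the chordal graph -/
  G : SimpleGraph (Fin n)
  /-- ranks of the nodes -/
  rank : Fin N → Fin n
  /-- arcs of the network -/
  Arc : Fin N → Fin N → Prop
  /-- supports of the polynomials of the system -/
  systemSupport : Fin m → Finset (Fin n →₀ ℕ)
  /-- supports of the node polynomials -/
  nodeSupport : Fin N → Finset (Fin n →₀ ℕ)
  /-- supports of the summands of `h` -/
  summandSupport : Fin n → Finset (Fin n →₀ ℕ)

/-- The addresses of the input coefficients: a polynomial and an exponent. -/
inductive Shape.Input (s : Shape) : Type where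
  | system (j : Fin s.m) (e : Fin s.n →₀ ℕ)
  | node (v : Fin s.N) (e : Fin s.n →₀ ℕ)
  | summand (l : Fin s.n) (e : Fin s.n →₀ ℕ)

/-- The discrete part of a given input. -/
def shapeOf {K : Type u} [Field K] {n m N : ℕ} {G : SimpleGraph (Fin n)} (q : ℕ)
    (F : Fin m → MvPolynomial (Fin n) K) (𝒩 : ChordalNetwork K G N)
    (f : Fin N → MvPolynomial (Fin n) K) (hs : Fin n → MvPolynomial (Fin n) K) : Shape where
  n := n
  q := q
  m := m
  N := N
  G := G
  rank := 𝒩.rank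
  Arc := 𝒩.Arc
  systemSupport j := (F j).support
  nodeSupport v := (f v).support
  summandSupport l := (hs l).support

/-- The coefficients of a given input, as elements of an extension field `L` of `K`. -/
def inputOf {K : Type u} [Field K] {n m N : ℕ} {G : SimpleGraph (Fin n)} (q : ℕ)
    (F : Fin m → MvPolynomial (Fin n) K) (𝒩 : ChordalNetwork K G N)
    (f : Fin N → MvPolynomial (Fin n) K) (hs : Fin n → MvPolynomial (Fin n) K)
    (L : Type v) [Field L] [Algebra K L] : (shapeOf q F 𝒩 f hs).Input → L
  | .system j e => algebraMap K L (MvPolynomial.coeff e (F j))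
  | .node w e => algebraMap K L (MvPolynomial.coeff e (f w))
  | .summand l e => algebraMap K L (MvPolynomial.coeff e (hs l))

end ChordalNet

/-!
The algorithm evaluates a random linear combination of the normal forms of `h` along all chains.

*Algebra.* Let `C` be a chain, `I_C` the ideal generated by its polynomials. As `I_C` is radical,
the Nullstellensatz shows that `h` vanishes on `V(F)` if and only if `h ∈ I_C` for all chains `C`
(`ChordalNetwork.Represents.forall_variety_iff`), and also that `F ⊆ I_C`. Let `t_l` be the
polynomial of `C` with main variable `x_l`. Modulo `I_C`, `h` is congruent to a polynomial `h_C`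
whose degree in `x_l` is less than `q` and than the degree of `t_l` in `x_l`
(`IsInput.exists_normalForm`: if the latter exceeds `q`, a monic polynomial of `F` is used for the
reduction). Attach an indeterminate `y_v` to each node `v`. The polynomial
`P = ∑_C (∏_l y_{C l}) h_C` vanishes if and only if all `h_C` do, since different chains have
different weights, and its total degree is at most `n + n (q - 1) = n q`. By the Schwartz–Zippel
lemma it suffices to test whether `P` vanishes at a random point (`half_le_card_ne_zero`).

*Evaluation.* For a triangular set `t` and a point `r`, the functional `normalEval t r` sends a
polynomial to the value at `r` of its normal form modulo `t`; it divides by `t_0`, evaluates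
`x_0` at `r_0`, divides by `t_1`, and so on. It vanishes on the ideal of `t`, so that the variable
`x_l` of a polynomial in `x_l, x_{l+1}, …` may be reduced and evaluated before the others are
considered, and on polynomials in `x_k, x_{k+1}, …` it depends on `t_k, t_{k+1}, …` only. This makes
it possible to sum over all chains by dynamic programming along the elimination tree. Each node
`v` of rank `l` receives a weight `w_v` and a polynomial `H_v` in the variables `X_l ∖ {x_l}`; they
form an element `w_v + ε H_v` of a ring with `ε² = 0`. The contribution of a child `c` of `x_l` is
the sum of `y_u (w_u + ε H_u)` over the nodes `u` of rank `c` that have an arc to `v`; the product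
of these contributions with `1 + ε h_l` is reduced with respect to `x_l`, by the polynomial of the
node, and evaluated at `x_l = r_l` (`collect`, `IsReducedAt`). The value of `P` is the
coefficient of `ε` in the product of the contributions of the roots (`sum_chains`, proved by
eliminating one rank at a time).

*Cost.* All polynomials that occur are kept in boxes of exponents less than `q` in at most `κ`
variables, so that they have at most `q ^ κ` coefficients. A contribution takes `O(W q ^ κ)`
operations for each node that receives it, hence `O(n W² q ^ κ)` overall. Every multiplication in
such a product is by a weight: the second components are multiplied by scalars only. The reduction
at a node uses tables of the normal forms of the monomials `x_i ^ q x ^ γ` modulo the monic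
polynomials of `F` that belong to the clique (`exists_isTable`). The tables and the division take
`O(κ² q ^ (2 κ))` operations, hence `O(κ² n W q ^ (2 κ))` overall (`exists_program`).

*Model.* The operations are performed simultaneously for all fields, inputs and random scalars, in
the ring of functions of these data, where the algorithm is a straight-line program (`Computes`).
The tree of a given discrete input draws the random scalars, runs this program, and compares the
result with zero (`Shape.Good.exists_tree`).
-/

namespace ChordalNet

/-! ### Straight-line computations -/

section Computes

variable {R : Type*} [CommRing R] [Div R]

/-- `x` is the result of one arithmetic operation on two elements of `S`. -/
def IsOpOf (S : Set R) (x : R) : Prop :=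
  ∃ a ∈ S, ∃ b ∈ S, x = a + b ∨ x = a - b ∨ x = a * b ∨ x = a / b

/-- `Computes k S T`: starting from the elements of `S`, a straight-line program with at most
`k` arithmetic operations makes all elements of `T` available. -/
inductive Computes : ℕ → Set R → Set R → Prop where
  | done {k : ℕ} {S T : Set R} (h : T ⊆ S) : Computes k S T
  | step {k : ℕ} {S T : Set R} (x : R) (hx : IsOpOf S x) (h : Computes k (insert x S) T) :
      Computes (k + 1) S T

theorem IsOpOf.mono {S S' : Set R} (h : S ⊆ S') {x : R} : IsOpOf S x → IsOpOf S' x := by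
  rintro ⟨a, ha, b, hb, e⟩
  exact ⟨a, h ha, b, h hb, e⟩

namespace Computes

theorem mono {k k' : ℕ} {S S' T T' : Set R} (h : Computes k S T) (hk : k ≤ k')
    (hS : S ⊆ S') (hT : T' ⊆ T) : Computes k' S' T' := by
  induction h generalizing k' S' with
  | done h => exact .done ((hT.trans h).trans hS)
  | step x hx _ ih =>
    obtain ⟨k'', rfl⟩ : ∃ j, k' = j + 1 := ⟨k' - 1, by omega⟩
    exact .step x (hx.mono hS) (ih (by omega) (Set.insert_subset_insert hS) hT)

theorem keep {k : ℕ} {S T : Set R} (h : Computes k S T) : Computes k S (S ∪ T) := by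
  induction h with
  | done h => exact .done (by simp [h])
  | step x hx _ ih =>
    exact .step x hx (ih.mono le_rfl subset_rfl
      (Set.union_subset_union_left _ (Set.subset_insert _ _)))

theorem trans {k m : ℕ} {S T U : Set R} (h : Computes k S T) (h' : Computes m (S ∪ T) U) :
    Computes (k + m) S (T ∪ U) := by
  induction h with
  | done h =>
    rw [Set.union_eq_self_of_subset_right h] at h'
    exact h'.keep.mono (by omega) subset_rfl (Set.union_subset_union_left _ h)
  | @step k S T x hx _ ih =>
    have := ih (h'.mono le_rfl (Set.union_subset_union_left _ (Set.subset_insert _ _))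
      subset_rfl)
    exact (Computes.step x hx this).mono (by omega) subset_rfl subset_rfl

theorem bind {k m j : ℕ} {S T U : Set R} (h : Computes k S T) (h' : Computes m (S ∪ T) U)
    (hj : k + m ≤ j) : Computes j S U :=
  (h.trans h').mono hj subset_rfl Set.subset_union_right

theorem union {k m j : ℕ} {S T U : Set R} (h : Computes k S T) (h' : Computes m S U)
    (hj : k + m ≤ j) : Computes j S (T ∪ U) :=
  (h.trans (h'.mono le_rfl Set.subset_union_left subset_rfl)).mono hj subset_rfl subset_rfl

theorem biUnion {α : Type*} (s : Finset α) {S : Set R} {c : α → ℕ} {T : α → Set R}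
    (h : ∀ i ∈ s, Computes (c i) S (T i)) : Computes (∑ i ∈ s, c i) S (⋃ i ∈ s, T i) := by
  classical
  induction s using Finset.induction_on with
  | empty => exact .done (by simp)
  | insert a s ha ih =>
    rw [Finset.sum_insert ha, Finset.set_biUnion_insert]
    exact (h a (Finset.mem_insert_self _ _)).union
      (ih fun i hi => h i (Finset.mem_insert_of_mem hi)) le_rfl

theorem biUnion_const {α : Type*} (s : Finset α) {S : Set R} {c j : ℕ} {T : α → Set R}
    (h : ∀ i ∈ s, Computes c S (T i)) (hj : s.card * c ≤ j) :
    Computes j S (⋃ i ∈ s, T i) :=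
  (biUnion s h).mono (by simpa using hj) subset_rfl subset_rfl

theorem add {S : Set R} {a b : R} (ha : a ∈ S) (hb : b ∈ S) : Computes 1 S {a + b} :=
  .step (a + b) ⟨a, ha, b, hb, .inl rfl⟩ (.done (by simp))

theorem sub {S : Set R} {a b : R} (ha : a ∈ S) (hb : b ∈ S) : Computes 1 S {a - b} :=
  .step (a - b) ⟨a, ha, b, hb, .inr (.inl rfl)⟩ (.done (by simp))

theorem mul {S : Set R} {a b : R} (ha : a ∈ S) (hb : b ∈ S) : Computes 1 S {a * b} :=
  .step (a * b) ⟨a, ha, b, hb, .inr (.inr (.inl rfl))⟩ (.done (by simp))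

theorem div {S : Set R} {a b : R} (ha : a ∈ S) (hb : b ∈ S) : Computes 1 S {a / b} :=
  .step (a / b) ⟨a, ha, b, hb, .inr (.inr (.inr rfl))⟩ (.done (by simp))

/-- An inner product, added to an available element. -/
theorem add_sum_mul {α : Type*} (s : Finset α) {S : Set R} {x : R} {a b : α → R} (hx : x ∈ S)
    (ha : ∀ i ∈ s, a i ∈ S) (hb : ∀ i ∈ s, b i ∈ S) :
    Computes (2 * s.card) S {x + ∑ i ∈ s, a i * b i} := by
  classical
  induction s using Finset.induction_on with
  | empty => exact .done (by simpa using hx)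
  | insert j s hj ih =>
    have h1 := ih (fun i hi => ha i (Finset.mem_insert_of_mem hi))
      (fun i hi => hb i (Finset.mem_insert_of_mem hi))
    have h2 := mul (ha j (Finset.mem_insert_self _ _)) (hb j (Finset.mem_insert_self _ _))
    refine (h1.union h2 le_rfl).bind
      (add (a := x + ∑ i ∈ s, a i * b i) (b := a j * b j) (by simp) (by simp)
        |>.mono le_rfl subset_rfl ?_) ?_
    · rw [Finset.sum_insert hj]; simp only [Set.singleton_subset_iff, Set.mem_singleton_iff]; ring
    · rw [Finset.card_insert_of_notMem hj]; omega

end Computes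

end Computes

/-! ### From straight-line computations to computation trees -/

section Compile

variable {ι : Type} {E : Type*} {L : E → Type v} [∀ e, Field (L e)]

/-- A straight-line computation in a ring of functions on the possible inputs, followed by a
zero test of its result, is performed by a computation tree. `loc` says where the available
elements are found; the registers from `k` on are free. -/
theorem Computes.exists_tree (inp : ∀ e, ι → L e) {m : ℕ} {S T : Set (∀ e, L e)}
    (h : Computes m S T) {p : ∀ e, L e} (hp : p ∈ T) (loc : (∀ e, L e) → Operand ι) (k : ℕ)
    (hloc : ∀ x ∈ S, ∀ j, loc x = .reg j → j < k) :
    ∃ t : CompTree ι, t.cost ≤ m + 1 ∧ ∀ (e : E) (U : Finset (L e)) (hU : U.Nonempty)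
      (mem : ℕ → L e), (∀ x ∈ S, (loc x).eval (inp e) mem = x e) →
        (p e = 0 → CompTree.runFrom U hU (inp e) t mem = PMF.pure true) ∧
        (p e ≠ 0 → CompTree.runFrom U hU (inp e) t mem = PMF.pure false) := by
  classical
  induction h generalizing loc k with
  | done h =>
    refine ⟨.test (loc p) (.halt true) (.halt false), by simp [CompTree.cost], ?_⟩
    intro e U hU mem hmem
    have := hmem p (h hp)
    constructor <;> intro h0 <;> simp [CompTree.runFrom, this, h0]
  | @step m S T x hx _ ih =>
    obtain ⟨a, ha, b, hb, hop⟩ := hx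
    obtain ⟨op, hop⟩ : ∃ op : FieldOp, ∀ e, x e = op.eval (a e) (b e) := by
      rcases hop with rfl | rfl | rfl | rfl
      exacts [⟨.add, fun e => rfl⟩, ⟨.sub, fun e => rfl⟩, ⟨.mul, fun e => rfl⟩,
        ⟨.div, fun e => rfl⟩]
    -- the new element goes to the register `k`, unless it was available before
    obtain ⟨t, htc, ht⟩ := ih hp (fun y => if y ∈ S then loc y else .reg k) (k + 1) (by
      intro y hy j hj
      by_cases hyS : y ∈ S
      · simp only [hyS, if_true] at hj
        exact (hloc y hyS j hj).trans (Nat.lt_succ_self k)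
      · simp only [hyS, if_false, Operand.reg.injEq] at hj
        omega)
    refine ⟨.compute op (loc a) (loc b) k t, by simp only [CompTree.cost]; omega, ?_⟩
    intro e U hU mem hmem
    simp only [CompTree.runFrom]
    apply ht
    intro y hy
    rw [hmem a ha, hmem b hb, ← hop]
    by_cases hyS : y ∈ S
    · simp only [hyS, if_true]
      rw [← hmem y hyS]
      have := hloc y hyS
      cases hl : loc y with
      | reg j =>
        have := this j hl
        simp only [Operand.eval]
        rw [Function.update_of_ne (by omega)]
      | _ => simp only [Operand.eval]
    · simp only [hyS, if_false, Operand.eval, Function.update_self]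
      rcases hy with rfl | hy
      · rfl
      · exact absurd hy hyS

/-- `drawAll j k t` draws random scalars into the registers `j, …, j + k - 1` and proceeds as
`t`. -/
def drawAll (j : ℕ) : ℕ → CompTree ι → CompTree ι
  | 0, t => t
  | k + 1, t => .draw j (drawAll (j + 1) k t)

theorem cost_drawAll (j k : ℕ) (t : CompTree ι) : (drawAll j k t).cost = k + t.cost := by
  induction k generalizing j with
  | zero => simp [drawAll]
  | succ k ih => simp only [drawAll, CompTree.cost, ih]; omega

/-- Register contents after `z` has been stored from register `j` on. -/
def storeAt {F : Type*} (j : ℕ) {k : ℕ} (z : Fin k → F) (mem : ℕ → F) : ℕ → F :=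
  fun i => if h : j ≤ i ∧ i < j + k then z ⟨i - j, by omega⟩ else mem i

/-- The answer after `k` independent draws is distributed like the answer for a uniformly random
vector of `U ^ k`. -/
theorem runFrom_drawAll {F : Type v} [Field F] (U : Finset F) (hU : U.Nonempty)
    (inp : ι → F) (t : CompTree ι) (b : Bool) (j k : ℕ) (mem : ℕ → F) :
    CompTree.runFrom U hU inp (drawAll j k t) mem b =
      (∑ z ∈ Fintype.piFinset fun _ : Fin k => U,
        CompTree.runFrom U hU inp t (storeAt j z mem) b) / (U.card : ℝ≥0∞) ^ k := by
  classical
  induction k generalizing j mem with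
  | zero =>
    have : ∀ z : Fin 0 → F, storeAt j z mem = mem := by
      intro z; funext i; simp [storeAt]
    simp [drawAll, this]
  | succ k ih =>
    simp only [drawAll, CompTree.runFrom, PMF.bind_apply]
    rw [tsum_eq_sum (s := U) (by
      intro x hx
      rw [PMF.uniformOfFinset_apply_of_notMem hU hx, zero_mul])]
    have hbij : (∑ z ∈ Fintype.piFinset fun _ : Fin (k + 1) => U,
        CompTree.runFrom U hU inp t (storeAt j z mem) b) =
        ∑ s ∈ U, ∑ z ∈ Fintype.piFinset fun _ : Fin k => U,
          CompTree.runFrom U hU inp t (storeAt (j + 1) z (Function.update mem j s)) b := by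
      rw [← Finset.sum_product']
      symm
      refine Finset.sum_bij' (fun a _ => Fin.cons a.1 a.2) (fun z _ => (z 0, Fin.tail z))
        ?_ ?_ ?_ ?_ ?_
      · rintro ⟨a, z⟩ h
        simp only [Finset.mem_product, Fintype.mem_piFinset] at h ⊢
        intro i
        refine Fin.cases ?_ (fun i => ?_) i
        · simpa using h.1
        · simpa using h.2 i
      · intro z h
        simp only [Finset.mem_product, Fintype.mem_piFinset] at h ⊢
        exact ⟨h 0, fun i => h _⟩
      · rintro ⟨a, z⟩ h; simp
      · intro z h; simp
      · rintro ⟨a, z⟩ h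
        congr 1
        simp only
        congr 1
        funext i
        simp only [storeAt]
        by_cases hij : i = j
        · subst hij
          simp
        · by_cases h1 : j + 1 ≤ i ∧ i < j + 1 + k
          · have h2 : j ≤ i ∧ i < j + (k + 1) := by omega
            rw [dif_pos h1, dif_pos h2]
            have : (⟨i - j, by omega⟩ : Fin (k + 1)) = Fin.succ ⟨i - (j + 1), by omega⟩ := by
              ext; simp; omega
            rw [this, Fin.cons_succ]
          · have h2 : ¬ (j ≤ i ∧ i < j + (k + 1)) := by omega
            rw [dif_neg h1, dif_neg h2, Function.update_of_ne hij]
    rw [hbij, ENNReal.div_eq_inv_mul, Finset.mul_sum]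
    refine Finset.sum_congr rfl fun s hs => ?_
    rw [PMF.uniformOfFinset_apply_of_mem hU hs, ih, ENNReal.div_eq_inv_mul, ← mul_assoc,
      pow_succ]
    congr 1
    rw [ENNReal.mul_inv (.inr (by simp)) (.inl (by simp)), mul_comm]

end Compile

/-! ### Evaluation of normal forms modulo a triangular set -/

section NormalForm

open MvPolynomial

variable {n : ℕ} {L : Type*} [CommRing L]

/-- `t = x_l ^ d + ⋯`, where the dots stand for terms of degree less than `d` in `x_l`. -/
def IsMonicIn (l : Fin n) (d : ℕ) (t : MvPolynomial (Fin n) L) : Prop :=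
  ∀ e : Fin n →₀ ℕ, d ≤ e l → t.coeff e = if e = Finsupp.single l d then 1 else 0

/-- Every exponent of `p` is bounded by `b`, strictly in each variable. -/
def InBox (b : Fin n → ℕ) (p : MvPolynomial (Fin n) L) : Prop :=
  ∀ e ∈ p.support, ∀ i, e i < b i

/-- `p` viewed as a univariate polynomial in `x_l`. The coefficients are elements of the full
polynomial ring, but do not involve `x_l`. -/
noncomputable def toUni (l : Fin n) :
    MvPolynomial (Fin n) L →ₐ[L] Polynomial (MvPolynomial (Fin n) L) :=
  aeval fun i => if i = l then Polynomial.X else Polynomial.C (X i)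

/-- Substitution of the scalar `a` for the variable `x_l`. -/
noncomputable def substVar (l : Fin n) (a : L) :
    MvPolynomial (Fin n) L →ₐ[L] MvPolynomial (Fin n) L :=
  aeval fun i => if i = l then C a else X i

/-- The remainder of a polynomial on division by `t` with respect to `x_l`, evaluated at
`x_l = a`. It is meaningful if `t` is monic in `x_l`. -/
noncomputable def remEval (l : Fin n) (t : MvPolynomial (Fin n) L) (a : L) :
    MvPolynomial (Fin n) L →ₗ[L] MvPolynomial (Fin n) L :=
  ((Polynomial.aeval (C a : MvPolynomial (Fin n) L)).toLinearMap.restrictScalars L) ∘ₗ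
    ((Polynomial.modByMonicHom (toUni l t)).restrictScalars L) ∘ₗ (toUni l).toLinearMap

theorem remEval_apply (l : Fin n) (t : MvPolynomial (Fin n) L) (a : L)
    (g : MvPolynomial (Fin n) L) :
    remEval l t a g = (toUni l g %ₘ toUni l t).eval (C a) := by
  simp [remEval]

theorem toUni_monomial (l : Fin n) (e : Fin n →₀ ℕ) (a : L) :
    toUni l (monomial e a) = Polynomial.C (monomial (e.erase l) a) * Polynomial.X ^ e l := by
  have h1 : (monomial e a : MvPolynomial (Fin n) L) =
      monomial (e.erase l) a * X l ^ e l := by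
    rw [X_pow_eq_monomial, monomial_mul, mul_one, Finsupp.erase_add_single]
  have h2 : toUni l (monomial (e.erase l) a) = Polynomial.C (monomial (e.erase l) a) := by
    rw [monomial_eq, map_mul, map_mul]
    congr 1
    · simp [toUni, MvPolynomial.algebraMap_eq]
    · rw [Finsupp.prod, map_prod, map_prod]
      refine Finset.prod_congr rfl fun i hi => ?_
      have : i ≠ l := by
        rintro rfl
        simp at hi
      simp [toUni, this]
  rw [h1, map_mul, h2, map_pow]
  simp [toUni]

theorem toUni_degree_lt {l : Fin n} {d : ℕ} {g : MvPolynomial (Fin n) L}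
    (h : ∀ e ∈ g.support, e l < d) : (toUni l g).degree < d := by
  rw [← Polynomial.mem_degreeLT, g.as_sum, map_sum]
  refine Submodule.sum_mem _ fun e he => ?_
  rw [toUni_monomial, Polynomial.mem_degreeLT]
  refine (Polynomial.degree_C_mul_X_pow_le _ _).trans_lt ?_
  exact_mod_cast h e he

theorem IsMonicIn.sub {l : Fin n} {d : ℕ} {t : MvPolynomial (Fin n) L} (h : IsMonicIn l d t) :
    ∀ e ∈ (t - X l ^ d).support, e l < d := by
  classical
  intro e he
  by_contra hd
  rw [mem_support_iff, coeff_sub, h e (by omega), coeff_X_pow] at he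
  apply he
  simp only [eq_comm, sub_self]

theorem IsMonicIn.toUni_monic [Nontrivial L] {l : Fin n} {d : ℕ} {t : MvPolynomial (Fin n) L}
    (h : IsMonicIn l d t) : (toUni l t).Monic ∧ (toUni l t).natDegree = d := by
  have h1 := toUni_degree_lt h.sub
  have h2 : toUni l t = Polynomial.X ^ d + toUni l (t - X l ^ d) := by
    rw [map_sub, map_pow]; simp [toUni]
  rw [h2]
  refine ⟨Polynomial.monic_X_pow_add h1, ?_⟩
  rw [Polynomial.natDegree_add_eq_left_of_degree_lt, Polynomial.natDegree_X_pow]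
  rwa [Polynomial.degree_X_pow]

theorem toUni_eq_C {l : Fin n} {g : MvPolynomial (Fin n) L} (h : ∀ e ∈ g.support, e l = 0) :
    toUni l g = Polynomial.C g := by
  conv_lhs => rw [g.as_sum]
  conv_rhs => rw [g.as_sum]
  rw [map_sum, map_sum]
  refine Finset.sum_congr rfl fun e he => ?_
  rw [toUni_monomial, h e he, pow_zero, mul_one]
  rw [Finsupp.erase_of_notMem_support (by simpa using h e he)]

theorem mem_supported_iff_support {s : Set (Fin n)} {g : MvPolynomial (Fin n) L} :
    g ∈ supported L s ↔ ∀ e ∈ g.support, ∀ i, e i ≠ 0 → i ∈ s := by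
  rw [mem_supported]
  constructor
  · intro h e he i hi
    exact h (by rw [Finset.mem_coe, mem_vars_iff_mem_support]; exact ⟨e, he, by simpa using hi⟩)
  · intro h i hi
    rw [Finset.mem_coe, mem_vars_iff_mem_support] at hi
    obtain ⟨e, he, hi⟩ := hi
    exact h e he i (by simpa using hi)

theorem eq_zero_of_mem_supported {s : Set (Fin n)} {g : MvPolynomial (Fin n) L} {l : Fin n}
    (h : g ∈ supported L s) (hl : l ∉ s) : ∀ e ∈ g.support, e l = 0 := by
  intro e he
  by_contra h0
  exact hl (mem_supported_iff_support.1 h e he l h0)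

theorem substVar_monomial (l : Fin n) (a : L) (e : Fin n →₀ ℕ) (c : L) :
    substVar l a (monomial e c) = monomial (e.erase l) (c * a ^ e l) := by
  have h1 : (monomial e c : MvPolynomial (Fin n) L) =
      monomial (e.erase l) c * X l ^ e l := by
    rw [X_pow_eq_monomial, monomial_mul, mul_one, Finsupp.erase_add_single]
  have h2 : substVar l a (monomial (e.erase l) c) = monomial (e.erase l) c := by
    rw [monomial_eq, map_mul]
    congr 1
    · simp [substVar, MvPolynomial.algebraMap_eq]
    · rw [Finsupp.prod, map_prod]
      refine Finset.prod_congr rfl fun i hi => ?_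
      have : i ≠ l := by
        rintro rfl
        simp at hi
      simp [substVar, this]
  rw [h1, map_mul, h2, map_pow]
  have : substVar l a (X l) = C a := by simp [substVar]
  rw [this, ← map_pow, mul_comm, C_mul_monomial, mul_comm]

theorem exists_of_mem_support_substVar {l : Fin n} {a : L} {g : MvPolynomial (Fin n) L}
    {e : Fin n →₀ ℕ} (he : e ∈ (substVar l a g).support) :
    ∃ e' ∈ g.support, e = e'.erase l := by
  classical
  rw [g.as_sum, map_sum] at he
  obtain ⟨e', he', h⟩ := Finset.mem_biUnion.1 (support_sum he)
  rw [substVar_monomial] at h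
  exact ⟨e', he', by simpa using support_monomial_subset h⟩

theorem eval_substVar (r : Fin n → L) (l : Fin n) (g : MvPolynomial (Fin n) L) :
    eval r (substVar l (r l) g) = eval r g := by
  have : ((aeval r : MvPolynomial (Fin n) L →ₐ[L] L).comp (substVar l (r l))) = aeval r := by
    ext i
    by_cases hi : i = l
    · subst hi; simp [substVar]
    · simp [substVar, hi]
  have := congrArg (fun f : MvPolynomial (Fin n) L →ₐ[L] L => f g) this
  simpa [MvPolynomial.aeval_eq_eval] using this

theorem remEval_of_degree_lt [Nontrivial L] {l : Fin n} {d : ℕ} {t g : MvPolynomial (Fin n) L}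
    (ht : IsMonicIn l d t) (a : L) (hg : ∀ e ∈ g.support, e l < d) :
    remEval l t a g = substVar l a g := by
  rw [remEval_apply, (Polynomial.modByMonic_eq_self_iff ht.toUni_monic.1).2]
  · have : ((Polynomial.aeval (C a : MvPolynomial (Fin n) L)).restrictScalars L).comp
        (toUni l) = substVar l a := by
      ext i
      by_cases hi : i = l
      · subst hi; simp [substVar, toUni]
      · simp [substVar, toUni, hi]
    have := congrArg (fun f : MvPolynomial (Fin n) L →ₐ[L] MvPolynomial (Fin n) L => f g) this
    simpa [Polynomial.aeval_def, Polynomial.eval₂_eq_eval_map] using this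
  · rw [Polynomial.degree_eq_natDegree ht.toUni_monic.1.ne_zero, ht.toUni_monic.2]
    exact toUni_degree_lt hg

theorem remEval_mul_of_notMem {l : Fin n} (t : MvPolynomial (Fin n) L) (a : L)
    {u : MvPolynomial (Fin n) L} (hu : ∀ e ∈ u.support, e l = 0) (g : MvPolynomial (Fin n) L) :
    remEval l t a (u * g) = u * remEval l t a g := by
  simp only [remEval_apply]
  rw [map_mul, toUni_eq_C hu, ← Polynomial.smul_eq_C_mul, Polynomial.smul_modByMonic,
    Polynomial.eval_smul, smul_eq_mul]

theorem remEval_mul_self [Nontrivial L] {l : Fin n} {d : ℕ} {t : MvPolynomial (Fin n) L}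
    (ht : IsMonicIn l d t) (a : L) (g : MvPolynomial (Fin n) L) :
    remEval l t a (t * g) = 0 := by
  rw [remEval_apply, map_mul,
    (Polynomial.modByMonic_eq_zero_iff_dvd ht.toUni_monic.1).2 (dvd_mul_right _ _),
    Polynomial.eval_zero]

theorem substVar_of_notMem {l : Fin n} (a : L) {g : MvPolynomial (Fin n) L}
    (hg : ∀ e ∈ g.support, e l = 0) : substVar l a g = g := by
  conv_lhs => rw [g.as_sum, map_sum]
  conv_rhs => rw [g.as_sum]
  refine Finset.sum_congr rfl fun e he => ?_
  rw [substVar_monomial, hg e he, pow_zero, mul_one]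
  rw [Finsupp.erase_of_notMem_support (by simpa using hg e he)]

theorem substVar_mem_supported {l : Fin n} (a : L) {g : MvPolynomial (Fin n) L} {s : Set (Fin n)}
    (hg : g ∈ supported L s) : substVar l a g ∈ supported L (s \ {l}) := by
  rw [mem_supported_iff_support] at hg ⊢
  intro e he i hi
  obtain ⟨e', he', rfl⟩ := exists_of_mem_support_substVar he
  have hil : i ≠ l := by
    rintro rfl
    simp at hi
  exact ⟨hg e' he' i (by simpa [hil] using hi), hil⟩

/-- Division by `t_0, …, t_{k-1}` in turn, each followed by the evaluation of its main
variable. -/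
noncomputable def remEvalUpTo (t : Fin n → MvPolynomial (Fin n) L) (r : Fin n → L) :
    ℕ → MvPolynomial (Fin n) L →ₗ[L] MvPolynomial (Fin n) L
  | 0 => LinearMap.id
  | k + 1 => if h : k < n then remEval ⟨k, h⟩ (t ⟨k, h⟩) (r ⟨k, h⟩) ∘ₗ remEvalUpTo t r k
      else remEvalUpTo t r k

/-- The value at `r` of the normal form of a polynomial modulo the triangular set `t`. -/
noncomputable def normalEval (t : Fin n → MvPolynomial (Fin n) L) (r : Fin n → L) :
    MvPolynomial (Fin n) L →ₗ[L] L :=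
  (aeval r).toLinearMap ∘ₗ remEvalUpTo t r n

theorem normalEval_apply (t : Fin n → MvPolynomial (Fin n) L) (r : Fin n → L)
    (g : MvPolynomial (Fin n) L) : normalEval t r g = eval r (remEvalUpTo t r n g) := by
  simp [normalEval, MvPolynomial.aeval_eq_eval]

theorem remEvalUpTo_succ (t : Fin n → MvPolynomial (Fin n) L) (r : Fin n → L) (l : Fin n)
    (g : MvPolynomial (Fin n) L) :
    remEvalUpTo t r (l + 1) g = remEval l (t l) (r l) (remEvalUpTo t r l g) := by
  simp [remEvalUpTo]

variable [Nontrivial L] {t : Fin n → MvPolynomial (Fin n) L} {d : Fin n → ℕ}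
  (ht : ∀ l, IsMonicIn l (d l) (t l)) (hd : ∀ l, 0 < d l) (r : Fin n → L)

include ht hd in
theorem remEvalUpTo_eq_self {k m : ℕ} (hm : m ≤ k) {g : MvPolynomial (Fin n) L}
    (hg : g ∈ supported L {i : Fin n | k ≤ i}) : remEvalUpTo t r m g = g := by
  induction m with
  | zero => rfl
  | succ m ih =>
    by_cases hmn : m < n
    · have h0 : ∀ e ∈ g.support, e (⟨m, hmn⟩ : Fin n) = 0 :=
        eq_zero_of_mem_supported hg (by simp; omega)
      rw [show m + 1 = ((⟨m, hmn⟩ : Fin n) : ℕ) + 1 from rfl, remEvalUpTo_succ]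
      simp only
      rw [ih (by omega), remEval_of_degree_lt (ht _) _ fun e he => by rw [h0 e he]; exact hd _,
        substVar_of_notMem _ h0]
    · simp only [remEvalUpTo, hmn, dif_neg, not_false_eq_true]
      exact ih (by omega)

include ht hd in
theorem normalEval_C (a : L) : normalEval t r (C a) = a := by
  rw [normalEval_apply, remEvalUpTo_eq_self ht hd r le_rfl (k := n), eval_C]
  rw [mem_supported_iff_support]
  intro e he i hi
  have := support_monomial_subset (s := (0 : Fin n →₀ ℕ)) (a := a) he
  simp only [Finset.mem_singleton] at this
  simp [this] at hi

/-- On polynomials in `x_k, x_{k+1}, …` only the members `t_k, t_{k+1}, …` of the triangular set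
matter. -/
theorem normalEval_congr {t' : Fin n → MvPolynomial (Fin n) L} {d' : Fin n → ℕ}
    (ht : ∀ l, IsMonicIn l (d l) (t l)) (hd : ∀ l, 0 < d l)
    (ht' : ∀ l, IsMonicIn l (d' l) (t' l)) (hd' : ∀ l, 0 < d' l) {k : ℕ}
    (h : ∀ l : Fin n, k ≤ l → t l = t' l) {g : MvPolynomial (Fin n) L}
    (hg : g ∈ supported L {i : Fin n | k ≤ i}) : normalEval t r g = normalEval t' r g := by
  have key : ∀ m, remEvalUpTo t r m g = remEvalUpTo t' r m g := by
    intro m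
    induction m with
    | zero => rfl
    | succ m ih =>
      rcases Nat.lt_or_ge m k with hm | hm
      · rw [remEvalUpTo_eq_self ht hd r hm hg, remEvalUpTo_eq_self ht' hd' r hm hg]
      · by_cases hmn : m < n
        · simp only [remEvalUpTo, hmn, dif_pos, LinearMap.comp_apply, ih, h ⟨m, hmn⟩ hm]
        · simp only [remEvalUpTo, hmn, dif_neg, not_false_eq_true, ih]
  rw [normalEval_apply, normalEval_apply, key]

/-- The divisions by `t_0, …, t_{j-1}` treat `t_j` as a constant, and the division by `t_j` then
yields zero. -/
theorem normalEval_mul_eq_zero (ht : ∀ l, IsMonicIn l (d l) (t l)) {j : Fin n}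
    (hj : t j ∈ supported L {i : Fin n | j ≤ i}) (g : MvPolynomial (Fin n) L) :
    normalEval t r (t j * g) = 0 := by
  have h1 : ∀ m : ℕ, m ≤ j → remEvalUpTo t r m (t j * g) = t j * remEvalUpTo t r m g := by
    intro m hm
    induction m with
    | zero => rfl
    | succ m ih =>
      have hmn : m < n := by omega
      have h0 : ∀ e ∈ (t j).support, e (⟨m, hmn⟩ : Fin n) = 0 :=
        eq_zero_of_mem_supported hj (by simp only [Set.mem_ofPred_eq, Fin.le_def]; omega)
      simp only [remEvalUpTo, hmn, dif_pos, LinearMap.comp_apply, ih (by omega)]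
      rw [remEval_mul_of_notMem _ _ h0]
  have h2 : ∀ m : ℕ, (j : ℕ) + 1 ≤ m → remEvalUpTo t r m (t j * g) = 0 := by
    intro m hm
    induction m, hm using Nat.le_induction with
    | base => rw [remEvalUpTo_succ, h1 _ le_rfl, remEval_mul_self (ht j)]
    | succ m hm ih =>
      simp only [remEvalUpTo]
      split_ifs
      · simp [ih]
      · exact ih
  rw [normalEval_apply, h2 n j.2, map_zero]

/-- The functional `normalEval t r` vanishes on the ideal generated by the triangular set. -/
theorem normalEval_eq_zero_of_mem (ht : ∀ l, IsMonicIn l (d l) (t l))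
    (hs : ∀ j, t j ∈ supported L {i : Fin n | j ≤ i}) {g : MvPolynomial (Fin n) L}
    (hg : g ∈ Ideal.span (Set.range t)) : normalEval t r g = 0 := by
  obtain ⟨c, rfl⟩ := (Ideal.mem_span_range_iff_exists_fun).1 hg
  rw [map_sum]
  refine Finset.sum_eq_zero fun j _ => ?_
  rw [mul_comm]
  exact normalEval_mul_eq_zero r ht (hs j) _

include ht hd in
/-- If `g` involves only `x_l, x_{l+1}, …` and is reduced with respect to `x_l`, then `x_l` may be
evaluated before the normal form is computed. -/
theorem normalEval_substVar {l : Fin n} {g : MvPolynomial (Fin n) L}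
    (hg : g ∈ supported L {i : Fin n | l ≤ i}) (hlt : ∀ e ∈ g.support, e l < d l) :
    normalEval t r g = normalEval t r (substVar l (r l) g) := by
  have hs : substVar l (r l) g ∈ supported L {i : Fin n | (l : ℕ) + 1 ≤ i} := by
    refine supported_mono ?_ (substVar_mem_supported (l := l) (r l) hg)
    rintro i ⟨hi, hil⟩
    simp only [Set.mem_ofPred_eq, Set.mem_singleton_iff] at hi hil ⊢
    have : l < i := lt_of_le_of_ne hi (Ne.symm hil)
    exact this
  have h1 : remEvalUpTo t r (l + 1) g = remEvalUpTo t r (l + 1) (substVar l (r l) g) := by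
    rw [remEvalUpTo_eq_self ht hd r le_rfl hs, remEvalUpTo_succ,
      remEvalUpTo_eq_self ht hd r le_rfl (k := (l : ℕ)) hg, remEval_of_degree_lt (ht l) _ hlt]
  have h2 : ∀ m : ℕ, (l : ℕ) + 1 ≤ m →
      remEvalUpTo t r m g = remEvalUpTo t r m (substVar l (r l) g) := by
    intro m hm
    induction m, hm using Nat.le_induction with
    | base => exact h1
    | succ m hm ih =>
      simp only [remEvalUpTo]
      split_ifs
      · simp [ih]
      · exact ih
  rw [normalEval_apply, normalEval_apply, h2 n l.2]

/-- A reduced polynomial is its own normal form. -/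
theorem normalEval_of_inBox (ht : ∀ l, IsMonicIn l (d l) (t l)) {g : MvPolynomial (Fin n) L}
    (hg : InBox d g) : normalEval t r g = eval r g := by
  have key : ∀ m, InBox d (remEvalUpTo t r m g) ∧
      eval r (remEvalUpTo t r m g) = eval r g := by
    intro m
    induction m with
    | zero => exact ⟨hg, rfl⟩
    | succ m ih =>
      simp only [remEvalUpTo]
      split_ifs with hmn
      · rw [LinearMap.comp_apply,
          remEval_of_degree_lt (ht _) _ fun e he => ih.1 e he _, eval_substVar]
        refine ⟨?_, ih.2⟩
        intro e he i
        obtain ⟨e', he', rfl⟩ := exists_of_mem_support_substVar he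
        refine lt_of_le_of_lt ?_ (ih.1 e' he' i)
        rw [Finsupp.erase_apply]
        split_ifs <;> simp
      · exact ih
  rw [normalEval_apply, (key n).2]

end NormalForm

/-! ### Reduction modulo a box of monic polynomials -/

section Box

open MvPolynomial

variable {n : ℕ}

/-- The exponents that are smaller than `b` in each variable. -/
noncomputable def box (b : Fin n → ℕ) : Finset (Fin n →₀ ℕ) :=
  (Fintype.piFinset fun i => Finset.range (b i)).map Finsupp.equivFunOnFinite.symm.toEmbedding

theorem mem_box {b : Fin n → ℕ} {e : Fin n →₀ ℕ} : e ∈ box b ↔ ∀ i, e i < b i := by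
  simp only [box, Finset.mem_map, Fintype.mem_piFinset, Finset.mem_range]
  constructor
  · rintro ⟨a, ha, rfl⟩ i
    exact ha i
  · intro h
    exact ⟨e, h, Finsupp.equivFunOnFinite.symm_apply_apply e⟩

theorem card_box (b : Fin n → ℕ) : (box b).card = ∏ i, b i := by
  simp [box]

/-- The bound `q` for the variables in `Y`, and no occurrence of the other variables. -/
def cap (q : ℕ) (Y : Finset (Fin n)) (i : Fin n) : ℕ := if i ∈ Y then q else 1

theorem card_box_cap (q : ℕ) (Y : Finset (Fin n)) : (box (cap q Y)).card = q ^ Y.card := by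
  rw [card_box]
  simp [cap]

variable {R : Type*} [CommRing R]

theorem inBox_iff {b : Fin n → ℕ} {p : MvPolynomial (Fin n) R} :
    InBox b p ↔ p.support ⊆ box b :=
  ⟨fun h _ he => mem_box.2 (h _ he), fun h _ he => mem_box.1 (h he)⟩

theorem InBox.mono {b b' : Fin n → ℕ} {p : MvPolynomial (Fin n) R} (h : InBox b p)
    (hb : ∀ i, b i ≤ b' i) : InBox b' p :=
  fun e he i => (h e he i).trans_le (hb i)

theorem cap_mono {q : ℕ} (hq : 0 < q) {Y Y' : Finset (Fin n)} (h : Y ⊆ Y') (i : Fin n) :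
    cap q Y i ≤ cap q Y' i := by
  unfold cap
  by_cases h1 : i ∈ Y
  · simp [h1, h h1]
  · simp only [h1, if_false]
    split_ifs <;> omega

/-- The coefficients of a polynomial (including `0`). -/
def coeffSet (p : MvPolynomial (Fin n) R) : Set R := Set.range fun e => p.coeff e

theorem coeffSet_X_mul (p : MvPolynomial (Fin n) R) (j : Fin n) {S : Set R} (h0 : (0 : R) ∈ S)
    (h : coeffSet p ⊆ S) : coeffSet (X j * p) ⊆ S := by
  classical
  rintro _ ⟨e, rfl⟩
  simp only [coeff_X_mul']
  split_ifs
  · exact h ⟨_, rfl⟩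
  · exact h0

theorem coeffSet_monomial_one_mul (p : MvPolynomial (Fin n) R) (a : Fin n →₀ ℕ) {S : Set R}
    (h0 : (0 : R) ∈ S) (h : coeffSet p ⊆ S) : coeffSet (monomial a 1 * p) ⊆ S := by
  classical
  rintro _ ⟨e, rfl⟩
  simp only [coeff_monomial_mul']
  split_ifs
  · rw [one_mul]; exact h ⟨_, rfl⟩
  · exact h0

theorem exists_of_mem_support_monomial_mul {p : MvPolynomial (Fin n) R} {a e : Fin n →₀ ℕ}
    (h : e ∈ (monomial a 1 * p).support) : ∃ e' ∈ p.support, e = a + e' := by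
  classical
  rw [mem_support_iff, coeff_monomial_mul'] at h
  split_ifs at h with h1
  · exact ⟨e - a, by simpa using h, (add_tsub_cancel_of_le h1).symm⟩
  · exact absurd rfl h

section

variable [Div R]

theorem Computes.coeffSet {S : Set R} {p : MvPolynomial (Fin n) R} {B : Finset (Fin n →₀ ℕ)}
    {c j : ℕ} (h0 : (0 : R) ∈ S) (hp : p.support ⊆ B)
    (h : ∀ e ∈ B, Computes c S {p.coeff e}) (hj : B.card * c ≤ j) :
    Computes j S (coeffSet p) := by
  refine ((Computes.biUnion_const B h hj).keep).mono le_rfl subset_rfl ?_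
  rintro _ ⟨e, rfl⟩
  by_cases he : e ∈ B
  · exact .inr (Set.mem_biUnion he rfl)
  · have : e ∉ p.support := fun h => he (hp h)
    rw [notMem_support_iff] at this
    simp only [this]
    exact .inl h0

end

/-- The terms of `p` with exponents in `B` are kept, and each monomial `x ^ e` with `e` in `E` is
replaced by `T e`. -/
noncomputable def replaceTerms (B E : Finset (Fin n →₀ ℕ))
    (T : (Fin n →₀ ℕ) → MvPolynomial (Fin n) R) (p : MvPolynomial (Fin n) R) :
    MvPolynomial (Fin n) R :=
  ∑ e ∈ B, monomial e (p.coeff e) + ∑ e ∈ E, C (p.coeff e) * T e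

theorem support_replaceTerms {B E : Finset (Fin n →₀ ℕ)}
    {T : (Fin n →₀ ℕ) → MvPolynomial (Fin n) R} (hT : ∀ e ∈ E, (T e).support ⊆ B)
    (p : MvPolynomial (Fin n) R) : (replaceTerms B E T p).support ⊆ B := by
  classical
  refine support_add.trans (Finset.union_subset ?_ ?_)
  · refine support_sum.trans (Finset.biUnion_subset.2 fun e he => ?_)
    exact support_monomial_subset.trans (by simpa using he)
  · refine support_sum.trans (Finset.biUnion_subset.2 fun e he => ?_)
    rw [← smul_eq_C_mul]
    exact support_smul.trans (hT e he)

theorem coeff_replaceTerms {B E : Finset (Fin n →₀ ℕ)}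
    {T : (Fin n →₀ ℕ) → MvPolynomial (Fin n) R} (p : MvPolynomial (Fin n) R)
    {e : Fin n →₀ ℕ} (he : e ∈ B) :
    (replaceTerms B E T p).coeff e = p.coeff e + ∑ a ∈ E, p.coeff a * (T a).coeff e := by
  classical
  simp [replaceTerms, coeff_sum, coeff_monomial, coeff_C_mul, he]

theorem sub_replaceTerms_mem {B E : Finset (Fin n →₀ ℕ)}
    {T : (Fin n →₀ ℕ) → MvPolynomial (Fin n) R} {p : MvPolynomial (Fin n) R}
    {I : Ideal (MvPolynomial (Fin n) R)} (hBE : Disjoint B E) (hp : p.support ⊆ B ∪ E)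
    (hT : ∀ e ∈ E, monomial e 1 - T e ∈ I) : p - replaceTerms B E T p ∈ I := by
  classical
  have : p = ∑ e ∈ B, monomial e (p.coeff e) + ∑ e ∈ E, monomial e (p.coeff e) := by
    rw [← Finset.sum_union hBE]
    conv_lhs => rw [p.as_sum]
    refine Finset.sum_subset hp fun e _ he => ?_
    rw [notMem_support_iff.1 he, monomial_zero]
  have h2 : p - replaceTerms B E T p = ∑ e ∈ E, C (p.coeff e) * (monomial e 1 - T e) := by
    conv_lhs => rw [replaceTerms]; enter [1]; rw [this]
    rw [add_sub_add_left_eq_sub, ← Finset.sum_sub_distrib]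
    refine Finset.sum_congr rfl fun e _ => ?_
    rw [mul_sub, C_mul_monomial, mul_one]
  rw [h2]
  exact Ideal.sum_mem _ fun e he => Ideal.mul_mem_left _ _ (hT e he)

open Classical in
/-- The cost of replacing terms depends on the number `M` of replacements that contribute to a
given coefficient. -/
theorem computes_replaceTerms [Div R] {S : Set R} (h0 : (0 : R) ∈ S)
    {B E : Finset (Fin n →₀ ℕ)} {T : (Fin n →₀ ℕ) → MvPolynomial (Fin n) R}
    {p : MvPolynomial (Fin n) R} (hp : coeffSet p ⊆ S) (hT : ∀ e ∈ E, (T e).support ⊆ B)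
    (hTS : ∀ e ∈ E, coeffSet (T e) ⊆ S) {M j : ℕ}
    (hM : ∀ β ∈ B, (E.filter fun e => (T e).coeff β ≠ 0).card ≤ M) (hj : B.card * (2 * M) ≤ j) :
    Computes j S (coeffSet (replaceTerms B E T p)) := by
  refine Computes.coeffSet h0 (support_replaceTerms hT p) (c := 2 * M) (fun β hβ => ?_) hj
  rw [coeff_replaceTerms p hβ]
  rw [← Finset.sum_filter_of_ne (p := fun e => (T e).coeff β ≠ 0)
    (fun e _ h => right_ne_zero_of_mul h)]
  refine (Computes.add_sum_mul _ (hp ⟨_, rfl⟩) (fun e _ => hp ⟨_, rfl⟩)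
    (fun e he => hTS e (Finset.mem_filter.1 he).1 ⟨_, rfl⟩)).mono
    (Nat.mul_le_mul_left 2 (hM β hβ)) subset_rfl subset_rfl

/-- Normal forms of the monomials `x_j ^ q * x ^ γ`, where `γ` involves only variables of `Z`
smaller than `x_j`. -/
def IsTable (I : Ideal (MvPolynomial (Fin n) R)) (q : ℕ) (Z : Finset (Fin n))
    (T : Fin n → (Fin n →₀ ℕ) → MvPolynomial (Fin n) R) : Prop :=
  ∀ j ∈ Z, ∀ γ ∈ box (cap q (Z.filter (j < ·))),
    InBox (cap q (Z.filter (j ≤ ·))) (T j γ) ∧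
      monomial (Finsupp.single j q + γ) 1 - T j γ ∈ I

/-- The coefficients of the normal forms in a table. -/
def tableSet (q : ℕ) (Z : Finset (Fin n))
    (T : Fin n → (Fin n →₀ ℕ) → MvPolynomial (Fin n) R) : Set R :=
  ⋃ j ∈ Z, ⋃ γ ∈ box (cap q (Z.filter (j < ·))), coeffSet (T j γ)

/-- Multiplication by `x_j` in the quotient ring. Only terms of degree `q` in `x_j` have to be
replaced. The replacements, which come from the table, change the exponents of `x_j` and of the
smaller variables only, so that few of them contribute to a given coefficient. -/
theorem exists_mul_X [Div R] {I : Ideal (MvPolynomial (Fin n) R)} {q : ℕ}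
    {Z : Finset (Fin n)} {T : Fin n → (Fin n →₀ ℕ) → MvPolynomial (Fin n) R}
    (hT : IsTable I q Z T) {S : Set R} (h0 : (0 : R) ∈ S) (hTS : tableSet q Z T ⊆ S)
    {j : Fin n} (hj : j ∈ Z) {b : Fin n → ℕ} (hb : ∀ m, j ≤ m → b m = cap q Z m)
    {p : MvPolynomial (Fin n) R} (hp : InBox b p) (hpS : coeffSet p ⊆ S) :
    ∃ p', InBox b p' ∧ X j * p - p' ∈ I ∧
      Computes ((box b).card * (2 * q ^ (Z.filter (j < ·)).card)) S (coeffSet p') := by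
  classical
  -- the exponents of the terms that leave the box
  set E : Finset (Fin n →₀ ℕ) :=
    (box (Function.update b j (q + 1))).filter fun e => e j = q with hE
  set U : (Fin n →₀ ℕ) → MvPolynomial (Fin n) R := fun e =>
    monomial (e.filter (· < j)) 1 * T j (e.filter (j < ·)) with hU
  have hbj : b j = q := by rw [hb j le_rfl]; simp [cap, hj]
  have hEmem : ∀ e ∈ E, e j = q ∧ ∀ m, m ≠ j → e m < b m := by
    intro e he
    rw [hE, Finset.mem_filter, mem_box] at he
    refine ⟨he.2, fun m hm => ?_⟩
    simpa [hm] using he.1 m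
  have hγ : ∀ e ∈ E, e.filter (j < ·) ∈ box (cap q (Z.filter (j < ·))) := by
    intro e he
    rw [mem_box]
    intro m
    rw [Finsupp.filter_apply]
    by_cases hm : j < m
    · have := (hEmem e he).2 m hm.ne'
      rw [hb m hm.le] at this
      simpa [hm, cap] using this
    · simp [hm, cap]
  have hUsupp : ∀ e ∈ E, ∀ β ∈ (U e).support,
      (∀ m, m < j → β m = e m) ∧ ∀ m, j ≤ m → β m < b m := by
    intro e he β hβ
    obtain ⟨η, hη, rfl⟩ := exists_of_mem_support_monomial_mul hβ
    have h1 := (hT j hj _ (hγ e he)).1 η hη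
    constructor
    · intro m hm
      have := h1 m
      simp only [cap, Finset.mem_filter, not_le.2 hm, and_false, if_false] at this
      simp [hm]; omega
    · intro m hm
      have := h1 m
      rw [hb m hm]
      simpa [cap, hm, not_lt.2 hm] using this
  have hUB : ∀ e ∈ E, (U e).support ⊆ box b := by
    intro e he β hβ
    rw [mem_box]
    intro m
    rcases lt_or_ge m j with hm | hm
    · rw [(hUsupp e he β hβ).1 m hm]
      exact (hEmem e he).2 m hm.ne
    · exact (hUsupp e he β hβ).2 m hm
  have hXsupp : (X j * p).support ⊆ box b ∪ E := by
    intro e he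
    rw [X] at he
    obtain ⟨e', he', rfl⟩ := exists_of_mem_support_monomial_mul he
    have h1 := hp e' he'
    rw [Finset.mem_union]
    by_cases h2 : e' j + 1 = q
    · right
      rw [hE, Finset.mem_filter, mem_box]
      refine ⟨fun m => ?_, by simp; omega⟩
      by_cases hm : m = j
      · subst hm; simp; omega
      · have := h1 m
        simp [hm, this]
    · left
      rw [mem_box]
      intro m
      by_cases hm : m = j
      · subst hm
        have := h1 m
        simp only [Finsupp.add_apply, Finsupp.single_eq_same]
        omega
      · have := h1 m
        simp [this, Ne.symm hm]
  have hdisj : Disjoint (box b) E := by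
    rw [Finset.disjoint_left]
    intro e he he'
    have := mem_box.1 he j
    have := (hEmem e he').1
    omega
  refine ⟨replaceTerms (box b) E U (X j * p), inBox_iff.2 (support_replaceTerms hUB _),
    sub_replaceTerms_mem hdisj hXsupp fun e he => ?_, ?_⟩
  · have : (monomial e 1 : MvPolynomial (Fin n) R) =
        monomial (e.filter (· < j)) 1 *
          monomial (Finsupp.single j q + e.filter (j < ·)) 1 := by
      rw [monomial_mul, one_mul]
      refine congrArg (fun a => (monomial a 1 : MvPolynomial (Fin n) R)) ?_
      ext m
      simp only [Finsupp.add_apply, Finsupp.filter_apply, Finsupp.single_apply]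
      rcases lt_trichotomy m j with h | h | h
      · simp [h, h.ne', not_lt.2 h.le]
      · subst h; simp [(hEmem e he).1]
      · simp [h, h.ne, not_lt.2 h.le]
    rw [this, hU, ← mul_sub]
    exact Ideal.mul_mem_left _ _ (hT j hj _ (hγ e he)).2
  · refine computes_replaceTerms h0 (coeffSet_X_mul p j h0 hpS) hUB (fun e he => ?_)
      (M := q ^ (Z.filter (j < ·)).card) (fun β hβ => ?_) le_rfl
    · refine coeffSet_monomial_one_mul _ _ h0 (subset_trans ?_ hTS)
      exact Set.subset_biUnion_of_mem (u := fun γ => coeffSet (T j γ)) (hγ e he)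
        |>.trans (Set.subset_biUnion_of_mem
          (u := fun j => ⋃ γ ∈ box (cap q (Z.filter (j < ·))), coeffSet (T j γ)) hj)
    · -- given `β`, the exponent `e` is determined by its part in the variables below `x_j`
      rw [← card_box_cap]
      refine Finset.card_le_card_of_injOn (fun e => e.filter (j < ·)) ?_ ?_
      · intro e he
        exact hγ e (Finset.mem_filter.1 he).1
      · intro e he e' he' hee
        obtain ⟨he, h1⟩ := Finset.mem_filter.1 (Finset.mem_coe.1 he)
        obtain ⟨he', h1'⟩ := Finset.mem_filter.1 (Finset.mem_coe.1 he')
        ext m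
        rcases lt_trichotomy m j with h | h | h
        · rw [← (hUsupp e he β (by simpa using h1)).1 m h,
            (hUsupp e' he' β (by simpa using h1')).1 m h]
        · subst h
          rw [(hEmem e he).1, (hEmem e' he').1]
        · have := DFunLike.congr_fun hee m
          simpa [Finsupp.filter_apply, h] using this

/-- The powers `x_j ^ k g` with `k < q`, in the quotient ring. -/
theorem exists_X_pow_mul [Div R] {I : Ideal (MvPolynomial (Fin n) R)} {q : ℕ}
    {Z : Finset (Fin n)} {T : Fin n → (Fin n →₀ ℕ) → MvPolynomial (Fin n) R}
    (hT : IsTable I q Z T) {S : Set R} (h0 : (0 : R) ∈ S) (hTS : tableSet q Z T ⊆ S)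
    {j : Fin n} (hj : j ∈ Z) {b : Fin n → ℕ} (hb : ∀ m, j ≤ m → b m = cap q Z m)
    {g : MvPolynomial (Fin n) R} (hg : InBox b g) (hgS : coeffSet g ⊆ S) (k : ℕ) :
    ∃ u : ℕ → MvPolynomial (Fin n) R, (∀ i ≤ k, InBox b (u i) ∧ X j ^ i * g - u i ∈ I) ∧
      Computes (k * ((box b).card * (2 * q ^ (Z.filter (j < ·)).card))) S
        (⋃ i ∈ Finset.range (k + 1), coeffSet (u i)) := by
  induction k with
  | zero =>
    refine ⟨fun _ => g, fun i hi => ?_, .done (by simpa using hgS)⟩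
    obtain rfl : i = 0 := by omega
    exact ⟨hg, by simp⟩
  | succ k ih =>
    obtain ⟨u, hu, hc⟩ := ih
    set V := ⋃ i ∈ Finset.range (k + 1), coeffSet (u i)
    obtain ⟨p', hp', hmem, hc'⟩ := exists_mul_X hT (S := S ∪ V) (.inl h0)
      (hTS.trans Set.subset_union_left) hj hb (hu k le_rfl).1
      ((Set.subset_biUnion_of_mem (u := fun i => coeffSet (u i))
        (Finset.mem_coe.2 (Finset.self_mem_range_succ k))).trans Set.subset_union_right)
    refine ⟨fun i => if i = k + 1 then p' else u i, fun i hi => ?_, ?_⟩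
    · by_cases hik : i = k + 1
      · subst hik
        simp only [if_true]
        refine ⟨hp', ?_⟩
        have : X j ^ (k + 1) * g - p' = X j * (X j ^ k * g - u k) + (X j * u k - p') := by ring
        rw [this]
        exact Ideal.add_mem _ (Ideal.mul_mem_left _ _ (hu k le_rfl).2) hmem
      · simp only [hik, if_false]
        exact hu i (by omega)
    · refine (hc.trans hc').mono (Nat.succ_mul _ _).ge subset_rfl ?_
      refine Set.iUnion₂_subset fun i hi => ?_
      by_cases hik : i = k + 1
      · simp [hik]
      · simp only [hik, if_false]
        rw [Finset.mem_range] at hi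
        exact (Set.subset_biUnion_of_mem (u := fun i => coeffSet (u i))
          (Finset.mem_coe.2 (Finset.mem_range.2 (by omega : i < k + 1)))).trans
          Set.subset_union_left

/-- The products `x ^ γ g`, where `γ` runs through the exponents in the variables of `W`, in the
quotient ring. The larger variables come first in the recursion: there are then few
multiplications by each of them, which compensates for the larger tables they need. -/
theorem exists_monomial_mul [Div R] {I : Ideal (MvPolynomial (Fin n) R)} {q : ℕ} (hq : 0 < q)
    {Z : Finset (Fin n)} {T : Fin n → (Fin n →₀ ℕ) → MvPolynomial (Fin n) R}
    (hT : IsTable I q Z T) {b : Fin n → ℕ} (W : Finset (Fin n)) :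
    W ⊆ Z → (∀ w ∈ W, ∀ m, w ≤ m → b m = cap q Z m ∧ (m ∈ Z → m ∈ W)) →
    ∀ {S : Set R}, (0 : R) ∈ S → tableSet q Z T ⊆ S →
    ∀ {g : MvPolynomial (Fin n) R}, InBox b g → coeffSet g ⊆ S →
    ∃ P : (Fin n →₀ ℕ) → MvPolynomial (Fin n) R,
      (∀ γ ∈ box (cap q W), InBox b (P γ) ∧ monomial γ 1 * g - P γ ∈ I) ∧
      Computes (2 * W.card * (box b).card * q ^ W.card) S
        (⋃ γ ∈ box (cap q W), coeffSet (P γ)) := by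
  classical
  induction W using Finset.induction_on_min with
  | empty =>
    intro _ _ S h0 hTS g hg hgS
    refine ⟨fun _ => g, fun γ hγ => ⟨hg, ?_⟩, .done (by simpa using fun _ _ => hgS)⟩
    have : γ = 0 := by
      ext i
      have := mem_box.1 hγ i
      simp [cap] at this
      simp [this]
    simp [this]
  | insert a W haW ih =>
    intro hWZ hW S h0 hTS g hg hgS
    have haZ : a ∈ Z := hWZ (Finset.mem_insert_self _ _)
    have haW' : a ∉ W := fun h => lt_irrefl _ (haW a h)
    have hfil : Z.filter (a < ·) = W := by
      ext m
      rw [Finset.mem_filter]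
      constructor
      · rintro ⟨hm, ham⟩
        have := (hW a (Finset.mem_insert_self _ _) m ham.le).2 hm
        rcases Finset.mem_insert.1 this with rfl | h
        · exact absurd ham (lt_irrefl _)
        · exact h
      · intro hm
        exact ⟨hWZ (Finset.mem_insert_of_mem hm), haW m hm⟩
    obtain ⟨u, hu, hc⟩ := exists_X_pow_mul hT h0 hTS haZ
      (fun m hm => (hW a (Finset.mem_insert_self _ _) m hm).1) hg hgS (q - 1)
    rw [hfil] at hc
    set V := ⋃ i ∈ Finset.range (q - 1 + 1), coeffSet (u i) with hV
    have hIH : ∀ k ∈ Finset.range q, ∃ P : (Fin n →₀ ℕ) → MvPolynomial (Fin n) R,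
        (∀ γ ∈ box (cap q W), InBox b (P γ) ∧ monomial γ 1 * u k - P γ ∈ I) ∧
        Computes (2 * W.card * (box b).card * q ^ W.card) (S ∪ V)
          (⋃ γ ∈ box (cap q W), coeffSet (P γ)) := by
      intro k hk
      rw [Finset.mem_range] at hk
      refine ih ((Finset.subset_insert _ _).trans hWZ) (fun w hw m hm => ?_) (.inl h0)
        (hTS.trans Set.subset_union_left) (hu k (by omega)).1
        ((Set.subset_biUnion_of_mem (u := fun i => coeffSet (u i))
          (Finset.mem_coe.2 (Finset.mem_range.2 (by omega : k < q - 1 + 1)))).trans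
          Set.subset_union_right)
      have := hW w (Finset.mem_insert_of_mem hw) m hm
      refine ⟨this.1, fun h => ?_⟩
      rcases Finset.mem_insert.1 (this.2 h) with rfl | h'
      · exact absurd (haW w hw) (not_lt.2 hm)
      · exact h'
    choose! P hP hPc using hIH
    refine ⟨fun γ => P (γ a) (γ.erase a), fun γ hγ => ?_, ?_⟩
    · have hγ' := mem_box.1 hγ
      have hk : γ a < q := by simpa [cap] using hγ' a
      have he : γ.erase a ∈ box (cap q W) := by
        rw [mem_box]
        intro i
        by_cases hi : i = a
        · subst hi; simp [cap, haW']
        · simpa [cap, hi] using hγ' i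
      have h1 := hP (γ a) (Finset.mem_range.2 hk) _ he
      refine ⟨h1.1, ?_⟩
      have h2 : (monomial γ 1 : MvPolynomial (Fin n) R) =
          monomial (γ.erase a) 1 * X a ^ γ a := by
        rw [X_pow_eq_monomial, monomial_mul, mul_one, Finsupp.erase_add_single]
      have : monomial γ 1 * g - P (γ a) (γ.erase a) =
          monomial (γ.erase a) 1 * (X a ^ γ a * g - u (γ a)) +
            (monomial (γ.erase a) 1 * u (γ a) - P (γ a) (γ.erase a)) := by
        rw [h2]; ring
      rw [this]
      exact Ideal.add_mem _ (Ideal.mul_mem_left _ _ (hu _ (by omega)).2) h1.2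
    · refine (hc.bind (Computes.biUnion_const (Finset.range q) (fun k hk => hPc k hk) le_rfl)
        ?_).mono le_rfl subset_rfl ?_
      · rw [Finset.card_insert_of_notMem haW', Finset.card_range, pow_succ]
        obtain ⟨q', rfl⟩ : ∃ q', q = q' + 1 := ⟨q - 1, by omega⟩
        simp only [Nat.add_sub_cancel]
        set A := (box b).card
        set B := (q' + 1) ^ W.card
        nlinarith [Nat.zero_le (A * B)]
      · refine Set.iUnion₂_subset fun γ hγ => ?_
        have hγ' := mem_box.1 hγ
        have hk : γ a < q := by simpa [cap] using hγ' a
        have he : γ.erase a ∈ box (cap q W) := by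
          rw [mem_box]
          intro i
          by_cases hi : i = a
          · subst hi; simp [cap, haW']
          · simpa [cap, hi] using hγ' i
        exact (Set.subset_biUnion_of_mem (u := fun δ => coeffSet (P (γ a) δ)) he).trans
          (Set.subset_biUnion_of_mem
            (u := fun k => ⋃ δ ∈ box (cap q W), coeffSet (P k δ))
            (Finset.mem_coe.2 (Finset.mem_range.2 hk)))

end Box

section NodeStep

open MvPolynomial

variable {n : ℕ} {R : Type*} [CommRing R]

/-- The tables are computed from the monic polynomials `x_i ^ q - tail i`, starting with the
smallest variable. -/
theorem exists_isTable [Div R] {I : Ideal (MvPolynomial (Fin n) R)} {q : ℕ} (hq : 0 < q)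
    {S : Set R} (h0 : (0 : R) ∈ S) (tail : Fin n → MvPolynomial (Fin n) R)
    (Z : Finset (Fin n))
    (hbox : ∀ i ∈ Z, InBox (cap q (Z.filter (i ≤ ·))) (tail i))
    (hI : ∀ i ∈ Z, X i ^ q - tail i ∈ I) (hS : ∀ i ∈ Z, coeffSet (tail i) ⊆ S) :
    ∃ T, IsTable I q Z T ∧
      Computes (2 * Z.card ^ 2 * q ^ (2 * Z.card)) S (tableSet q Z T) := by
  classical
  induction Z using Finset.induction_on_min with
  | empty =>
    exact ⟨fun _ _ => 0, by simp [IsTable], .done (by simp [tableSet])⟩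
  | insert a Z haZ ih =>
    have haZ' : a ∉ Z := fun h => lt_irrefl _ (haZ a h)
    have hf1 : ∀ i ∈ Z, (insert a Z).filter (i ≤ ·) = Z.filter (i ≤ ·) := by
      intro i hi
      rw [Finset.filter_insert, if_neg (not_le.2 (haZ i hi))]
    have hf2 : ∀ i ∈ Z, (insert a Z).filter (i < ·) = Z.filter (i < ·) := by
      intro i hi
      rw [Finset.filter_insert, if_neg (not_lt.2 (haZ i hi).le)]
    have hf3 : (insert a Z).filter (a < ·) = Z := by
      rw [Finset.filter_insert, if_neg (lt_irrefl _), Finset.filter_true_of_mem haZ]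
    have hf4 : (insert a Z).filter (a ≤ ·) = insert a Z := by
      apply Finset.filter_true_of_mem
      intro i hi
      rcases Finset.mem_insert.1 hi with rfl | h
      exacts [le_rfl, (haZ i h).le]
    obtain ⟨T, hT, hc⟩ := ih (fun i hi => hf1 i hi ▸ hbox i (Finset.mem_insert_of_mem hi))
      (fun i hi => hI i (Finset.mem_insert_of_mem hi))
      (fun i hi => hS i (Finset.mem_insert_of_mem hi))
    have ha := Finset.mem_insert_self a Z
    obtain ⟨P, hP, hPc⟩ := exists_monomial_mul hq hT (b := cap q (insert a Z)) Z subset_rfl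
      (fun w hw m hm => ⟨by
        have : m ≠ a := by rintro rfl; exact absurd (haZ w hw) (not_lt.2 hm)
        simp [cap, this], id⟩) (S := S ∪ tableSet q Z T) (.inl h0) Set.subset_union_right
      (hf4 ▸ hbox a ha) ((hS a ha).trans Set.subset_union_left)
    refine ⟨Function.update T a P, ?_, ?_⟩
    · intro j hj γ hγ
      rcases Finset.mem_insert.1 hj with rfl | hj'
      · rw [hf3] at hγ
        rw [hf4, Function.update_self]
        refine ⟨(hP γ hγ).1, ?_⟩
        have : monomial (Finsupp.single j q + γ) 1 - P γ =
            monomial γ 1 * (X j ^ q - tail j) + (monomial γ 1 * tail j - P γ) := by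
          rw [X_pow_eq_monomial, mul_sub, monomial_mul, one_mul, add_comm γ]; ring
        rw [this]
        exact Ideal.add_mem _ (Ideal.mul_mem_left _ _ (hI j ha)) (hP γ hγ).2
      · have hja : j ≠ a := fun h => haZ' (h ▸ hj')
        rw [hf2 j hj'] at hγ
        rw [hf1 j hj', Function.update_of_ne hja]
        exact hT j hj' γ hγ
    · refine (hc.trans hPc).mono ?_ subset_rfl ?_
      · rw [Finset.card_insert_of_notMem haZ', card_box_cap,
          Finset.card_insert_of_notMem haZ']
        set z := Z.card
        have h1 : q ^ (2 * z) ≤ q ^ (2 * (z + 1)) := Nat.pow_le_pow_right hq (by omega)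
        have h2 : q ^ (z + 1) * q ^ z ≤ q ^ (2 * (z + 1)) := by
          rw [← pow_add]; exact Nat.pow_le_pow_right hq (by omega)
        calc 2 * z ^ 2 * q ^ (2 * z) + 2 * z * q ^ (z + 1) * q ^ z
            = 2 * z ^ 2 * q ^ (2 * z) + 2 * z * (q ^ (z + 1) * q ^ z) := by ring
          _ ≤ 2 * z ^ 2 * q ^ (2 * (z + 1)) + 2 * z * q ^ (2 * (z + 1)) := by gcongr
          _ = (2 * z ^ 2 + 2 * z) * q ^ (2 * (z + 1)) := by ring
          _ ≤ 2 * (z + 1) ^ 2 * q ^ (2 * (z + 1)) := by gcongr; nlinarith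
      · rw [tableSet, Finset.set_biUnion_insert]
        refine Set.union_subset ?_ ?_
        · rw [hf3, Function.update_self]
          exact Set.subset_union_right
        · refine Set.iUnion₂_subset fun j hj => ?_
          have hja : j ≠ a := by rintro rfl; exact haZ' hj
          rw [hf2 j hj, Function.update_of_ne hja]
          exact (Set.subset_biUnion_of_mem
            (u := fun j => ⋃ γ ∈ box (cap q (Z.filter (j < ·))), coeffSet (T j γ)) hj).trans
            Set.subset_union_left

theorem card_box_update_le {q : ℕ} {Z : Finset (Fin n)} {l : Fin n} {k : ℕ}
    (hk : k ≤ q) : (box (Function.update (cap q (insert l Z)) l k)).card ≤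
      q ^ (insert l Z).card := by
  rw [← card_box_cap]
  refine Finset.card_le_card fun e he => ?_
  rw [mem_box] at he ⊢
  intro i
  by_cases hi : i = l
  · subst hi
    have := he i
    simp [cap] at this ⊢
    omega
  · simpa [hi] using he i

/-- One step of the division with respect to `x_l` by `x_l ^ d - tail`, in the quotient ring:
the terms of degree `k` in `x_l` are removed. -/
theorem exists_division_step [Div R] {I : Ideal (MvPolynomial (Fin n) R)} {q : ℕ}
    {Z : Finset (Fin n)} {l : Fin n} (hlZ : l ∉ Z) {d k : ℕ} (hdk : d ≤ k) (hkq : k < q)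
    {P : (Fin n →₀ ℕ) → MvPolynomial (Fin n) R}
    (hP : ∀ γ ∈ box (cap q Z), InBox (Function.update (cap q (insert l Z)) l d) (P γ) ∧
      monomial (Finsupp.single l d + γ) 1 - P γ ∈ I)
    {S : Set R} (h0 : (0 : R) ∈ S) (hPS : ∀ γ ∈ box (cap q Z), coeffSet (P γ) ⊆ S)
    {H : MvPolynomial (Fin n) R} (hH : InBox (Function.update (cap q (insert l Z)) l (k + 1)) H)
    (hHS : coeffSet H ⊆ S) :
    ∃ G, InBox (Function.update (cap q (insert l Z)) l k) G ∧ H - G ∈ I ∧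
      Computes (q ^ (insert l Z).card * (2 * q ^ Z.card)) S (coeffSet G) := by
  classical
  set b : ℕ → Fin n → ℕ := fun k => Function.update (cap q (insert l Z)) l k with hb
  -- the exponents of the terms to be removed
  set E : Finset (Fin n →₀ ℕ) := (box (b (k + 1))).filter fun e => e l = k with hE
  set U : (Fin n →₀ ℕ) → MvPolynomial (Fin n) R := fun e =>
    monomial (Finsupp.single l (k - d)) 1 * P (e.erase l) with hU
  have hbne : ∀ k m, m ≠ l → b k m = cap q Z m := by
    intro k m hm
    simp [hb, hm, cap]
  have hγ : ∀ e ∈ E, e.erase l ∈ box (cap q Z) := by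
    intro e he
    rw [hE, Finset.mem_filter, mem_box] at he
    rw [mem_box]
    intro m
    by_cases hm : m = l
    · subst hm; simp [cap, hlZ]
    · rw [Finsupp.erase_ne hm, ← hbne (k + 1) m hm]
      exact he.1 m
  have hUB : ∀ e ∈ E, (U e).support ⊆ box (b k) := by
    intro e he β hβ
    obtain ⟨η, hη, rfl⟩ := exists_of_mem_support_monomial_mul hβ
    have h1 := (hP _ (hγ e he)).1 η hη
    rw [mem_box]
    intro m
    have := h1 m
    by_cases hm : m = l
    · subst hm
      simp [hb] at this ⊢
      omega
    · rw [hbne k m hm]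
      rw [show Function.update (cap q (insert l Z)) l d m = b d m from rfl,
        hbne d m hm] at this
      simpa [hm] using this
  have hsupp : H.support ⊆ box (b k) ∪ E := by
    intro e he
    have h1 := hH e he
    rw [Finset.mem_union]
    by_cases h2 : e l = k
    · right
      rw [hE, Finset.mem_filter, mem_box]
      exact ⟨h1, h2⟩
    · left
      rw [mem_box]
      intro m
      have h3 := h1 m
      by_cases hm : m = l
      · subst hm
        simp [hb] at h3 ⊢
        omega
      · rw [hbne k m hm]
        rwa [show Function.update (cap q (insert l Z)) l (k + 1) m = b (k + 1) m from rfl,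
          hbne _ m hm] at h3
  have hdisj : Disjoint (box (b k)) E := by
    rw [Finset.disjoint_left]
    intro e he he'
    have h1 := mem_box.1 he l
    have h2 := (Finset.mem_filter.1 he').2
    simp [hb] at h1
    omega
  refine ⟨replaceTerms (box (b k)) E U H, inBox_iff.2 (support_replaceTerms hUB _),
    sub_replaceTerms_mem hdisj hsupp fun e he => ?_, ?_⟩
  · have : (monomial e 1 : MvPolynomial (Fin n) R) =
        monomial (Finsupp.single l (k - d)) 1 *
          monomial (Finsupp.single l d + e.erase l) 1 := by
      rw [monomial_mul, one_mul]
      refine congrArg (fun a => (monomial a 1 : MvPolynomial (Fin n) R)) ?_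
      rw [← add_assoc, ← Finsupp.single_add, Nat.sub_add_cancel hdk,
        ← (Finset.mem_filter.1 he).2, Finsupp.single_add_erase]
    rw [this, hU, ← mul_sub]
    exact Ideal.mul_mem_left _ _ (hP _ (hγ e he)).2
  · refine computes_replaceTerms h0 hHS hUB (fun e he => ?_) (M := q ^ Z.card)
      (fun β hβ => ?_) (Nat.mul_le_mul_right _ (card_box_update_le hkq.le))
    · exact coeffSet_monomial_one_mul _ _ h0 (hPS _ (hγ e he))
    · -- the exponents in `E` agree in `x_l`
      rw [← card_box_cap]
      refine Finset.card_le_card_of_injOn (fun e => e.erase l) ?_ ?_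
      · intro e he
        exact hγ e (Finset.mem_filter.1 he).1
      · intro e he e' he' hee
        have h1 := (Finset.mem_filter.1 (Finset.mem_filter.1 he).1).2
        have h2 := (Finset.mem_filter.1 (Finset.mem_filter.1 he').1).2
        rw [← Finsupp.single_add_erase l e, ← Finsupp.single_add_erase l e', h1, h2]
        exact congrArg _ hee

/-- Division with respect to `x_l` by `x_l ^ d - tail`, in the quotient ring. -/
theorem exists_division [Div R] {I : Ideal (MvPolynomial (Fin n) R)} {q : ℕ} (hq : 0 < q)
    {Z : Finset (Fin n)} {l : Fin n} (hlZ : ∀ m ∈ Z, l < m)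
    {T : Fin n → (Fin n →₀ ℕ) → MvPolynomial (Fin n) R} (hT : IsTable I q Z T)
    {S : Set R} (h0 : (0 : R) ∈ S) (hTS : tableSet q Z T ⊆ S) {d : ℕ} (hdq : d ≤ q)
    {tail : MvPolynomial (Fin n) R} (ht : InBox (Function.update (cap q (insert l Z)) l d) tail)
    (htI : X l ^ d - tail ∈ I) (htS : coeffSet tail ⊆ S) {H : MvPolynomial (Fin n) R}
    (hH : InBox (cap q (insert l Z)) H) (hHS : coeffSet H ⊆ S) :
    ∃ G, InBox (Function.update (cap q (insert l Z)) l d) G ∧ H - G ∈ I ∧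
      Computes (2 * (insert l Z).card * q ^ (2 * (insert l Z).card)) S (coeffSet G) := by
  classical
  have hlZ' : l ∉ Z := fun h => lt_irrefl _ (hlZ l h)
  obtain ⟨P, hP, hPc⟩ := exists_monomial_mul hq hT
    (b := Function.update (cap q (insert l Z)) l d) Z subset_rfl
    (fun w hw m hm => ⟨by
      have : m ≠ l := by rintro rfl; exact absurd (hlZ w hw) (not_lt.2 hm)
      simp [cap, this], id⟩) h0 hTS ht htS
  set V := ⋃ γ ∈ box (cap q Z), coeffSet (P γ)
  have hP' : ∀ γ ∈ box (cap q Z), InBox (Function.update (cap q (insert l Z)) l d) (P γ) ∧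
      monomial (Finsupp.single l d + γ) 1 - P γ ∈ I := by
    intro γ hγ
    refine ⟨(hP γ hγ).1, ?_⟩
    have : monomial (Finsupp.single l d + γ) 1 - P γ =
        monomial γ 1 * (X l ^ d - tail) + (monomial γ 1 * tail - P γ) := by
      rw [X_pow_eq_monomial, mul_sub, monomial_mul, one_mul, add_comm γ]; ring
    rw [this]
    exact Ideal.add_mem _ (Ideal.mul_mem_left _ _ htI) (hP γ hγ).2
  -- after `j` steps the degree in `x_l` is less than `q - j`
  have key : ∀ j, j + d ≤ q → ∃ G,
      InBox (Function.update (cap q (insert l Z)) l (q - j)) G ∧ H - G ∈ I ∧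
      Computes (j * (q ^ (insert l Z).card * (2 * q ^ Z.card))) (S ∪ V) (coeffSet G) := by
    intro j
    induction j with
    | zero =>
      intro _
      refine ⟨H, ?_, by simp, .done (hHS.trans Set.subset_union_left)⟩
      have : Function.update (cap q (insert l Z)) l (q - 0) = cap q (insert l Z) := by
        rw [Function.update_eq_self_iff]; simp [cap]
      rwa [this]
    | succ j ih =>
      intro hj
      obtain ⟨G, hG, hGI, hGc⟩ := ih (by omega)
      obtain ⟨G', hG', hGI', hGc'⟩ := exists_division_step (k := q - (j + 1)) hlZ'
        (by omega) (by omega) hP' (S := S ∪ V ∪ coeffSet G) (.inl (.inl h0))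
        (fun γ hγ => (Set.subset_biUnion_of_mem (u := fun γ => coeffSet (P γ)) hγ).trans
          (Set.subset_union_right.trans Set.subset_union_left))
        (H := G) (by rwa [show q - (j + 1) + 1 = q - j by omega]) Set.subset_union_right
      refine ⟨G', hG', ?_, hGc.bind hGc' (Nat.succ_mul _ _).ge⟩
      have : H - G' = (H - G) + (G - G') := by ring
      rw [this]
      exact Ideal.add_mem _ hGI hGI'
  obtain ⟨G, hG, hGI, hGc⟩ := key (q - d) (by omega)
  rw [show q - (q - d) = d by omega] at hG
  refine ⟨G, hG, hGI, hPc.bind hGc ?_⟩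
  have hcard : (insert l Z).card = Z.card + 1 := Finset.card_insert_of_notMem hlZ'
  have h1 := card_box_update_le (Z := Z) (l := l) hdq
  rw [hcard] at h1 ⊢
  set z := Z.card
  set B := (box (Function.update (cap q (insert l Z)) l d)).card
  have h2 : q ^ (z + 1) * q ^ z ≤ q ^ (2 * (z + 1)) := by
    rw [← pow_add]; exact Nat.pow_le_pow_right hq (by omega)
  calc 2 * z * B * q ^ z + (q - d) * (q ^ (z + 1) * (2 * q ^ z))
      ≤ 2 * z * q ^ (z + 1) * q ^ z + q * (q ^ (z + 1) * (2 * q ^ z)) := by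
        gcongr; omega
    _ = 2 * z * (q ^ (z + 1) * q ^ z) + 2 * q ^ (2 * (z + 1)) := by
        rw [two_mul (z + 1), pow_add q (z + 1) (z + 1), pow_succ q z]; ring
    _ ≤ 2 * z * q ^ (2 * (z + 1)) + 2 * q ^ (2 * (z + 1)) := by gcongr
    _ = 2 * (z + 1) * q ^ (2 * (z + 1)) := by ring

theorem computes_pow [Div R] {S : Set R} (h1 : (1 : R) ∈ S) {r : R} (hr : r ∈ S) (k : ℕ) :
    Computes k S (⋃ i ∈ Finset.range (k + 1), {r ^ i}) := by
  induction k with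
  | zero => exact .done (by simpa using h1)
  | succ k ih =>
    refine (ih.trans (Computes.mul (a := r ^ k) (b := r) (.inr ?_) (.inl hr))).mono le_rfl
      subset_rfl ?_
    · exact Set.mem_biUnion (Finset.mem_coe.2 (Finset.self_mem_range_succ k)) rfl
    · refine Set.iUnion₂_subset fun i hi => ?_
      rw [Finset.mem_range] at hi
      rw [Set.singleton_subset_iff]
      rcases Nat.lt_or_ge i (k + 1) with h | h
      · exact .inl (Set.mem_biUnion (Finset.mem_coe.2 (Finset.mem_range.2 h)) rfl)
      · obtain rfl : i = k + 1 := by omega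
        exact .inr (by rw [pow_succ]; rfl)

theorem inBox_substVar {q : ℕ} {Z : Finset (Fin n)} {l : Fin n} (hlZ : l ∉ Z)
    {d : ℕ} {r : R} {G : MvPolynomial (Fin n) R}
    (hG : InBox (Function.update (cap q (insert l Z)) l d) G) :
    InBox (cap q Z) (substVar l r G) := by
  intro e he i
  obtain ⟨e', he', rfl⟩ := exists_of_mem_support_substVar he
  by_cases hi : i = l
  · subst hi; simp [cap, hlZ]
  · have := hG e' he' i
    simpa [hi, cap] using this

theorem computes_substVar [Div R] {q : ℕ} {Z : Finset (Fin n)} {l : Fin n} (hlZ : l ∉ Z)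
    {d : ℕ} (hdq : d ≤ q) {S : Set R} (h0 : (0 : R) ∈ S) (h1 : (1 : R) ∈ S) {r : R}
    (hr : r ∈ S) {G : MvPolynomial (Fin n) R}
    (hG : InBox (Function.update (cap q (insert l Z)) l d) G) (hGS : coeffSet G ⊆ S) :
    Computes (q + q ^ Z.card * (2 * q)) S (coeffSet (substVar l r G)) := by
  classical
  set B := box (Function.update (cap q (insert l Z)) l d)
  refine (computes_pow h1 hr q).bind
    (Computes.coeffSet (B := box (cap q Z)) (c := 2 * q) (.inl h0)
      (inBox_iff.1 (inBox_substVar hlZ hG)) (fun β hβ => ?_) (by rw [card_box_cap])) le_rfl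
  have hsum : (substVar l r G).coeff β =
      0 + ∑ e ∈ B.filter (fun e => e.erase l = β), G.coeff e * r ^ e l := by
    conv_lhs => rw [G.as_sum, map_sum]
    rw [Finset.sum_subset (inBox_iff.1 hG) (by
      intro e _ he
      rw [notMem_support_iff.1 he, monomial_zero, map_zero]), coeff_sum, Finset.sum_filter,
      zero_add]
    refine Finset.sum_congr rfl fun e _ => ?_
    rw [substVar_monomial, coeff_monomial]
  rw [hsum]
  have hlt : ∀ e ∈ B.filter (fun e => e.erase l = β), e l < d := by
    intro e he
    have := mem_box.1 (Finset.mem_filter.1 he).1 l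
    simpa using this
  refine (Computes.add_sum_mul _ (.inl h0) (fun e _ => .inl (hGS ⟨_, rfl⟩)) (fun e he => .inr
    (Set.mem_biUnion (Finset.mem_coe.2 (Finset.mem_range.2 (by
      have := hlt e he; omega : e l < q + 1))) rfl))).mono ?_ subset_rfl subset_rfl
  refine Nat.mul_le_mul_left 2 (le_trans ?_ hdq)
  conv_rhs => rw [← Finset.card_range d]
  refine Finset.card_le_card_of_injOn (fun e => e l) ?_ ?_
  · intro e he
    exact Finset.mem_coe.2 (Finset.mem_range.2 (hlt e he))
  · intro e he e' he' hee
    have h1 := (Finset.mem_filter.1 he).2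
    have h2 := (Finset.mem_filter.1 he').2
    rw [← Finsupp.single_add_erase l e, ← Finsupp.single_add_erase l e', h1, h2]
    exact congrArg (fun k => Finsupp.single l k + β) hee

/-- The work at one node: division by the node polynomial `x_l ^ d - tail` (which is void if
`d > q`), followed by the evaluation at `x_l = r`. -/
theorem exists_reduce_eval [Div R] {I : Ideal (MvPolynomial (Fin n) R)} {q : ℕ} (hq : 0 < q)
    {Z : Finset (Fin n)} {l : Fin n} (hlZ : ∀ m ∈ Z, l < m)
    {T : Fin n → (Fin n →₀ ℕ) → MvPolynomial (Fin n) R} (hT : IsTable I q Z T)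
    {S : Set R} (h0 : (0 : R) ∈ S) (h1 : (1 : R) ∈ S) (hTS : tableSet q Z T ⊆ S) {d : ℕ}
    {tail : MvPolynomial (Fin n) R}
    (ht : d ≤ q → InBox (Function.update (cap q (insert l Z)) l d) tail)
    (htI : X l ^ d - tail ∈ I) (htS : d ≤ q → coeffSet tail ⊆ S) {r : R} (hr : r ∈ S)
    {H : MvPolynomial (Fin n) R}
    (hH : InBox (cap q (insert l Z)) H) (hHS : coeffSet H ⊆ S) :
    ∃ G, InBox (Function.update (cap q (insert l Z)) l (min d q)) G ∧ H - G ∈ I ∧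
      Computes (5 * (insert l Z).card * q ^ (2 * (insert l Z).card)) S
        (coeffSet (substVar l r G)) := by
  classical
  have hlZ' : l ∉ Z := fun h => lt_irrefl _ (hlZ l h)
  obtain ⟨G, hG, hGI, hGc⟩ : ∃ G, InBox (Function.update (cap q (insert l Z)) l (min d q)) G ∧
      H - G ∈ I ∧
      Computes (2 * (insert l Z).card * q ^ (2 * (insert l Z).card)) S (coeffSet G) := by
    rcases le_or_gt d q with hd | hd
    · rw [min_eq_left hd]
      exact exists_division hq hlZ hT h0 hTS hd (ht hd) htI (htS hd) hH hHS
    · rw [min_eq_right hd.le]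
      refine ⟨H, ?_, by simp, .done hHS⟩
      have : Function.update (cap q (insert l Z)) l q = cap q (insert l Z) := by
        rw [Function.update_eq_self_iff]; simp [cap]
      rwa [this]
  refine ⟨G, hG, hGI, hGc.bind (computes_substVar hlZ' (min_le_right d q) (.inl h0) (.inl h1)
    (.inl hr) hG Set.subset_union_right) ?_⟩
  rw [Finset.card_insert_of_notMem hlZ']
  set z := Z.card
  have h2 : q ^ z * (2 * q) ≤ 2 * q ^ (2 * (z + 1)) := by
    have : q ^ (z + 1) ≤ q ^ (2 * (z + 1)) := Nat.pow_le_pow_right hq (by omega)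
    rw [pow_succ] at this
    linarith
  have h3 : q ≤ q ^ (2 * (z + 1)) := by
    calc q = q ^ 1 := (pow_one q).symm
      _ ≤ _ := Nat.pow_le_pow_right hq (by omega)
  have h4 : q ^ (2 * (z + 1)) ≤ (z + 1) * q ^ (2 * (z + 1)) :=
    Nat.le_mul_of_pos_left _ (by omega)
  linarith

end NodeStep

/-! ### Summation over the chains of a network -/

section Chains

variable {n N : ℕ} (G : SimpleGraph (Fin n)) (rank : Fin N → Fin n)
  (Arc : Fin N → Fin N → Prop)

/-- Chains of the ranked directed graph `(rank, Arc)`. -/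
def IsChainOf (C : Fin n → Fin N) : Prop :=
  (∀ l, rank (C l) = l) ∧ ∀ l p, IsParent G l p → Arc (C l) (C p)

open Classical in
/-- The nodes `u` of rank `c` that lie on some chain and are joined by an arc to the node that
`C` selects at the parent of `x_c`, if there is a parent. -/
noncomputable def childNodes (C : Fin n → Fin N) (c : Fin n) : Finset (Fin N) :=
  Finset.univ.filter fun u => rank u = c ∧ (∃ D, IsChainOf G rank Arc D ∧ D c = u) ∧
    ∀ p, IsParent G c p → Arc u (C p)

theorem IsParent.lt {G : SimpleGraph (Fin n)} {l p : Fin n} (h : IsParent G l p) : l < p :=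
  h.1.1

theorem IsParent.unique {G : SimpleGraph (Fin n)} {l p p' : Fin n} (h : IsParent G l p)
    (h' : IsParent G l p') : p = p' :=
  IsLeast.unique h h'

variable {G rank Arc}

theorem childNodes_congr {C C' : Fin n → Fin N} {c : Fin n}
    (h : ∀ p, IsParent G c p → C p = C' p) :
    childNodes G rank Arc C c = childNodes G rank Arc C' c := by
  classical
  unfold childNodes
  refine Finset.filter_congr fun u _ => and_congr_right fun _ => and_congr_right fun _ => ?_
  exact forall₂_congr fun p hp => by rw [h p hp]

/-- A chain may be replaced below (and at) `x_k` by another chain, provided that the new node of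
rank `k` is joined to the old node at the parent. -/
theorem exists_merge {C D : Fin n → Fin N} (hC : IsChainOf G rank Arc C)
    (hD : IsChainOf G rank Arc D) {k : Fin n} (h : ∀ p, IsParent G k p → Arc (D k) (C p)) :
    ∃ E, IsChainOf G rank Arc E ∧ E k = D k ∧ ∀ m, k < m → E m = C m := by
  classical
  have hle : ∀ m, Relation.ReflTransGen (IsParent G) m k → m ≤ k := by
    intro m hm
    induction hm using Relation.ReflTransGen.head_induction_on with
    | refl => exact le_rfl
    | head h _ ih => exact h.lt.le.trans ih
  refine ⟨fun m => if Relation.ReflTransGen (IsParent G) m k then D m else C m,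
    ⟨fun l => ?_, fun l p hlp => ?_⟩, by simp [Relation.ReflTransGen.refl], fun m hm => ?_⟩
  · simp only
    split_ifs
    exacts [hD.1 l, hC.1 l]
  · simp only
    by_cases hp : Relation.ReflTransGen (IsParent G) p k
    · rw [if_pos hp, if_pos (Relation.ReflTransGen.head hlp hp)]
      exact hD.2 l p hlp
    · rw [if_neg hp]
      split_ifs with hl
      · rcases Relation.ReflTransGen.cases_head hl with rfl | ⟨p', hp', h'⟩
        · exact h p hlp
        · rw [hp'.unique hlp] at h'
          exact absurd h' hp
      · exact hC.2 l p hlp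
  · refine if_neg ?_
    exact fun h => absurd (hle m h) (not_le.2 hm)

end Chains

section ChainSum

open MvPolynomial

variable {n N : ℕ} {G : SimpleGraph (Fin n)} {rank : Fin N → Fin n}
  {Arc : Fin N → Fin N → Prop} {R : Type*} [CommRing R]

/-- Pairs of polynomials, multiplied as dual numbers: the first component is the total weight of
the partial chains below a node, the second one is the weighted sum of the reduced parts of `h`
that they contribute. -/
abbrev Pair (n : ℕ) (R : Type*) [CommRing R] := DualNumber (MvPolynomial (Fin n) R)

/-- The weighted sum of the pairs `D u` over the nodes `u` that may be chosen at rank `c`. -/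
noncomputable def message (G : SimpleGraph (Fin n)) (rank : Fin N → Fin n)
    (Arc : Fin N → Fin N → Prop) (y : Fin N → R) (D : Fin N → Pair n R)
    (C : Fin n → Fin N) (c : Fin n) : Pair n R :=
  ∑ u ∈ childNodes G rank Arc C c, y u • D u

open Classical in
/-- The pair collected at a node `v` of rank `l`, before the reduction: the product of `1 + h_l δ`
and of the messages of the children of `x_l`. -/
noncomputable def collect (G : SimpleGraph (Fin n)) (rank : Fin N → Fin n)
    (Arc : Fin N → Fin N → Prop) (y : Fin N → R) (h : Fin n → MvPolynomial (Fin n) R)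
    (D : Fin N → Pair n R) (v : Fin N) : Pair n R :=
  (1 + TrivSqZeroExt.inr (h (rank v))) *
    ∏ c ∈ Finset.univ.filter fun c => IsParent G c (rank v),
      message G rank Arc y D (fun _ => v) c

/-- The first component is a scalar and the second one involves only `x_k, x_{k+1}, …`. -/
def IsPairFrom (k : ℕ) (x : Pair n R) : Prop :=
  (∃ a, x.fst = C a) ∧ x.snd ∈ supported R {i : Fin n | k ≤ i}

theorem snd_mul_of_fst {x y : Pair n R} {a b : R} (hx : x.fst = C a) (hy : y.fst = C b) :
    (x * y).snd = a • y.snd + b • x.snd := by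
  rw [TrivSqZeroExt.snd_mul, op_smul_eq_smul, hx, hy, smul_eq_mul, smul_eq_mul, smul_eq_C_mul,
    smul_eq_C_mul]

theorem IsPairFrom.mul {k : ℕ} {x y : Pair n R} (hx : IsPairFrom k x) (hy : IsPairFrom k y) :
    IsPairFrom k (x * y) := by
  obtain ⟨⟨a, ha⟩, hx⟩ := hx
  obtain ⟨⟨b, hb⟩, hy⟩ := hy
  refine ⟨⟨a * b, by simp [ha, hb]⟩, ?_⟩
  rw [TrivSqZeroExt.snd_mul, ha, hb]
  refine add_mem ?_ ?_
  · exact mul_mem (Subalgebra.algebraMap_mem (supported R {i : Fin n | k ≤ i}) a) hy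
  · rw [op_smul_eq_smul]
    exact mul_mem (Subalgebra.algebraMap_mem (supported R {i : Fin n | k ≤ i}) b) hx

theorem isPairFrom_one (k : ℕ) : IsPairFrom k (1 : Pair n R) :=
  ⟨⟨1, by simp⟩, by simp [zero_mem]⟩

theorem IsPairFrom.prod {α : Type*} {k : ℕ} {s : Finset α} {x : α → Pair n R}
    (h : ∀ i ∈ s, IsPairFrom k (x i)) : IsPairFrom k (∏ i ∈ s, x i) :=
  Finset.prod_induction _ _ (fun _ _ => IsPairFrom.mul) (isPairFrom_one k) h

theorem IsPairFrom.sum_smul {α : Type*} {k : ℕ} {s : Finset α} {w : α → R} {x : α → Pair n R}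
    (h : ∀ i ∈ s, IsPairFrom k (x i)) : IsPairFrom k (∑ i ∈ s, w i • x i) := by
  refine Finset.sum_induction _ (IsPairFrom k) ?_ ⟨⟨0, by simp⟩, by simp [zero_mem]⟩ ?_
  · rintro x y ⟨⟨a, ha⟩, hx⟩ ⟨⟨b, hb⟩, hy⟩
    exact ⟨⟨a + b, by simp [ha, hb]⟩, by simpa using add_mem hx hy⟩
  · intro i hi
    obtain ⟨⟨a, ha⟩, hx⟩ := h i hi
    refine ⟨⟨w i * a, by simp [ha, smul_eq_C_mul]⟩, ?_⟩
    rw [TrivSqZeroExt.snd_smul]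
    exact Subalgebra.smul_mem _ hx _

theorem IsPairFrom.one_add_inr {k : ℕ} {g : MvPolynomial (Fin n) R}
    (hg : g ∈ supported R {i : Fin n | k ≤ i}) :
    IsPairFrom k (1 + TrivSqZeroExt.inr g : Pair n R) :=
  ⟨⟨1, by simp⟩, by simpa using hg⟩

theorem snd_prod_one_add_inr {α : Type*} (s : Finset α) (h : α → MvPolynomial (Fin n) R) :
    (∏ m ∈ s, (1 + TrivSqZeroExt.inr (h m) : Pair n R)).fst = 1 ∧
      (∏ m ∈ s, (1 + TrivSqZeroExt.inr (h m) : Pair n R)).snd = ∑ m ∈ s, h m := by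
  classical
  induction s using Finset.induction_on with
  | empty => simp
  | insert a s ha ih =>
    rw [Finset.prod_insert ha, Finset.sum_insert ha]
    rw [TrivSqZeroExt.fst_mul, TrivSqZeroExt.snd_mul, ih.1, ih.2]
    simp [add_comm]

theorem message_congr (y : Fin N → R) (D : Fin N → Pair n R) {C C' : Fin n → Fin N} {c : Fin n}
    (h : ∀ p, IsParent G c p → C p = C' p) :
    message G rank Arc y D C c = message G rank Arc y D C' c := by
  rw [message, message, childNodes_congr h]

/-- A message only involves variables `x_k, x_{k+1}, …` if the parent of `x_c` is among them. -/
theorem isPairFrom_message {y : Fin N → R} {D : Fin N → Pair n R}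
    (hDW : ∀ v, ∃ a, (D v).fst = C a)
    (hDs : ∀ v, (D v).snd ∈ supported R {m | rank v < m ∧ G.Adj (rank v) m})
    (A : Fin n → Fin N) {c : Fin n} {k : ℕ} (hk : ∀ p, IsParent G c p → k ≤ p) :
    IsPairFrom k (message G rank Arc y D A c) := by
  classical
  refine IsPairFrom.sum_smul fun u hu => ⟨hDW u, supported_mono ?_ (hDs u)⟩
  have hr : rank u = c := (Finset.mem_filter.1 hu).2.1
  intro m hm
  rw [hr] at hm
  -- the parent is the least element of this nonempty set
  obtain ⟨p, hp⟩ : ∃ p, IsParent G c p := by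
    refine ⟨(Finset.univ.filter fun m => c < m ∧ G.Adj c m).min' ⟨m, by simpa using hm⟩, ?_, ?_⟩
    · have := Finset.min'_mem (Finset.univ.filter fun m => c < m ∧ G.Adj c m)
        ⟨m, by simpa using hm⟩
      exact (Finset.mem_filter.1 this).2
    · intro m' hm'
      exact Finset.min'_le _ _ (by simpa using hm')
  exact (hk p hp).trans (hp.2 hm)

open Classical in
/-- The dynamic program computes a weighted sum over all chains: if the functionals `φ C` agree on
the collected and on the reduced pairs along each chain, then the product of the messages
of the roots of the elimination forest is `∑ C, (∏ l, y (C l)) * φ C (∑ l, h l)`. The proof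
eliminates the ranks one by one; `trunc` fills the eliminated ranks with those of a fixed
chain. -/
theorem sum_chains {y : Fin N → R} {h : Fin n → MvPolynomial (Fin n) R}
    {D : Fin N → Pair n R} {φ : (Fin n → Fin N) → MvPolynomial (Fin n) R →ₗ[R] R}
    (hloc : ∀ A A', (∀ l, rank (A l) = l) → (∀ l, rank (A' l) = l) →
      (∀ l, ∃ B, IsChainOf G rank Arc B ∧ B l = A l) →
      (∀ l, ∃ B, IsChainOf G rank Arc B ∧ B l = A' l) →
      ∀ (k : ℕ) g, g ∈ supported R {i : Fin n | k ≤ i} →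
      (∀ l : Fin n, k ≤ l → A l = A' l) → φ A g = φ A' g)
    (hh : ∀ l, h l ∈ supported R {i : Fin n | l ≤ i})
    (hDW : ∀ v, ∃ a, (D v).fst = C a)
    (hDs : ∀ v, (D v).snd ∈ supported R {m | rank v < m ∧ G.Adj (rank v) m})
    (hDfst : ∀ A, IsChainOf G rank Arc A → ∀ l,
      (D (A l)).fst = (collect G rank Arc y h D (A l)).fst)
    (hDφ : ∀ A, IsChainOf G rank Arc A → ∀ l,
      φ A (collect G rank Arc y h D (A l)).snd = φ A (D (A l)).snd)
    {A₀ : Fin n → Fin N} (hA₀ : IsChainOf G rank Arc A₀) :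
    φ A₀ (∏ c ∈ Finset.univ.filter fun c => ∀ p, ¬ IsParent G c p,
        message G rank Arc y D A₀ c).snd =
      ∑ A ∈ Finset.univ.filter (IsChainOf G rank Arc), (∏ l, y (A l)) * φ A (∑ l, h l) := by
  set chains := Finset.univ.filter (IsChainOf G rank Arc) with hchains
  -- `front k` consists of the eliminated ranks whose messages have not been collected yet, and
  -- `Θ k A` is the contribution of all chains that agree with `A` in the ranks from `k` on
  set trunc : ℕ → (Fin n → Fin N) → Fin n → Fin N :=
    fun k A m => if (m : ℕ) < k then A₀ m else A m with htrunc
  set front : ℕ → Finset (Fin n) := fun k =>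
    Finset.univ.filter fun c : Fin n => (c : ℕ) < k ∧ ∀ p, IsParent G c p → k ≤ (p : ℕ)
    with hfront
  set up : ℕ → Finset (Fin n) := fun k => Finset.univ.filter fun c : Fin n => k ≤ (c : ℕ)
    with hup
  set Θ : ℕ → (Fin n → Fin N) → R := fun k A => (∏ m ∈ up k, y (A m)) *
    φ A ((∏ m ∈ up k, (1 + TrivSqZeroExt.inr (h m) : Pair n R)) *
      ∏ c ∈ front k, message G rank Arc y D A c).snd with hΘ
  have hstep : ∀ k, k < n →
      ∑ A ∈ chains.image (trunc k), Θ k A = ∑ A ∈ chains.image (trunc (k + 1)), Θ (k + 1) A := by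
    intro k hkn
    set κ : Fin n := ⟨k, hkn⟩ with hκ
    have htt : ∀ A, trunc (k + 1) (trunc k A) = trunc (k + 1) A := by
      intro A
      funext m
      simp only [htrunc]
      split_ifs <;> first | rfl | omega
    rw [← Finset.sum_fiberwise_of_maps_to (s := chains.image (trunc k))
      (t := chains.image (trunc (k + 1))) (g := trunc (k + 1)) (by
        intro A hA
        obtain ⟨B, hB, rfl⟩ := Finset.mem_image.1 hA
        rw [htt]
        exact Finset.mem_image_of_mem _ hB)]
    refine Finset.sum_congr rfl fun A hA => ?_
    obtain ⟨B, hB, rfl⟩ := Finset.mem_image.1 hA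
    rw [hchains, Finset.mem_filter] at hB
    replace hB := hB.2
    set A := trunc (k + 1) B with hAdef
    have hAB : ∀ m : Fin n, k < m → A m = B m := by
      intro m hm
      simp only [hAdef, htrunc]
      rw [if_neg (by omega)]
    have hAA₀ : ∀ m : Fin n, (m : ℕ) ≤ k → A m = A₀ m := by
      intro m hm
      simp only [hAdef, htrunc]
      rw [if_pos (by omega)]
    have hArank : ∀ l, rank (A l) = l := by
      intro l
      rcases le_or_gt (l : ℕ) k with hl | hl
      · rw [hAA₀ l hl, hA₀.1]
      · rw [hAB l hl, hB.1]
    have hAch : ∀ l, ∃ B, IsChainOf G rank Arc B ∧ B l = A l := by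
      intro l
      rcases le_or_gt (l : ℕ) k with hl | hl
      · exact ⟨A₀, hA₀, (hAA₀ l hl).symm⟩
      · exact ⟨B, hB, (hAB l hl).symm⟩
    -- the chains in the fibre over `A`, up to truncation, arise by a choice of the node at `k`
    have hfib : (chains.image (trunc k)).filter (fun A' => trunc (k + 1) A' = A) =
        (childNodes G rank Arc A κ).image fun v => Function.update A κ v := by
      ext A'
      simp only [Finset.mem_filter, Finset.mem_image]
      constructor
      · rintro ⟨⟨B', hB', rfl⟩, hA'⟩
        rw [hchains, Finset.mem_filter] at hB'
        replace hB' := hB'.2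
        have hB'A : ∀ m : Fin n, k < m → B' m = A m := by
          intro m hm
          rw [← hA']
          simp only [htrunc]
          rw [if_neg (by omega), if_neg (by omega)]
        refine ⟨B' κ, ?_, ?_⟩
        · refine Finset.mem_filter.2 ⟨Finset.mem_univ _, hB'.1 κ, ⟨B', hB', rfl⟩, ?_⟩
          intro p hp
          rw [← hB'A p hp.lt]
          exact hB'.2 κ p hp
        · funext m
          rcases lt_trichotomy (m : ℕ) k with hm | hm | hm
          · have : m ≠ κ := by rintro rfl; simp [hκ] at hm
            rw [Function.update_of_ne this, hAA₀ m hm.le]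
            simp [htrunc, hm]
          · obtain rfl : m = κ := Fin.ext hm
            simp [htrunc, hκ]
          · have : m ≠ κ := by rintro rfl; simp [hκ] at hm
            rw [Function.update_of_ne this, ← hB'A m hm]
            simp [htrunc, not_lt.2 hm.le]
      · rintro ⟨v, hv, rfl⟩
        obtain ⟨-, hrv, ⟨B', hB', hB'v⟩, harc⟩ := Finset.mem_filter.1 hv
        obtain ⟨B'', hB'', hk1, hk2⟩ := exists_merge (k := κ) hB hB' (fun p hp => by
          rw [hB'v, ← hAB p hp.lt]; exact harc p hp)
        refine ⟨⟨B'', ?_, ?_⟩, ?_⟩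
        · rw [hchains]; exact Finset.mem_filter.2 ⟨Finset.mem_univ _, hB''⟩
        · funext m
          rcases lt_trichotomy (m : ℕ) k with hm | hm | hm
          · have : m ≠ κ := by rintro rfl; simp [hκ] at hm
            rw [Function.update_of_ne this, hAA₀ m hm.le]
            simp [htrunc, hm]
          · obtain rfl : m = κ := Fin.ext hm
            rw [Function.update_self, ← hB'v, ← hk1]
            simp [htrunc, hκ]
          · have : m ≠ κ := by rintro rfl; simp [hκ] at hm
            rw [Function.update_of_ne this, hAB m hm, ← hk2 m hm]
            simp [htrunc, not_lt.2 hm.le]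
        · funext m
          simp only [htrunc]
          split_ifs with hm
          · rw [hAA₀ m (by omega)]
          · have : m ≠ κ := by rintro rfl; simp [hκ] at hm
            rw [Function.update_of_ne this]
    rw [hfib, Finset.sum_image (by
      intro v _ v' _ hvv
      have := congrFun hvv κ
      simpa using this)]
    have hup1 : up k = insert κ (up (k + 1)) := by
      ext m
      simp only [hup, Finset.mem_filter, Finset.mem_univ, true_and, Finset.mem_insert, hκ,
        Fin.ext_iff]
      omega
    have hκup : κ ∉ up (k + 1) := by simp [hup, hκ]
    set rest := Finset.univ.filter fun c : Fin n => (c : ℕ) < k ∧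
      ∀ p, IsParent G c p → k + 1 ≤ (p : ℕ) with hrest
    set kids := Finset.univ.filter fun c : Fin n => IsParent G c κ with hkids
    have hfr1 : front k = kids ∪ rest := by
      ext c
      simp only [hfront, hkids, hrest, Finset.mem_filter, Finset.mem_univ, true_and,
        Finset.mem_union]
      constructor
      · rintro ⟨h1, h2⟩
        by_cases hc : IsParent G c κ
        · exact .inl hc
        · refine .inr ⟨h1, fun p hp => ?_⟩
          have := h2 p hp
          have h3 : (p : ℕ) ≠ k := fun h => hc ((Fin.ext h : p = κ) ▸ hp)
          omega
      · rintro (hc | ⟨h1, h2⟩)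
        · refine ⟨hc.lt, fun p hp => ?_⟩
          rw [hp.unique hc]
        · exact ⟨h1, fun p hp => by have := h2 p hp; omega⟩
    have hdisj : Disjoint kids rest := by
      rw [Finset.disjoint_left]
      intro c hc hc'
      have := (Finset.mem_filter.1 hc').2.2 κ (Finset.mem_filter.1 hc).2
      simp [hκ] at this
    have hfr2 : front (k + 1) = insert κ rest := by
      ext c
      simp only [hfront, hrest, Finset.mem_filter, Finset.mem_univ, true_and,
        Finset.mem_insert]
      constructor
      · rintro ⟨h1, h2⟩
        by_cases hc : c = κ
        · exact .inl hc
        · refine .inr ⟨?_, h2⟩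
          have : (c : ℕ) ≠ k := fun h => hc (Fin.ext h)
          omega
      · rintro (rfl | ⟨h1, h2⟩)
        · exact ⟨Nat.lt_succ_self k, fun p hp => hp.lt⟩
        · exact ⟨by omega, h2⟩
    have hκrest : κ ∉ rest := by simp [hrest, hκ]
    set Q : Pair n R := (∏ m ∈ up (k + 1), (1 + TrivSqZeroExt.inr (h m) : Pair n R)) *
      ∏ c ∈ rest, message G rank Arc y D A c with hQ
    have hQgood : IsPairFrom (k + 1) Q := by
      refine (IsPairFrom.prod fun m hm => ?_).mul (IsPairFrom.prod fun c hc => ?_)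
      · refine IsPairFrom.one_add_inr (supported_mono ?_ (hh m))
        intro i hi
        have h1 : k + 1 ≤ (m : ℕ) := (Finset.mem_filter.1 hm).2
        exact h1.trans hi
      · exact isPairFrom_message hDW hDs A (Finset.mem_filter.1 hc).2.2
    -- the message of `x_k`, as a sum over the nodes of rank `k`, is part of `Θ (k + 1)`
    have hR : Θ (k + 1) A = ∑ v ∈ childNodes G rank Arc A κ,
        y v * ((∏ m ∈ up (k + 1), y (A m)) * φ A (D v * Q).snd) := by
      simp only [hΘ]
      rw [hfr2, Finset.prod_insert hκrest, mul_left_comm, ← hQ]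
      simp only [message]
      rw [Finset.sum_mul, TrivSqZeroExt.snd_sum, map_sum, Finset.mul_sum]
      refine Finset.sum_congr rfl fun v _ => ?_
      rw [smul_mul_assoc, TrivSqZeroExt.snd_smul, map_smul, smul_eq_mul]
      ring
    rw [hR]
    refine Finset.sum_congr rfl fun v hv => ?_
    have hv' : Function.update A κ v ∈ (chains.image (trunc k)) := by
      have : Function.update A κ v ∈
          (chains.image (trunc k)).filter (fun A' => trunc (k + 1) A' = A) := by
        rw [hfib]; exact Finset.mem_image_of_mem _ hv
      exact (Finset.mem_filter.1 this).1
    obtain ⟨B', hB', hB'A⟩ := Finset.mem_image.1 hv'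
    rw [hchains, Finset.mem_filter] at hB'
    replace hB' := hB'.2
    set A' := Function.update A κ v with hA'
    have hA'A : ∀ m : Fin n, k + 1 ≤ m → A' m = A m := by
      intro m hm
      have : m ≠ κ := by rintro rfl; simp [hκ] at hm
      rw [hA', Function.update_of_ne this]
    have hA'B' : ∀ m : Fin n, k ≤ m → A' m = B' m := by
      intro m hm
      rw [← hB'A]
      simp [htrunc, not_lt.2 hm]
    -- `A'` is the truncation of the chain `B'`, which selects `v` at the rank `k`
    have hA'κ : A' κ = v := by simp [hA']
    have hA'rank : ∀ l, rank (A' l) = l := by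
      intro l
      by_cases hl : l = κ
      · rw [hl, hA'κ]; exact (Finset.mem_filter.1 hv).2.1
      · rw [hA', Function.update_of_ne hl, hArank]
    have hA'ch : ∀ l, ∃ B, IsChainOf G rank Arc B ∧ B l = A' l := by
      intro l
      by_cases hl : l = κ
      · rw [hl, hA'κ]; exact (Finset.mem_filter.1 hv).2.2.1
      · rw [hA', Function.update_of_ne hl]; exact hAch l
    have hB'ch : ∀ l, ∃ B, IsChainOf G rank Arc B ∧ B l = B' l := fun l => ⟨B', hB', rfl⟩
    have hrv : rank v = κ := (Finset.mem_filter.1 hv).2.1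
    have hB'v : B' κ = v := by rw [← hA'B' κ le_rfl, hA'κ]
    simp only [hΘ]
    rw [hup1, Finset.prod_insert hκup, Finset.prod_insert hκup, hfr1,
      Finset.prod_union hdisj, hA'κ]
    have hp1 : ∏ m ∈ up (k + 1), y (A' m) = ∏ m ∈ up (k + 1), y (A m) :=
      Finset.prod_congr rfl fun m hm => by rw [hA'A m (Finset.mem_filter.1 hm).2]
    have hp2 : ∏ c ∈ rest, message G rank Arc y D A' c =
        ∏ c ∈ rest, message G rank Arc y D A c :=
      Finset.prod_congr rfl fun c hc => message_congr y D fun p hp =>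
        hA'A p ((Finset.mem_filter.1 hc).2.2 p hp)
    have hp3 : (1 + TrivSqZeroExt.inr (h κ) : Pair n R) *
        ∏ c ∈ kids, message G rank Arc y D A' c = collect G rank Arc y h D v := by
      rw [collect, hrv]
      congr 1
      refine Finset.prod_congr rfl fun c hc => message_congr y D fun p hp => ?_
      rw [hp.unique (Finset.mem_filter.1 hc).2, hA'κ]
    have hp4 : (1 + TrivSqZeroExt.inr (h κ) : Pair n R) *
        (∏ m ∈ up (k + 1), (1 + TrivSqZeroExt.inr (h m) : Pair n R)) *
        ((∏ c ∈ kids, message G rank Arc y D A' c) *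
          ∏ c ∈ rest, message G rank Arc y D A c) = collect G rank Arc y h D v * Q := by
      rw [hQ, ← hp3]; ring
    -- it remains to compare the pair collected at `v` with the reduced one
    rw [hp1, hp2, hp4, mul_assoc]
    congr 2
    have hcg : IsPairFrom k (collect G rank Arc y h D v) := by
      refine (IsPairFrom.one_add_inr (supported_mono ?_ (hh _))).mul
        (IsPairFrom.prod fun c hc => isPairFrom_message hDW hDs _ fun p hp => ?_)
      · intro i hi
        rw [hrv] at hi
        exact hi
      · rw [hp.unique (Finset.mem_filter.1 hc).2, hrv]
    have hDg : (D v).snd ∈ supported R {i : Fin n | k + 1 ≤ (i : ℕ)} := by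
      refine supported_mono ?_ (hDs v)
      rintro i ⟨hi, -⟩
      rw [hrv] at hi
      exact hi
    have hsub : {i : Fin n | k + 1 ≤ (i : ℕ)} ⊆ {i : Fin n | k ≤ (i : ℕ)} := by
      intro i hi
      exact Nat.le_of_succ_le hi
    obtain ⟨a, ha⟩ := hQgood.1
    obtain ⟨w, hw⟩ := hDW v
    have hfst : (D v).fst = (collect G rank Arc y h D v).fst := by
      have := hDfst B' hB' κ
      rwa [hB'v] at this
    have hφ : φ A' (collect G rank Arc y h D v).snd = φ A (D v).snd := by
      rw [hloc A' B' hA'rank hB'.1 hA'ch hB'ch k _ hcg.2 hA'B', ← hB'v, hDφ B' hB' κ, hB'v,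
        ← hloc A' B' hA'rank hB'.1 hA'ch hB'ch k _ (supported_mono hsub hDg) hA'B',
        hloc A' A hA'rank hArank hA'ch hAch (k + 1) _ hDg hA'A]
    rw [snd_mul_of_fst (hfst ▸ hw) ha, snd_mul_of_fst hw ha,
      map_add, map_add, map_smul, map_smul, map_smul, map_smul, hφ,
      hloc A' A hA'rank hArank hA'ch hAch (k + 1) _ hQgood.2 hA'A]
  have hall : ∀ k, k ≤ n → ∑ A ∈ chains.image (trunc 0), Θ 0 A =
      ∑ A ∈ chains.image (trunc k), Θ k A := by
    intro k
    induction k with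
    | zero => intro _; rfl
    | succ k ih => intro hk; rw [ih (by omega), hstep k (by omega)]
  have hfinal := hall n le_rfl
  have h0 : chains.image (trunc 0) = chains := by
    have : trunc 0 = id := by funext A m; simp [htrunc]
    rw [this, Finset.image_id]
  have hn : chains.image (trunc n) = {A₀} := by
    have : trunc n = fun _ => A₀ := by funext A m; simp [htrunc]
    rw [this]
    exact Finset.image_const ⟨A₀, by rw [hchains]; simpa using hA₀⟩ _
  rw [h0, hn, Finset.sum_singleton] at hfinal
  have hup0 : up 0 = Finset.univ := by simp [hup]
  have hupn : up n = ∅ := by simp [hup, Finset.filter_eq_empty_iff]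
  have hfr0 : front 0 = ∅ := by simp [hfront]
  have hfrn : front n = Finset.univ.filter fun c => ∀ p, ¬ IsParent G c p := by
    ext c
    simp only [hfront, Finset.mem_filter, Finset.mem_univ, true_and, c.2]
    refine forall_congr' fun p => ⟨fun h hp => ?_, fun h hp => absurd hp h⟩
    have := h hp
    omega
  simp only [hΘ, hup0, hupn, hfr0, hfrn, Finset.prod_empty, one_mul, mul_one] at hfinal
  rw [← hfinal]
  refine Finset.sum_congr rfl fun A _ => ?_
  rw [(snd_prod_one_add_inr Finset.univ h).2]

end ChainSum

/-! ### The cost of the dynamic program -/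

section Dynamic

open MvPolynomial

variable {n N : ℕ} {G : SimpleGraph (Fin n)} {rank : Fin N → Fin n}
  {Arc : Fin N → Fin N → Prop} {R : Type*} [CommRing R]

open Classical in
/-- The smaller neighbours of `x_l`. -/
noncomputable def lowerNbrs (G : SimpleGraph (Fin n)) (l : Fin n) : Finset (Fin n) :=
  Finset.univ.filter fun m => l < m ∧ G.Adj l m

theorem mem_lowerNbrs {l m : Fin n} : m ∈ lowerNbrs G l ↔ l < m ∧ G.Adj l m := by
  simp [lowerNbrs]

/-- The message of `x_c` involves only variables that are present at its parent. -/
theorem lowerNbrs_subset (hG : IsPerfectElimination G) {c p : Fin n} (h : IsParent G c p) :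
    lowerNbrs G c ⊆ insert p (lowerNbrs G p) := by
  intro m hm
  rw [mem_lowerNbrs] at hm
  rw [Finset.mem_insert, mem_lowerNbrs]
  rcases (h.2 hm).eq_or_lt with hpm | hpm
  · exact .inl hpm.symm
  · exact .inr ⟨hpm, hG c (.inr h.1) (.inr hm) hpm.ne⟩

theorem lowerNbrs_eq_empty {c : Fin n} (h : ∀ p, ¬ IsParent G c p) : lowerNbrs G c = ∅ := by
  by_contra hne
  have hne' := Finset.nonempty_iff_ne_empty.2 hne
  refine h ((lowerNbrs G c).min' hne') ⟨mem_lowerNbrs.1 (Finset.min'_mem _ hne'), ?_⟩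
  intro m hm
  exact Finset.min'_le _ _ (mem_lowerNbrs.2 hm)

/-- All coefficients of the two components of a pair. -/
def pairSet (x : Pair n R) : Set R := coeffSet x.fst ∪ coeffSet x.snd

/-- A pair consisting of a scalar and a polynomial in the variables `Y` of degree less than `q`
in each variable. -/
def IsPairIn (q : ℕ) (Y : Finset (Fin n)) (x : Pair n R) : Prop :=
  (∃ a, x.fst = C a) ∧ InBox (cap q Y) x.snd

theorem InBox.add {b : Fin n → ℕ} {p p' : MvPolynomial (Fin n) R} (h : InBox b p)
    (h' : InBox b p') : InBox b (p + p') := by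
  classical
  intro e he
  rcases Finset.mem_union.1 (support_add he) with he | he
  exacts [h e he, h' e he]

theorem InBox.smul {b : Fin n → ℕ} {p : MvPolynomial (Fin n) R} (h : InBox b p) (a : R) :
    InBox b (a • p) :=
  fun e he => h e (support_smul he)

theorem inBox_zero (b : Fin n → ℕ) : InBox b (0 : MvPolynomial (Fin n) R) := by
  intro e he
  simp at he

theorem InBox.sum {α : Type*} {s : Finset α} {b : Fin n → ℕ} {p : α → MvPolynomial (Fin n) R}
    (h : ∀ i ∈ s, InBox b (p i)) : InBox b (∑ i ∈ s, p i) :=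
  Finset.sum_induction _ (InBox b) (fun _ _ => InBox.add) (inBox_zero b) h

theorem inBox_C {b : Fin n → ℕ} (hb : ∀ i, 0 < b i) (a : R) : InBox b (C a) := by
  intro e he i
  have := support_monomial_subset (s := (0 : Fin n →₀ ℕ)) (a := a) he
  simp only [Finset.mem_singleton] at this
  simpa [this] using hb i

theorem cap_pos {q : ℕ} (hq : 0 < q) (Y : Finset (Fin n)) (i : Fin n) : 0 < cap q Y i := by
  unfold cap
  split_ifs <;> omega

theorem InBox.mem_supported {q : ℕ} {Y : Finset (Fin n)} {p : MvPolynomial (Fin n) R}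
    (h : InBox (cap q Y) p) : p ∈ supported R (Y : Set (Fin n)) := by
  rw [mem_supported_iff_support]
  intro e he i hi
  by_contra hY
  have := h e he i
  simp only [cap, show i ∉ Y from hY, if_false] at this
  omega

theorem IsPairIn.mono {q : ℕ} (hq : 0 < q) {Y Y' : Finset (Fin n)} {x : Pair n R}
    (h : IsPairIn q Y x) (hY : Y ⊆ Y') : IsPairIn q Y' x :=
  ⟨h.1, h.2.mono (cap_mono hq hY)⟩

theorem isPairIn_message {q : ℕ} {y : Fin N → R} {D : Fin N → Pair n R}
    (hD : ∀ u, IsPairIn q (lowerNbrs G (rank u)) (D u)) (A : Fin n → Fin N) (c : Fin n) :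
    IsPairIn q (lowerNbrs G c) (message G rank Arc y D A c) := by
  classical
  have hr : ∀ u ∈ childNodes G rank Arc A c, rank u = c :=
    fun u hu => (Finset.mem_filter.1 hu).2.1
  rw [message]
  constructor
  · choose w hw using fun u => (hD u).1
    refine ⟨∑ u ∈ childNodes G rank Arc A c, y u * w u, ?_⟩
    rw [TrivSqZeroExt.fst_sum, map_sum]
    refine Finset.sum_congr rfl fun u _ => ?_
    rw [TrivSqZeroExt.fst_smul, hw, smul_eq_C_mul, ← map_mul]
  · rw [TrivSqZeroExt.snd_sum]
    refine InBox.sum fun u hu => ?_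
    rw [TrivSqZeroExt.snd_smul]
    have := (hD u).2.smul (y u)
    rwa [hr u hu] at this

theorem computes_sum_smul [Div R] {α : Type*} (s : Finset α) {S : Set R} (h0 : (0 : R) ∈ S)
    {w : α → R} {p : α → MvPolynomial (Fin n) R} {b : Fin n → ℕ} (hw : ∀ i ∈ s, w i ∈ S)
    (hp : ∀ i ∈ s, InBox b (p i)) (hpS : ∀ i ∈ s, coeffSet (p i) ⊆ S) :
    Computes ((box b).card * (2 * s.card)) S (coeffSet (∑ i ∈ s, w i • p i)) := by
  refine Computes.coeffSet h0 (inBox_iff.1 (InBox.sum fun i hi => (hp i hi).smul _))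
    (c := 2 * s.card) (fun e _ => ?_) le_rfl
  have : (∑ i ∈ s, w i • p i).coeff e = 0 + ∑ i ∈ s, w i * (p i).coeff e := by
    simp [coeff_sum]
  rw [this]
  exact Computes.add_sum_mul s h0 hw fun i hi => hpS i hi ⟨e, rfl⟩

theorem computes_message [Div R] {q : ℕ} (hq : 0 < q) {S : Set R} (h0 : (0 : R) ∈ S) {y : Fin N → R}
    (hy : ∀ u, y u ∈ S) {D : Fin N → Pair n R}
    (hD : ∀ u, IsPairIn q (lowerNbrs G (rank u)) (D u)) {A : Fin n → Fin N} {c : Fin n}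
    (hS : ∀ u, rank u = c → pairSet (D u) ⊆ S) {W κ : ℕ}
    (hW : (childNodes G rank Arc A c).card ≤ W) (hκ : (lowerNbrs G c).card ≤ κ) :
    Computes (4 * W * q ^ κ) S (pairSet (message G rank Arc y D A c)) := by
  classical
  have hr : ∀ u ∈ childNodes G rank Arc A c, rank u = c :=
    fun u hu => (Finset.mem_filter.1 hu).2.1
  have h1 : Computes ((box (cap q (∅ : Finset (Fin n)))).card *
      (2 * (childNodes G rank Arc A c).card)) S
      (coeffSet (∑ u ∈ childNodes G rank Arc A c, y u • (D u).fst)) := by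
    refine computes_sum_smul _ h0 (fun u _ => hy u) (fun u _ => ?_)
      (fun u hu => Set.subset_union_left.trans (hS u (hr u hu)))
    obtain ⟨a, ha⟩ := (hD u).1
    rw [ha]
    exact inBox_C (cap_pos hq _) a
  have h2 : Computes ((box (cap q (lowerNbrs G c))).card *
      (2 * (childNodes G rank Arc A c).card)) S
      (coeffSet (∑ u ∈ childNodes G rank Arc A c, y u • (D u).snd)) := by
    refine computes_sum_smul _ h0 (fun u _ => hy u) (fun u hu => ?_)
      (fun u hu => Set.subset_union_right.trans (hS u (hr u hu)))
    have := (hD u).2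
    rwa [hr u hu] at this
  have e1 : (message G rank Arc y D A c).fst =
      ∑ u ∈ childNodes G rank Arc A c, y u • (D u).fst := by
    simp [message, TrivSqZeroExt.fst_sum]
  have e2 : (message G rank Arc y D A c).snd =
      ∑ u ∈ childNodes G rank Arc A c, y u • (D u).snd := by
    simp [message, TrivSqZeroExt.snd_sum]
  rw [pairSet, e1, e2]
  refine h1.union h2 ?_
  rw [card_box_cap, card_box_cap, Finset.card_empty, pow_zero]
  have h3 : q ^ (lowerNbrs G c).card ≤ q ^ κ := Nat.pow_le_pow_right hq hκ
  have h4 : 1 ≤ q ^ κ := Nat.one_le_pow _ _ hq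
  set w := (childNodes G rank Arc A c).card
  calc 1 * (2 * w) + q ^ (lowerNbrs G c).card * (2 * w)
      ≤ q ^ κ * (2 * W) + q ^ κ * (2 * W) := by gcongr
    _ = 4 * W * q ^ κ := by ring

theorem IsPairIn.mul {q : ℕ} {Y : Finset (Fin n)} {x x' : Pair n R} (hx : IsPairIn q Y x)
    (hx' : IsPairIn q Y x') : IsPairIn q Y (x * x') := by
  obtain ⟨⟨a, ha⟩, hx⟩ := hx
  obtain ⟨⟨b, hb⟩, hx'⟩ := hx'
  refine ⟨⟨a * b, by simp [ha, hb]⟩, ?_⟩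
  rw [snd_mul_of_fst ha hb]
  exact (hx'.smul a).add (hx.smul b)

/-- As the first components are scalars, no two polynomials are multiplied here. -/
theorem computes_mul [Div R] {q : ℕ} (hq : 0 < q) {S : Set R} (h0 : (0 : R) ∈ S)
    {Y : Finset (Fin n)}
    {x x' : Pair n R} (hx : IsPairIn q Y x) (hx' : IsPairIn q Y x') (hS : pairSet x ⊆ S)
    (hS' : pairSet x' ⊆ S) {κ : ℕ} (hκ : Y.card ≤ κ) :
    Computes (4 * q ^ κ) S (pairSet (x * x')) := by
  classical
  have hmul := hx.mul hx'
  obtain ⟨⟨a, ha⟩, hx⟩ := hx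
  obtain ⟨⟨b, hb⟩, hx'⟩ := hx'
  have haS : a ∈ S := hS (.inl ⟨0, by simp [ha]⟩)
  have hbS : b ∈ S := hS' (.inl ⟨0, by simp [hb]⟩)
  have h1 : Computes 1 S (coeffSet (x * x').fst) := by
    refine ((Computes.mul haS hbS).keep).mono le_rfl subset_rfl ?_
    rintro _ ⟨e, rfl⟩
    simp only [TrivSqZeroExt.fst_mul, ha, hb, ← map_mul, coeff_C]
    split_ifs
    · exact .inr rfl
    · exact .inl h0
  have h2 : Computes ((box (cap q Y)).card * 3) S (coeffSet (x * x').snd) := by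
    refine Computes.coeffSet h0 (inBox_iff.1 hmul.2) (c := 3) (fun e _ => ?_) le_rfl
    rw [snd_mul_of_fst ha hb, coeff_add, coeff_smul, coeff_smul, smul_eq_mul, smul_eq_mul]
    exact ((Computes.mul haS (hS' (.inr ⟨e, rfl⟩))).union
      (Computes.mul hbS (hS (.inr ⟨e, rfl⟩))) le_rfl).bind
      (Computes.add (.inr (.inl rfl)) (.inr (.inr rfl))) le_rfl
  refine h1.union h2 ?_
  rw [card_box_cap]
  have h3 : q ^ Y.card ≤ q ^ κ := Nat.pow_le_pow_right hq hκ
  have h4 : 1 ≤ q ^ κ := Nat.one_le_pow _ _ hq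
  omega

/-- The cost of a product of messages. -/
theorem computes_mul_prod_message [Div R] {q : ℕ} (hq : 0 < q) {S : Set R} (h0 : (0 : R) ∈ S)
    {y : Fin N → R} (hy : ∀ u, y u ∈ S) {D : Fin N → Pair n R}
    (hD : ∀ u, IsPairIn q (lowerNbrs G (rank u)) (D u)) {A : Fin n → Fin N}
    {Y : Finset (Fin n)} {x : Pair n R} (hx : IsPairIn q Y x) (hxS : pairSet x ⊆ S)
    (s : Finset (Fin n)) (hsY : ∀ c ∈ s, lowerNbrs G c ⊆ Y)
    (hS : ∀ c ∈ s, ∀ u, rank u = c → pairSet (D u) ⊆ S) {W κ : ℕ} (hW0 : 0 < W)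
    (hW : ∀ c, (childNodes G rank Arc A c).card ≤ W) (hκ : Y.card ≤ κ) :
    IsPairIn q Y (x * ∏ c ∈ s, message G rank Arc y D A c) ∧
    Computes (s.card * (8 * W * q ^ κ)) S
      (pairSet (x * ∏ c ∈ s, message G rank Arc y D A c)) := by
  classical
  induction s using Finset.induction_on with
  | empty => exact ⟨by simpa using hx, .done (by simpa using hxS)⟩
  | insert c s hc ih =>
    obtain ⟨h1, h2⟩ := ih (fun c' hc' => hsY c' (Finset.mem_insert_of_mem hc'))
      (fun c' hc' => hS c' (Finset.mem_insert_of_mem hc'))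
    have hcY := hsY c (Finset.mem_insert_self _ _)
    have hm : IsPairIn q Y (message G rank Arc y D A c) := (isPairIn_message hD A c).mono hq hcY
    have hmc : Computes (4 * W * q ^ κ) S (pairSet (message G rank Arc y D A c)) :=
      computes_message hq h0 hy hD (hS c (Finset.mem_insert_self _ _)) (hW c)
        ((Finset.card_le_card hcY).trans hκ)
    have e : x * ∏ c ∈ insert c s, message G rank Arc y D A c =
        (x * ∏ c ∈ s, message G rank Arc y D A c) * message G rank Arc y D A c := by
      rw [Finset.prod_insert hc]; ring
    rw [e]
    refine ⟨h1.mul hm, (h2.union hmc le_rfl).bind (computes_mul hq (.inl h0) h1 hm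
      (Set.subset_union_left.trans Set.subset_union_right)
      (Set.subset_union_right.trans Set.subset_union_right) hκ) ?_⟩
    rw [Finset.card_insert_of_notMem hc, Nat.succ_mul]
    have : q ^ κ ≤ W * q ^ κ := Nat.le_mul_of_pos_left _ hW0
    nlinarith

theorem collect_congr {y : Fin N → R} {h : Fin n → MvPolynomial (Fin n) R}
    {D D' : Fin N → Pair n R} {v : Fin N} (hDD : ∀ u, rank u < rank v → D u = D' u) :
    collect G rank Arc y h D v = collect G rank Arc y h D' v := by
  classical
  unfold collect
  congr 1
  refine Finset.prod_congr rfl fun c hc => ?_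
  refine Finset.sum_congr rfl fun u hu => ?_
  rw [hDD u]
  rw [(Finset.mem_filter.1 hu).2.1]
  exact (Finset.mem_filter.1 hc).2.lt

/-- The data of the dynamic program: polynomials `x_i ^ q - tail l i` for the variables `x_i`
below `x_l`, and node polynomials `x_l ^ deg v - nodeTail v`, all of them reduced and available
in `S`, together with the summands `h l` and the random scalars `y` (one for each node) and `r`
(one for each variable). -/
structure ProgramData (G : SimpleGraph (Fin n)) (rank : Fin N → Fin n)
    (Arc : Fin N → Fin N → Prop) (q : ℕ) (S : Set R)
    (tail : Fin n → Fin n → MvPolynomial (Fin n) R)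
    (deg : Fin N → ℕ) (nodeTail : Fin N → MvPolynomial (Fin n) R)
    (h : Fin n → MvPolynomial (Fin n) R) (y : Fin N → R) (r : Fin n → R) : Prop where
  zero_mem : 0 ∈ S
  one_mem : 1 ∈ S
  y_mem : ∀ v, y v ∈ S
  r_mem : ∀ l, r l ∈ S
  h_mem : ∀ l, coeffSet (h l) ⊆ S
  h_box : ∀ l, InBox (cap q (insert l (lowerNbrs G l))) (h l)
  tail_mem : ∀ l, ∀ i ∈ lowerNbrs G l, coeffSet (tail l i) ⊆ S
  tail_box : ∀ l, ∀ i ∈ lowerNbrs G l, InBox (cap q ((lowerNbrs G l).filter (i ≤ ·))) (tail l i)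
  nodeTail_mem : ∀ C, IsChainOf G rank Arc C → ∀ l, deg (C l) ≤ q →
    coeffSet (nodeTail (C l)) ⊆ S
  nodeTail_box : ∀ C, IsChainOf G rank Arc C → ∀ l, deg (C l) ≤ q →
    InBox (Function.update (cap q (insert l (lowerNbrs G l))) l (deg (C l))) (nodeTail (C l))

/-- The ideal modulo which the computation at the node `v` takes place. -/
noncomputable def nodeIdeal (G : SimpleGraph (Fin n)) (rank : Fin N → Fin n) (q : ℕ)
    (tail : Fin n → Fin n → MvPolynomial (Fin n) R)
    (deg : Fin N → ℕ) (nodeTail : Fin N → MvPolynomial (Fin n) R) (v : Fin N) :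
    Ideal (MvPolynomial (Fin n) R) :=
  Ideal.span (insert (X (rank v) ^ deg v - nodeTail v)
    {g | ∃ i ∈ lowerNbrs G (rank v), g = X i ^ q - tail (rank v) i})

open Classical in
/-- `D v` arises from the pair collected at `v` by reduction modulo the ideal of the node and
evaluation at `x_l = r_l`. -/
def IsReducedAt (G : SimpleGraph (Fin n)) (rank : Fin N → Fin n)
    (Arc : Fin N → Fin N → Prop) (q : ℕ)
    (tail : Fin n → Fin n → MvPolynomial (Fin n) R)
    (deg : Fin N → ℕ) (nodeTail : Fin N → MvPolynomial (Fin n) R)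
    (h : Fin n → MvPolynomial (Fin n) R) (y : Fin N → R) (r : Fin n → R)
    (D : Fin N → Pair n R) (v : Fin N) : Prop :=
  (D v).fst = (collect G rank Arc y h D v).fst ∧
    ∃ g, InBox (Function.update (cap q (insert (rank v) (lowerNbrs G (rank v)))) (rank v)
        (min (deg v) q)) g ∧
      (collect G rank Arc y h D v).snd - g ∈ nodeIdeal G rank q tail deg nodeTail v ∧
      (D v).snd = substVar (rank v) (r (rank v)) g

open Classical in
/-- The work at a node whose children have been dealt with. -/
theorem exists_reduced_pair [Div R] (hG : IsPerfectElimination G) {q : ℕ} (hq : 0 < q) {S : Set R}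
    {tail : Fin n → Fin n → MvPolynomial (Fin n) R} {deg : Fin N → ℕ}
    {nodeTail : Fin N → MvPolynomial (Fin n) R} {h : Fin n → MvPolynomial (Fin n) R}
    {y : Fin N → R} {r : Fin n → R}
    (hP : ProgramData G rank Arc q S tail deg nodeTail h y r)
    {D : Fin N → Pair n R} (hD : ∀ u, IsPairIn q (lowerNbrs G (rank u)) (D u))
    {S' : Set R} (hSS : S ⊆ S') {v : Fin N} (hS : ∀ u, rank u < rank v → pairSet (D u) ⊆ S')
    {A : Fin n → Fin N} (hA : IsChainOf G rank Arc A) (hv : A (rank v) = v)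
    {W κ : ℕ} (hW0 : 0 < W)
    (hW : ∀ l, (Finset.univ.filter fun u => rank u = l).card ≤ W)
    (hκ : ∀ l, (lowerNbrs G l).card + 1 ≤ κ) :
    ∃ x : Pair n R, IsPairIn q (lowerNbrs G (rank v)) x ∧
      x.fst = (collect G rank Arc y h D v).fst ∧
      (∃ g, InBox (Function.update (cap q (insert (rank v) (lowerNbrs G (rank v)))) (rank v)
          (min (deg v) q)) g ∧
        (collect G rank Arc y h D v).snd - g ∈ nodeIdeal G rank q tail deg nodeTail v ∧
        x.snd = substVar (rank v) (r (rank v)) g) ∧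
      Computes ((Finset.univ.filter fun c => IsParent G c (rank v)).card * (8 * W * q ^ κ) +
        7 * κ ^ 2 * q ^ (2 * κ)) S' (pairSet x) := by
  classical
  set l := rank v with hl
  set Z := lowerNbrs G l with hZ
  have hlZ : ∀ m ∈ Z, l < m := fun m hm => (mem_lowerNbrs.1 hm).1
  have hlZ' : l ∉ Z := fun h => lt_irrefl _ (hlZ l h)
  have hcard : (insert l Z).card = Z.card + 1 := Finset.card_insert_of_notMem hlZ'
  have hκ' : (insert l Z).card ≤ κ := by rw [hcard]; exact hκ l
  have h0 : (0 : R) ∈ S' := hSS hP.zero_mem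
  have h1 : (1 : R) ∈ S' := hSS hP.one_mem
  have hbase : IsPairIn q (insert l Z) (1 + TrivSqZeroExt.inr (h l) : Pair n R) :=
    ⟨⟨1, by simp⟩, by simpa using hP.h_box l⟩
  have hbaseS : pairSet (1 + TrivSqZeroExt.inr (h l) : Pair n R) ⊆ S' := by
    rintro _ (⟨e, rfl⟩ | ⟨e, rfl⟩)
    · simp only [TrivSqZeroExt.fst_add, TrivSqZeroExt.fst_one, TrivSqZeroExt.fst_inr, add_zero]
      rw [coeff_one]
      split_ifs
      exacts [h1, h0]
    · simp only [TrivSqZeroExt.snd_add, TrivSqZeroExt.snd_one, TrivSqZeroExt.snd_inr, zero_add]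
      exact hSS (hP.h_mem l ⟨e, rfl⟩)
  obtain ⟨hE, hEc⟩ := computes_mul_prod_message (G := G) (rank := rank) (Arc := Arc) hq h0
    (fun u => hSS (hP.y_mem u)) hD
    (A := fun _ => v) hbase hbaseS (Finset.univ.filter fun c => IsParent G c l)
    (fun c hc => lowerNbrs_subset hG (Finset.mem_filter.1 hc).2)
    (fun c hc u hu => hS u (by rw [hu]; exact (Finset.mem_filter.1 hc).2.lt)) hW0
    (fun c => (Finset.card_le_card (fun u hu => by
      simpa using (Finset.mem_filter.1 hu).2.1)).trans (hW c)) hκ'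
  have hcol : (1 + TrivSqZeroExt.inr (h l) : Pair n R) *
      ∏ c ∈ Finset.univ.filter fun c => IsParent G c l,
        message G rank Arc y D (fun _ => v) c = collect G rank Arc y h D v := rfl
  rw [hcol] at hE hEc
  set E := collect G rank Arc y h D v
  set I := nodeIdeal G rank q tail deg nodeTail v with hI
  obtain ⟨T, hT, hTc⟩ := exists_isTable (I := I) hq h0 (tail l) Z (fun i hi => hP.tail_box l i hi)
    (fun i hi => Ideal.subset_span (.inr ⟨i, hi, rfl⟩))
    (fun i hi => (hP.tail_mem l i hi).trans hSS)
  obtain ⟨g, hg, hgI, hgc⟩ := exists_reduce_eval (I := I) hq hlZ hT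
    (S := S' ∪ (pairSet E ∪ tableSet q Z T)) (.inl h0) (.inl h1)
    (Set.subset_union_right.trans Set.subset_union_right) (d := deg v) (tail := nodeTail v)
    (fun hd => by
      have := hP.nodeTail_box A hA l
      rw [hv] at this
      exact this hd)
    (Ideal.subset_span (.inl rfl))
    (fun hd => by
      have := hP.nodeTail_mem A hA l
      rw [hv] at this
      exact ((this hd).trans hSS).trans Set.subset_union_left)
    (r := r l) (.inl (hSS (hP.r_mem l))) hE.2
    (Set.subset_union_right.trans (Set.subset_union_left.trans Set.subset_union_right))
  refine ⟨TrivSqZeroExt.inl E.fst + TrivSqZeroExt.inr (substVar l (r l) g),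
    ⟨by simpa using hE.1, by simpa using inBox_substVar hlZ' hg⟩, by simp,
    ⟨g, hg, hgI, by simp⟩, ?_⟩
  have hset : pairSet (TrivSqZeroExt.inl E.fst + TrivSqZeroExt.inr (substVar l (r l) g) :
      Pair n R) ⊆ (pairSet E ∪ tableSet q Z T) ∪ coeffSet (substVar l (r l) g) := by
    rintro _ (⟨e, rfl⟩ | ⟨e, rfl⟩)
    · refine .inl (.inl (.inl ⟨e, by simp⟩))
    · refine .inr ⟨e, by simp⟩
  refine ((hEc.union hTc le_rfl).trans hgc).mono ?_ subset_rfl hset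
  rw [add_assoc]
  refine Nat.add_le_add_left ?_ _
  have hz : Z.card ≤ κ := (Nat.le_succ _).trans (hκ l)
  have e1 : q ^ (2 * Z.card) ≤ q ^ (2 * κ) := Nat.pow_le_pow_right hq (by omega)
  have e2 : q ^ (2 * (insert l Z).card) ≤ q ^ (2 * κ) := Nat.pow_le_pow_right hq (by omega)
  have e3 : κ ≤ κ ^ 2 := Nat.le_self_pow (by norm_num) κ
  calc 2 * Z.card ^ 2 * q ^ (2 * Z.card) + 5 * (insert l Z).card * q ^ (2 * (insert l Z).card)
      ≤ 2 * κ ^ 2 * q ^ (2 * κ) + 5 * κ ^ 2 * q ^ (2 * κ) := by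
        gcongr
        exact hκ'.trans e3
    _ = 7 * κ ^ 2 * q ^ (2 * κ) := by ring

theorem sum_card_children_le (G : SimpleGraph (Fin n)) [DecidableRel (IsParent G)] :
    ∑ l, (Finset.univ.filter fun c => IsParent G c l).card ≤ n := by
  classical
  rw [← Finset.card_biUnion]
  · exact (Finset.card_le_univ _).trans (by simp)
  · intro l _ l' _ hll
    rw [Function.onFun, Finset.disjoint_left]
    intro c hc hc'
    exact hll ((Finset.mem_filter.1 hc).2.unique (Finset.mem_filter.1 hc').2)

open Classical in
/-- The dynamic program, run through all ranks. -/
theorem exists_program [Div R] (hG : IsPerfectElimination G) {q : ℕ} (hq : 0 < q) {S : Set R}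
    {tail : Fin n → Fin n → MvPolynomial (Fin n) R} {deg : Fin N → ℕ}
    {nodeTail : Fin N → MvPolynomial (Fin n) R} {h : Fin n → MvPolynomial (Fin n) R}
    {y : Fin N → R} {r : Fin n → R}
    (hP : ProgramData G rank Arc q S tail deg nodeTail h y r)
    {A₀ : Fin n → Fin N} {W κ : ℕ} (hW0 : 0 < W)
    (hW : ∀ l, (Finset.univ.filter fun u => rank u = l).card ≤ W)
    (hκ : ∀ l, (lowerNbrs G l).card + 1 ≤ κ) :
    ∃ D : Fin N → Pair n R, (∀ u, IsPairIn q (lowerNbrs G (rank u)) (D u)) ∧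
      (∀ A, IsChainOf G rank Arc A → ∀ l,
        IsReducedAt G rank Arc q tail deg nodeTail h y r D (A l)) ∧
      IsPairIn q ∅ (∏ c ∈ Finset.univ.filter fun c => ∀ p, ¬ IsParent G c p,
        message G rank Arc y D A₀ c) ∧
      Computes (7 * κ ^ 2 * (n * W * q ^ (2 * κ)) + 16 * (n * W ^ 2 * q ^ κ)) S
        (pairSet (∏ c ∈ Finset.univ.filter fun c => ∀ p, ¬ IsParent G c p,
          message G rank Arc y D A₀ c)) := by
  classical
  set cost : Fin n → ℕ := fun l => W * ((Finset.univ.filter fun c => IsParent G c l).card *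
    (8 * W * q ^ κ) + 7 * κ ^ 2 * q ^ (2 * κ)) with hcost
  -- the pairs of the nodes of rank less than `k`
  have key : ∀ k, k ≤ n → ∃ D : Fin N → Pair n R,
      (∀ u, IsPairIn q (lowerNbrs G (rank u)) (D u)) ∧
      (∀ A, IsChainOf G rank Arc A → ∀ l : Fin n, (l : ℕ) < k →
        IsReducedAt G rank Arc q tail deg nodeTail h y r D (A l)) ∧
      Computes (∑ l ∈ Finset.univ.filter fun l : Fin n => (l : ℕ) < k, cost l) S
        (⋃ u ∈ Finset.univ.filter fun u => (rank u : ℕ) < k, pairSet (D u)) := by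
    intro k
    induction k with
    | zero =>
      intro _
      refine ⟨fun _ => 0, fun u => ⟨⟨0, by simp⟩, inBox_zero _⟩, fun A _ l hl => by omega,
        .done (by simp)⟩
    | succ k ih =>
      intro hk
      obtain ⟨D, hD, hDr, hDc⟩ := ih (by omega)
      set κ' : Fin n := ⟨k, hk⟩ with hκ'
      set V := ⋃ u ∈ Finset.univ.filter fun u => (rank u : ℕ) < k, pairSet (D u) with hV
      have hV' : ∀ u, (rank u : ℕ) < k → pairSet (D u) ⊆ V := fun u hu =>
        Set.subset_biUnion_of_mem (u := fun u => pairSet (D u))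
          (Finset.mem_coe.2 (Finset.mem_filter.2 ⟨Finset.mem_univ u, hu⟩))
      -- the pairs of the nodes of rank `k`, with zero at the nodes that lie on no chain
      have hnew : ∀ v, ∃ x : Pair n R, IsPairIn q (lowerNbrs G (rank v)) x ∧
          (rank v = κ' → Computes ((Finset.univ.filter fun c => IsParent G c κ').card *
            (8 * W * q ^ κ) + 7 * κ ^ 2 * q ^ (2 * κ)) (S ∪ V) (pairSet x)) ∧
          (rank v = κ' → (∃ A, IsChainOf G rank Arc A ∧ A (rank v) = v) →
            x.fst = (collect G rank Arc y h D v).fst ∧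
            (∃ g, InBox (Function.update (cap q (insert (rank v) (lowerNbrs G (rank v))))
                (rank v) (min (deg v) q)) g ∧
              (collect G rank Arc y h D v).snd - g ∈ nodeIdeal G rank q tail deg nodeTail v ∧
              x.snd = substVar (rank v) (r (rank v)) g)) := by
        intro v
        by_cases hv : rank v = κ' ∧ ∃ A, IsChainOf G rank Arc A ∧ A (rank v) = v
        · obtain ⟨hv1, A, hA, hv2⟩ := hv
          obtain ⟨x, hx1, hx2, hx3, hx4⟩ := exists_reduced_pair hG hq hP hD
            (S' := S ∪ V) Set.subset_union_left (v := v) (fun u hu => by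
              refine (hV' u ?_).trans Set.subset_union_right
              rw [hv1] at hu
              exact hu) hA hv2 hW0 hW hκ
          rw [hv1] at hx4
          exact ⟨x, hx1, fun _ => hx4, fun _ _ => ⟨hx2, hx3⟩⟩
        · refine ⟨0, ⟨⟨0, by simp⟩, inBox_zero _⟩, fun _ => .done ?_,
            fun h1 h2 => absurd ⟨h1, h2⟩ hv⟩
          rintro _ (⟨e, rfl⟩ | ⟨e, rfl⟩)
          · simpa using .inl hP.zero_mem
          · simpa using .inl hP.zero_mem
      choose x hx1 hx2 hx3 using hnew
      set D' : Fin N → Pair n R := fun v => if rank v = κ' then x v else D v with hD'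
      have hcol : ∀ v, (rank v : ℕ) ≤ k →
          collect G rank Arc y h D' v = collect G rank Arc y h D v := by
        intro v hv
        refine collect_congr fun u hu => ?_
        have : rank u ≠ κ' := by
          intro h
          rw [h] at hu
          have : k < (rank v : ℕ) := hu
          omega
        simp [hD', this]
      refine ⟨D', fun u => ?_, fun A hA l hl => ?_, ?_⟩
      · simp only [hD']
        split_ifs
        exacts [hx1 u, hD u]
      · unfold IsReducedAt
        rw [hcol (A l) (by rw [hA.1]; omega)]
        by_cases hlk : l = κ'
        · have hr : rank (A l) = κ' := by rw [hA.1, hlk]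
          have hDA : D' (A l) = x (A l) := by simp only [hD', hr, if_true]
          rw [hDA]
          exact hx3 (A l) hr ⟨A, hA, by rw [hA.1]⟩
        · have hr : rank (A l) ≠ κ' := by rw [hA.1]; exact hlk
          have hDA : D' (A l) = D (A l) := by simp only [hD', hr, if_false]
          rw [hDA]
          refine hDr A hA l ?_
          have : (l : ℕ) ≠ k := fun h => hlk (Fin.ext h)
          omega
      · have hstep : Computes (cost κ') (S ∪ V)
            (⋃ u ∈ Finset.univ.filter fun u => rank u = κ', pairSet (x u)) :=
          Computes.biUnion_const _ (fun u hu => hx2 u (Finset.mem_filter.1 hu).2)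
            (Nat.mul_le_mul_right _ (hW κ'))
        refine (hDc.trans hstep).mono ?_ subset_rfl ?_
        · have : (Finset.univ.filter fun l : Fin n => (l : ℕ) < k + 1) =
              insert κ' (Finset.univ.filter fun l : Fin n => (l : ℕ) < k) := by
            ext l
            simp only [Finset.mem_filter, Finset.mem_univ, true_and, Finset.mem_insert,
              Fin.ext_iff, hκ']
            omega
          rw [this, Finset.sum_insert (by simp [hκ']), add_comm]
        · refine Set.iUnion₂_subset fun u hu => ?_
          have hu' : (rank u : ℕ) < k + 1 := (Finset.mem_filter.1 hu).2
          by_cases huk : rank u = κ'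
          · simp only [hD', huk, if_true]
            exact (Set.subset_biUnion_of_mem (u := fun u => pairSet (x u))
              (Finset.mem_coe.2 (Finset.mem_filter.2 ⟨Finset.mem_univ u, huk⟩))).trans
              Set.subset_union_right
          · simp only [hD', huk, if_false]
            refine (hV' u ?_).trans Set.subset_union_left
            have : (rank u : ℕ) ≠ k := fun h => huk (Fin.ext h)
            omega
  obtain ⟨D, hD, hDr, hDc⟩ := key n le_rfl
  set V := ⋃ u ∈ Finset.univ.filter fun u => (rank u : ℕ) < n, pairSet (D u) with hV
  set roots := Finset.univ.filter fun c => ∀ p, ¬ IsParent G c p with hroots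
  have h1S : pairSet (1 : Pair n R) ⊆ S := by
    rintro _ (⟨e, rfl⟩ | ⟨e, rfl⟩)
    · simp only [TrivSqZeroExt.fst_one]
      rw [coeff_one]
      split_ifs
      exacts [hP.one_mem, hP.zero_mem]
    · simpa using hP.zero_mem
  obtain ⟨hp1, hp2⟩ := computes_mul_prod_message (G := G) (rank := rank) (Arc := Arc)
    (S := S ∪ V) hq (.inl hP.zero_mem) (fun u => .inl (hP.y_mem u)) hD (A := A₀)
    (x := 1) (Y := ∅) ⟨⟨1, by simp⟩, by simpa using inBox_zero _⟩
    (h1S.trans Set.subset_union_left) roots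
    (fun c hc => by rw [lowerNbrs_eq_empty (Finset.mem_filter.1 hc).2])
    (fun c _ u _ => (Set.subset_biUnion_of_mem (u := fun u => pairSet (D u))
      (Finset.mem_coe.2 (Finset.mem_filter.2 ⟨Finset.mem_univ u, (rank u).2⟩))).trans
      Set.subset_union_right) hW0
    (fun c => (Finset.card_le_card (fun u hu => by
      simpa using (Finset.mem_filter.1 hu).2.1)).trans (hW c)) (κ := κ) (by simp)
  rw [one_mul] at hp1 hp2
  refine ⟨D, hD, fun A hA l => hDr A hA l l.2, hp1, hDc.bind hp2 ?_⟩
  have hsum : ∑ l ∈ Finset.univ.filter fun l : Fin n => (l : ℕ) < n, cost l ≤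
      8 * (n * W ^ 2 * q ^ κ) + 7 * κ ^ 2 * (n * W * q ^ (2 * κ)) := by
    rw [Finset.filter_true_of_mem (fun l _ => l.2)]
    simp only [hcost]
    rw [← Finset.mul_sum, Finset.sum_add_distrib, ← Finset.sum_mul, Finset.sum_const,
      Finset.card_univ, Fintype.card_fin, smul_eq_mul]
    calc W * ((∑ l, (Finset.univ.filter fun c => IsParent G c l).card) * (8 * W * q ^ κ) +
          n * (7 * κ ^ 2 * q ^ (2 * κ)))
        ≤ W * (n * (8 * W * q ^ κ) + n * (7 * κ ^ 2 * q ^ (2 * κ))) := by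
          gcongr
          exact sum_card_children_le G
      _ = _ := by ring
  have hr : roots.card * (8 * W * q ^ κ) ≤ 8 * (n * W ^ 2 * q ^ κ) := by
    have h1 : roots.card ≤ n := (Finset.card_le_univ _).trans (by simp)
    calc roots.card * (8 * W * q ^ κ) ≤ n * (8 * (W * W) * q ^ κ) := by
          gcongr
          exact Nat.le_mul_of_pos_left _ hW0
      _ = _ := by ring
  omega

end Dynamic

/-! ### The algorithm for a given discrete input -/

section Algorithm

open MvPolynomial

/-- The polynomial with the given support and coefficients. -/
noncomputable def polyOf {n : ℕ} {R : Type*} [CommRing R] (A : Finset (Fin n →₀ ℕ))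
    (c : (Fin n →₀ ℕ) → R) : MvPolynomial (Fin n) R :=
  ∑ e ∈ A, monomial e (c e)

section PolyOf

variable {n : ℕ} {R : Type*} [CommRing R] (A : Finset (Fin n →₀ ℕ)) (c : (Fin n →₀ ℕ) → R)

open Classical in
theorem coeff_polyOf (e : Fin n →₀ ℕ) : (polyOf A c).coeff e = if e ∈ A then c e else 0 := by
  simp [polyOf, coeff_sum, coeff_monomial]

theorem support_polyOf_subset : (polyOf A c).support ⊆ A := by
  classical
  intro e he
  rw [mem_support_iff, coeff_polyOf] at he
  by_contra h
  simp [h] at he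

theorem coeffSet_polyOf {S : Set R} (h0 : (0 : R) ∈ S) (h : ∀ e ∈ A, c e ∈ S) :
    coeffSet (polyOf A c) ⊆ S := by
  classical
  rintro _ ⟨e, rfl⟩
  simp only [coeff_polyOf]
  split_ifs with he
  exacts [h e he, h0]

theorem map_polyOf {R' : Type*} [CommRing R'] (f : R →+* R') :
    map f (polyOf A c) = polyOf A fun e => f (c e) := by
  simp [polyOf, map_sum, map_monomial]

theorem polyOf_support (p : MvPolynomial (Fin n) R) : polyOf p.support p.coeff = p :=
  (p.as_sum).symm

end PolyOf

/-- `A` is the support of a polynomial in the variables `Y` whose term of highest degree in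
`x_i` is a multiple of `x_i ^ d` and whose degree in the other variables is less than `q`. -/
structure IsMonicSupport {n : ℕ} (q : ℕ) (Y : Set (Fin n)) (i : Fin n) (d : ℕ)
    (A : Finset (Fin n →₀ ℕ)) : Prop where
  pos : 0 < d
  lead_mem : Finsupp.single i d ∈ A
  eq_or_lt : ∀ e ∈ A, e = Finsupp.single i d ∨ e i < d
  mem_of_ne : ∀ e ∈ A, ∀ m, e m ≠ 0 → m ∈ Y
  lt : ∀ e ∈ A, ∀ m, m ≠ i → e m < q

namespace Shape

variable (s : Shape)

/-- The choices of one node of each rank that are compatible with the arcs. -/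
abbrev IsChain (A : Fin s.n → Fin s.N) : Prop := IsChainOf s.G s.rank s.Arc A

/-- The conditions on the discrete part of an input that the algorithm relies on. -/
structure Good : Prop where
  n_pos : 0 < s.n
  q_pos : 0 < s.q
  m_pos : 0 < s.m
  perfect : IsPerfectElimination s.G
  exists_chain : ∃ A, s.IsChain A
  exists_system : ∀ l, ∀ i ∈ lowerNbrs s.G l, ∃ j d, d ≤ s.q ∧
    IsMonicSupport s.q {m | m ∈ lowerNbrs s.G l ∧ i ≤ m} i d (s.systemSupport j)
  exists_node : ∀ v, (∃ A, s.IsChain A ∧ A (s.rank v) = v) → ∃ d,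
    IsMonicSupport s.q {m | m ∈ insert (s.rank v) (lowerNbrs s.G (s.rank v))} (s.rank v) d
      (s.nodeSupport v)
  summand : ∀ l, s.summandSupport l ⊆ box (cap s.q (insert l (lowerNbrs s.G l)))

variable {s}
variable {L : Type*} [Field L]

/-- The polynomial `f_j` of the system, over `L`. -/
noncomputable def systemPoly (inp : s.Input → L) (j : Fin s.m) : MvPolynomial (Fin s.n) L :=
  polyOf (s.systemSupport j) fun e => inp (.system j e)

/-- The polynomial of the node `v`, over `L`. -/
noncomputable def nodePoly (inp : s.Input → L) (v : Fin s.N) : MvPolynomial (Fin s.n) L :=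
  polyOf (s.nodeSupport v) fun e => inp (.node v e)

/-- The summand `h_l`, over `L`. -/
noncomputable def summandPoly (inp : s.Input → L) (l : Fin s.n) : MvPolynomial (Fin s.n) L :=
  polyOf (s.summandSupport l) fun e => inp (.summand l e)

variable (s) in
/-- The conditions on the coefficients of an input that the algorithm relies on. -/
structure Valid (inp : s.Input → L) : Prop where
  ne_zero : ∀ j, ∀ e ∈ s.systemSupport j, inp (.system j e) ≠ 0
  lead : ∀ v, (∃ A, s.IsChain A ∧ A (s.rank v) = v) → ∀ Y d,
    IsMonicSupport s.q Y (s.rank v) d (s.nodeSupport v) →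
    inp (.node v (Finsupp.single (s.rank v) d)) = 1
  system_mem : ∀ A, s.IsChain A → ∀ j,
    systemPoly inp j ∈ Ideal.span (Set.range fun l => nodePoly inp (A l))

variable (s) in
/-- A field with a valid input and values of the random scalars. -/
structure Env where
  L : Type v
  [field : Field L]
  inp : s.Input → L
  valid : s.Valid inp
  z : Fin (s.n + s.N) → L

attribute [instance] Env.field

open Classical in
/-- The result of the dynamic program as a function of the random scalars: the weighted sum over
the chains of the values of the normal forms of `h`. -/
noncomputable def chainSum (inp : s.Input → L) (z : Fin (s.n + s.N) → L) : L :=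
  ∑ A ∈ Finset.univ.filter s.IsChain, (∏ l, z (Fin.natAdd s.n (A l))) *
    normalEval (fun l => nodePoly inp (A l)) (fun l => z (Fin.castAdd s.N l))
      (∑ l, summandPoly inp l)

/-- The functions of a valid input and the random scalars. -/
abbrev Fun (s : Shape) := (e : Env.{v} s) → e.L

variable (s) in
/-- The values that are available to the algorithm at the outset. -/
def initial : Set (Fun.{v} s) :=
  {0, 1} ∪ Set.range (fun (a : s.Input) (e : Env.{v} s) => e.inp a) ∪
    Set.range fun (i : Fin (s.n + s.N)) (e : Env.{v} s) => e.z i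

/-- Evaluation at an input, as a ring homomorphism. -/
abbrev evalEnv (e : Env.{v} s) : Fun.{v} s →+* e.L := Pi.evalRingHom (fun e : Env.{v} s => e.L) e

theorem map_substVar {n : ℕ} {R R' : Type*} [CommRing R] [CommRing R'] (f : R →+* R') (l : Fin n)
    (a : R) (g : MvPolynomial (Fin n) R) :
    map f (substVar l a g) = substVar l (f a) (map f g) := by
  induction g using MvPolynomial.induction_on' with
  | monomial e c => rw [substVar_monomial, map_monomial, map_monomial, substVar_monomial]; simp
  | add p q hp hq => rw [map_add, map_add, map_add, map_add, hp, hq]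

variable (s) in
/-- The value at the random point of the normal form modulo the polynomials of the nodes `A l`,
for all inputs at once. -/
noncomputable def normalFun (A : Fin s.n → Fin s.N) :
    MvPolynomial (Fin s.n) (Fun.{v} s) →ₗ[Fun.{v} s] Fun.{v} s where
  toFun g := fun e => normalEval (fun l => nodePoly e.inp (A l))
    (fun l => e.z (Fin.castAdd s.N l)) (map (evalEnv e) g)
  map_add' g g' := by funext e; simp
  map_smul' a g := by
    funext e
    rw [smul_eq_C_mul, map_mul, map_C, ← smul_eq_C_mul, map_smul]
    rfl

theorem isMonicIn_nodePoly {inp : s.Input → L} (hv : s.Valid inp) {v : Fin s.N}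
    (h : ∃ A, s.IsChain A ∧ A (s.rank v) = v) {Y : Set (Fin s.n)} {d : ℕ}
    (hd : IsMonicSupport s.q Y (s.rank v) d (s.nodeSupport v)) :
    IsMonicIn (s.rank v) d (nodePoly inp v) := by
  classical
  intro e he
  rw [nodePoly, coeff_polyOf]
  by_cases h1 : e = Finsupp.single (s.rank v) d
  · rw [if_pos h1, h1, if_pos hd.lead_mem, hv.lead v h Y d hd]
  · rw [if_neg h1, if_neg]
    intro h2
    rcases hd.eq_or_lt e h2 with h3 | h3
    · exact h1 h3
    · omega

/-- The exponents other than the leading one lie in the box. -/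
theorem support_erase_subset_box {q : ℕ} {n : ℕ} {Y : Finset (Fin n)} {Y' : Set (Fin n)} {i : Fin n}
    {d : ℕ} {A : Finset (Fin n →₀ ℕ)} (h : IsMonicSupport q Y' i d A) (hY : Y' ⊆ Y) (hd : d ≤ q)
    (hi : i ∈ Y) : A.erase (Finsupp.single i d) ⊆ box (cap q Y) := by
  intro e he
  obtain ⟨h1, h2⟩ := Finset.mem_erase.1 he
  rw [mem_box]
  intro m
  by_cases hm : m = i
  · subst hm
    rcases h.eq_or_lt e h2 with h3 | h3
    · exact absurd h3 h1
    · simp [cap, hi]; omega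
  · by_cases hmY : m ∈ Y
    · simpa [cap, hmY] using h.lt e h2 m hm
    · have : e m = 0 := by
        by_contra h0
        exact hmY (hY (h.mem_of_ne e h2 m h0))
      simp [cap, hmY, this]

open Classical in
/-- A straight-line program for `chainSum`. -/
theorem Good.computes_chainSum (hs : s.Good) {W κ : ℕ}
    (hW : ∀ l, (Finset.univ.filter fun u => s.rank u = l).card ≤ W)
    (hκ : ∀ l, (lowerNbrs s.G l).card + 1 ≤ κ) :
    ∃ k, s.n + s.N + (k + 1) ≤
        16 * κ ^ 2 * (s.n * W * s.q ^ (2 * κ) + s.n * W ^ 2 * s.q ^ κ) ∧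
      Computes k (initial.{v} s) {fun e : Env.{v} s => chainSum e.inp e.z} := by
  classical
  obtain ⟨A₀, hA₀⟩ := hs.exists_chain
  have hq := hs.q_pos
  have : Nonempty (Fin s.m) := ⟨⟨0, hs.m_pos⟩⟩
  have hrank : ∀ A, s.IsChain A → ∀ l, ∃ B, s.IsChain B ∧ B (s.rank (A l)) = A l :=
    fun A hA l => ⟨A, hA, by rw [hA.1]⟩
  have hW0 : 0 < W := by
    refine lt_of_lt_of_le ?_ (hW ⟨0, hs.n_pos⟩)
    exact Finset.card_pos.2 ⟨A₀ ⟨0, hs.n_pos⟩, by simp [hA₀.1]⟩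
  -- the polynomials used for the reduction; those of the system are divided by their leading
  -- coefficients and multiplied by a power of `x_i` to make the degree in `x_i` equal to `q`
  choose! j d hdq hjd using hs.exists_system
  choose! deg hdeg using hs.exists_node
  set R := Fun.{v} s
  set ιn : s.Input → R := fun a e => e.inp a with hιn
  set ν : Fin s.n → Fin s.n → (Fin s.n →₀ ℕ) → R := fun l i e =>
    0 - ιn (.system (j l i) e) / ιn (.system (j l i) (Finsupp.single i (d l i))) with hν
  set sysA : Fin s.n → Fin s.n → Finset (Fin s.n →₀ ℕ) := fun l i =>
    (s.systemSupport (j l i)).erase (Finsupp.single i (d l i)) with hsysA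
  set tail : Fin s.n → Fin s.n → MvPolynomial (Fin s.n) R := fun l i =>
    monomial (Finsupp.single i (s.q - d l i)) 1 * polyOf (sysA l i) (ν l i) with htail
  set nodeA : Fin s.N → Finset (Fin s.n →₀ ℕ) := fun v =>
    (s.nodeSupport v).erase (Finsupp.single (s.rank v) (deg v)) with hnodeA
  set η : Fin s.N → (Fin s.n →₀ ℕ) → R := fun v e => 0 - ιn (.node v e) with hη
  set nodeTail : Fin s.N → MvPolynomial (Fin s.n) R := fun v => polyOf (nodeA v) (η v)
    with hnodeTail
  set h : Fin s.n → MvPolynomial (Fin s.n) R := fun l =>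
    polyOf (s.summandSupport l) fun e => ιn (.summand l e) with hh
  set y : Fin s.N → R := fun u e => e.z (Fin.natAdd s.n u) with hy
  set r : Fin s.n → R := fun l e => e.z (Fin.castAdd s.N l) with hr
  have h0 : (0 : R) ∈ initial.{v} s := .inl (.inl (.inl rfl))
  have h1 : (1 : R) ∈ initial.{v} s := .inl (.inl (.inr rfl))
  have hin : ∀ a, ιn a ∈ initial.{v} s := fun a => .inl (.inr ⟨a, rfl⟩)
  set onChain := Finset.univ.filter fun v : Fin s.N =>
    (∃ A, s.IsChain A ∧ A (s.rank v) = v) ∧ deg v ≤ s.q with honChain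
  set T₁ : Set R := ⋃ l ∈ (Finset.univ : Finset (Fin s.n)), ⋃ i ∈ lowerNbrs s.G l,
    ⋃ e ∈ sysA l i, {ν l i e} with hT₁
  set T₂ : Set R := ⋃ v ∈ onChain, ⋃ e ∈ nodeA v, {η v e} with hT₂
  have hsysbox : ∀ l, ∀ i ∈ lowerNbrs s.G l, sysA l i ⊆ box (cap s.q (lowerNbrs s.G l)) :=
    fun l i hi => support_erase_subset_box (hjd l i hi) (fun m hm => hm.1) (hdq l i hi) hi
  have hnodebox : ∀ v ∈ onChain, nodeA v ⊆ box (cap s.q (insert (s.rank v)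
      (lowerNbrs s.G (s.rank v)))) := by
    intro v hv
    obtain ⟨h1, h2⟩ := (Finset.mem_filter.1 hv).2
    exact support_erase_subset_box (hdeg v h1) (fun m hm => hm) h2 (Finset.mem_insert_self _ _)
  have hpow : ∀ {a : ℕ}, a ≤ κ → s.q ^ a ≤ s.q ^ κ := fun h => Nat.pow_le_pow_right hq h
  have hc₁ : Computes (2 * κ * (s.n * s.q ^ κ)) (initial.{v} s) T₁ := by
    refine Computes.biUnion_const (c := κ * (s.q ^ κ * 2)) _ (fun l _ => ?_) ?_
    · refine Computes.biUnion_const (c := s.q ^ κ * 2) _ (fun i hi => ?_) ?_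
      · refine Computes.biUnion_const (c := 2) _ (fun e _ => ?_) ?_
        · exact (Computes.div (hin _) (hin _)).bind (Computes.sub (.inl h0) (.inr rfl)) le_rfl
        · refine Nat.mul_le_mul_right _ ((Finset.card_le_card (hsysbox l i hi)).trans ?_)
          rw [card_box_cap]
          exact hpow ((Nat.le_succ _).trans (hκ l))
      · exact Nat.mul_le_mul_right _ ((Nat.le_succ _).trans (hκ l))
    · rw [Finset.card_univ, Fintype.card_fin]
      exact le_of_eq (by ring)
  have hc₂ : Computes (s.N * s.q ^ κ) (initial.{v} s) T₂ := by
    refine Computes.biUnion_const (c := s.q ^ κ) _ (fun v hv => ?_)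
      (Nat.mul_le_mul_right _ ((Finset.card_le_univ _).trans (by simp)))
    refine Computes.biUnion_const (c := 1) _ (fun e _ => Computes.sub h0 (hin _)) ?_
    rw [mul_one]
    refine (Finset.card_le_card (hnodebox v hv)).trans ?_
    rw [card_box_cap]
    exact hpow ((Finset.card_insert_le _ _).trans (hκ _))
  set S := initial.{v} s ∪ (T₁ ∪ T₂) with hS
  have hS0 : initial.{v} s ⊆ S := Set.subset_union_left
  have hP : ProgramData s.G s.rank s.Arc s.q S tail deg nodeTail h y r := by
    refine ⟨hS0 h0, hS0 h1, fun v => hS0 (.inr ⟨_, rfl⟩), fun l => hS0 (.inr ⟨_, rfl⟩),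
      fun l => coeffSet_polyOf _ _ (hS0 h0) fun e _ => hS0 (hin _),
      fun l => inBox_iff.2 ((support_polyOf_subset _ _).trans (hs.summand l)),
      fun l i hi => ?_, fun l i hi => ?_, fun A hA l hd => ?_, fun A hA l hd => ?_⟩
    · refine coeffSet_monomial_one_mul _ _ (hS0 h0) (coeffSet_polyOf _ _ (hS0 h0) fun e he => ?_)
      refine .inr (.inl ?_)
      exact Set.mem_biUnion (Finset.mem_coe.2 (Finset.mem_univ l))
        (Set.mem_biUnion (Finset.mem_coe.2 hi) (Set.mem_biUnion (Finset.mem_coe.2 he) rfl))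
    · intro e he m
      obtain ⟨e', he', rfl⟩ := exists_of_mem_support_monomial_mul he
      have he'' := support_polyOf_subset _ _ he'
      have hb := mem_box.1 (hsysbox l i hi he'') m
      obtain ⟨hne, hmem⟩ := Finset.mem_erase.1 he''
      by_cases hmi : m = i
      · subst hmi
        rcases (hjd l m hi).eq_or_lt e' hmem with h3 | h3
        · exact absurd h3 hne
        · have := hdq l m hi
          simp [cap, hi]
          omega
      · by_cases hml : m ∈ (lowerNbrs s.G l).filter (i ≤ ·)
        · have hm' := (Finset.mem_filter.1 hml).1
          simpa [cap, hml, Ne.symm hmi, hm'] using hb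
        · have : e' m = 0 := by
            by_contra h0
            exact hml (Finset.mem_filter.2 ((hjd l i hi).mem_of_ne e' hmem m h0))
          simp only [Finsupp.add_apply, Finsupp.single_apply, if_neg (Ne.symm hmi), this]
          exact cap_pos hq _ m
    · refine coeffSet_polyOf _ _ (hS0 h0) fun e he => .inr (.inr ?_)
      exact Set.mem_biUnion (Finset.mem_coe.2 (Finset.mem_filter.2
        ⟨Finset.mem_univ _, hrank A hA l, hd⟩)) (Set.mem_biUnion (Finset.mem_coe.2 he) rfl)
    · intro e he m
      have he' := support_polyOf_subset _ _ he
      have hb := mem_box.1 (hnodebox (A l) (Finset.mem_filter.2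
        ⟨Finset.mem_univ _, hrank A hA l, hd⟩) he') m
      have hm := hdeg (A l) (hrank A hA l)
      rw [hA.1] at hb
      by_cases hml : m = l
      · subst hml
        obtain ⟨hne, hmem⟩ := Finset.mem_erase.1 he'
        rcases hm.eq_or_lt e hmem with h3 | h3
        · exact absurd h3 hne
        · rw [hA.1] at h3
          simpa using h3
      · simpa [hml] using hb
  obtain ⟨D, hD, hDr, htot, hc⟩ := exists_program hs.perfect hq hP (A₀ := A₀) hW0 hW hκ
  -- the functionals that justify the reductions
  have hmonic : ∀ (e : Env.{v} s) (A : Fin s.n → Fin s.N), (∀ l, s.rank (A l) = l) →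
      (∀ l, ∃ B, s.IsChain B ∧ B l = A l) →
      ∀ l, IsMonicIn l (deg (A l)) (nodePoly e.inp (A l)) ∧ 0 < deg (A l) := by
    intro e A hA hB l
    obtain ⟨B, hB, hBl⟩ := hB l
    have hch : ∃ B, s.IsChain B ∧ B (s.rank (A l)) = A l := ⟨B, hB, by rw [hA, hBl]⟩
    have h2 := hdeg (A l) hch
    have h3 := isMonicIn_nodePoly e.valid hch h2
    rw [hA] at h3
    exact ⟨h3, h2.pos⟩
  have hch : ∀ A, s.IsChain A → ∀ l, ∃ B, s.IsChain B ∧ B l = A l := fun A hA l => ⟨A, hA, rfl⟩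
  have hmap : ∀ (e : Env.{v} s) (g : MvPolynomial (Fin s.n) R) (Y : Set (Fin s.n)),
      g ∈ supported R Y → map (evalEnv e) g ∈ supported e.L Y := by
    intro e g Y hg
    rw [mem_supported_iff_support] at hg ⊢
    exact fun a ha => hg a (support_map_subset _ _ ha)
  have hDs : ∀ v, (D v).snd ∈ supported R {m | s.rank v < m ∧ s.G.Adj (s.rank v) m} := by
    intro v
    refine supported_mono ?_ (hD v).2.mem_supported
    intro m hm
    exact mem_lowerNbrs.1 hm
  have hideal : ∀ (e : Env.{v} s) (A : Fin s.n → Fin s.N), s.IsChain A → ∀ l,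
      ∀ g ∈ nodeIdeal s.G s.rank s.q tail deg nodeTail (A l),
      map (evalEnv e) g ∈ Ideal.span (Set.range fun l => nodePoly e.inp (A l)) := by
    intro e A hA l g hg
    rw [← Ideal.mem_comap]
    refine (Ideal.span_le.2 ?_) hg
    rintro _ (rfl | ⟨i, hi, rfl⟩)
    · refine Ideal.mem_comap.2 ?_
      have h2 := hdeg (A l) (hrank A hA l)
      have hX : (X (s.rank (A l)) ^ deg (A l) : MvPolynomial (Fin s.n) e.L) =
          monomial (Finsupp.single (s.rank (A l)) (deg (A l)))
            (e.inp (.node (A l) (Finsupp.single (s.rank (A l)) (deg (A l))))) := by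
        rw [e.valid.lead _ (hrank A hA l) _ _ h2, X_pow_eq_monomial]
      have : map (evalEnv e) (X (s.rank (A l)) ^ deg (A l) - nodeTail (A l)) =
          nodePoly e.inp (A l) := by
        rw [map_sub, map_pow, map_X, hX, hnodeTail, map_polyOf, nodePoly, polyOf, polyOf,
          ← Finset.add_sum_erase _ _ h2.lead_mem, sub_eq_add_neg, ← Finset.sum_neg_distrib]
        congr 1
        refine Finset.sum_congr rfl fun a _ => ?_
        have h3 : evalEnv e (η (A l) a) = -e.inp (.node (A l) a) := zero_sub _
        rw [h3, map_neg, neg_neg]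
      rw [this]
      exact Ideal.subset_span ⟨l, rfl⟩
    · refine Ideal.mem_comap.2 ?_
      rw [hA.1] at hi ⊢
      have h2 := hjd l i hi
      set c := e.inp (.system (j l i) (Finsupp.single i (d l i))) with hc
      have hc0 : c ≠ 0 := e.valid.ne_zero _ _ h2.lead_mem
      have : map (evalEnv e) (X i ^ s.q - tail l i) =
          (monomial (Finsupp.single i (s.q - d l i)) 1 * C c⁻¹) *
            systemPoly e.inp (j l i) := by
        have h3 : (C c⁻¹ : MvPolynomial (Fin s.n) e.L) * systemPoly e.inp (j l i) =
            X i ^ d l i - map (evalEnv e) (polyOf (sysA l i) (ν l i)) := by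
          rw [map_polyOf, systemPoly, polyOf, polyOf,
            ← Finset.add_sum_erase _ _ h2.lead_mem, mul_add, C_mul_monomial,
            inv_mul_cancel₀ hc0, X_pow_eq_monomial, sub_eq_add_neg, Finset.mul_sum,
            ← Finset.sum_neg_distrib]
          congr 1
          refine Finset.sum_congr rfl fun a _ => ?_
          have h4 : evalEnv e (ν l i a) = -(c⁻¹ * e.inp (.system (j l i) a)) := by
            rw [← div_eq_inv_mul]
            exact zero_sub _
          rw [h4, C_mul_monomial, map_neg, neg_neg]
        rw [mul_assoc, h3, map_sub, map_pow, map_X, htail, map_mul, map_monomial, map_one,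
          mul_sub, X_pow_eq_monomial, X_pow_eq_monomial, monomial_mul, ← Finsupp.single_add,
          Nat.sub_add_cancel (hdq l i hi), one_mul]
      rw [this]
      exact Ideal.mul_mem_left _ _ (e.valid.system_mem A hA _)
  have hsum := sum_chains (G := s.G) (rank := s.rank) (Arc := s.Arc) (y := y) (h := h) (D := D)
    (φ := normalFun.{v} s)
    (fun A A' hA hA' hB hB' k g hg hAA => by
      funext e
      exact normalEval_congr _ (fun l => (hmonic e A hA hB l).1)
        (fun l => (hmonic e A hA hB l).2) (fun l => (hmonic e A' hA' hB' l).1)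
        (fun l => (hmonic e A' hA' hB' l).2) (fun l hl => by rw [hAA l hl]) (hmap e g _ hg))
    (fun l => by
      refine supported_mono ?_ (hP.h_box l).mem_supported
      intro m hm
      rcases Finset.mem_insert.1 (Finset.mem_coe.1 hm) with rfl | hm
      · exact le_refl m
      · exact (mem_lowerNbrs.1 hm).1.le)
    (fun v => (hD v).1) hDs (fun A hA l => (hDr A hA l).1)
    (fun A hA l => by
      obtain ⟨-, g, hg, hgI, hgs⟩ := hDr A hA l
      funext e
      rw [hgs]
      have hm := hmonic e A hA.1 (hch A hA)
      rw [hA.1] at hg ⊢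
      have hsupp : ∀ i, nodePoly e.inp (A i) ∈ supported e.L {m : Fin s.n | i ≤ m} := by
        intro i
        rw [mem_supported_iff_support]
        intro a ha m hma
        have h2 := hdeg (A i) (hrank A hA i)
        have := h2.mem_of_ne a (support_polyOf_subset _ _ ha) m hma
        rw [hA.1, Set.mem_ofPred_eq, Finset.mem_insert] at this
        rcases this with rfl | h3
        · exact le_refl m
        · exact (mem_lowerNbrs.1 h3).1.le
      have e1 : normalFun.{v} s A (collect s.G s.rank s.Arc y h D (A l)).snd e =
          normalFun.{v} s A g e := by
        have h3 := normalEval_eq_zero_of_mem (r := fun l => e.z (Fin.castAdd s.N l))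
          (fun l => (hm l).1) hsupp (hideal e A hA l _ hgI)
        rw [map_sub, map_sub, sub_eq_zero] at h3
        exact h3
      rw [e1]
      have e2 : normalFun.{v} s A (substVar l (r l) g) e =
          normalEval (fun l => nodePoly e.inp (A l)) (fun l => e.z (Fin.castAdd s.N l))
            (substVar l (e.z (Fin.castAdd s.N l)) (map (evalEnv e) g)) := by
        rw [← show (evalEnv e) (r l) = e.z (Fin.castAdd s.N l) from rfl, ← map_substVar]
        rfl
      rw [e2]
      refine normalEval_substVar (fun l => (hm l).1) (fun l => (hm l).2) _ ?_ ?_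
      · refine hmap e g _ ?_
        rw [mem_supported_iff_support]
        intro a ha m hma
        by_cases hml : m = l
        · exact hml.ge
        · have h3 := hg a ha m
          rw [Function.update_of_ne hml] at h3
          have h4 : m ∈ lowerNbrs s.G l := by
            by_contra h5
            simp [cap, hml, h5] at h3
            exact hma h3
          exact (mem_lowerNbrs.1 h4).1.le
      · intro a ha
        have h3 := hg a (support_map_subset _ _ ha) l
        rw [Function.update_self] at h3
        exact h3.trans_le (min_le_left _ _))
    hA₀
  set P := ∏ c ∈ Finset.univ.filter fun c => ∀ p, ¬ IsParent s.G c p,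
    message s.G s.rank s.Arc y D A₀ c with hPdef
  -- no variables are left in the product of the messages of the roots
  have hPC : P.snd = C (P.snd.coeff 0) := by
    refine MvPolynomial.ext _ _ fun a => ?_
    rw [coeff_C]
    split_ifs with ha
    · rw [← ha]
    · rw [← notMem_support_iff]
      intro h2
      apply ha
      symm
      ext m
      have := htot.2 a h2 m
      simp [cap] at this
      simp [this]
  have hval : (fun e : Env.{v} s => chainSum e.inp e.z) = P.snd.coeff 0 := by
    have h2 : normalFun.{v} s A₀ P.snd = P.snd.coeff 0 := by
      funext e
      rw [hPC]
      have := normalEval_C (fun l => (hmonic e A₀ hA₀.1 (hch A₀ hA₀) l).1)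
        (fun l => (hmonic e A₀ hA₀.1 (hch A₀ hA₀) l).2)
        (fun l => e.z (Fin.castAdd s.N l)) (P.snd.coeff 0 e)
      simp only [coeff_C, if_true]
      simp only [normalFun, LinearMap.coe_mk, AddHom.coe_mk, map_C]
      exact this
    rw [← h2, hsum]
    funext e
    rw [chainSum, Finset.sum_apply]
    refine Finset.sum_congr rfl fun A _ => ?_
    rw [Pi.mul_apply, Finset.prod_apply]
    have h3 : ∑ l, summandPoly e.inp l = map (evalEnv e) (∑ l, h l) := by
      rw [map_sum]
      refine Finset.sum_congr rfl fun l _ => ?_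
      rw [hh, map_polyOf]
      rfl
    rw [h3]
    rfl
  rw [hval]
  refine ⟨_, ?_, ((hc₁.union hc₂ le_rfl).bind hc le_rfl).mono le_rfl subset_rfl
    (Set.singleton_subset_iff.2 (.inr ⟨0, rfl⟩))⟩
  -- the remaining estimates bound the cost
  have hN : s.N ≤ s.n * W := by
    have : (Finset.univ : Finset (Fin s.N)) = Finset.univ.biUnion fun l : Fin s.n =>
        Finset.univ.filter fun u => s.rank u = l := by
      ext u; simp
    calc s.N = (Finset.univ : Finset (Fin s.N)).card := by simp
      _ ≤ ∑ l : Fin s.n, (Finset.univ.filter fun u => s.rank u = l).card := by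
        conv_lhs => rw [this]
        exact Finset.card_biUnion_le
      _ ≤ ∑ _l : Fin s.n, W := Finset.sum_le_sum fun l _ => hW l
      _ = s.n * W := by simp
  have hκ0 : 0 < κ := lt_of_lt_of_le (Nat.succ_pos _) (hκ ⟨0, hs.n_pos⟩)
  have hn0 : 0 < s.n := hs.n_pos
  set a := s.n * W * s.q ^ (2 * κ) with ha
  set b := s.n * W ^ 2 * s.q ^ κ with hb
  have hqk : 1 ≤ s.q ^ (2 * κ) := Nat.one_le_pow _ _ hq
  have hnW : s.n * W ≤ a := Nat.le_mul_of_pos_right _ hqk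
  have hn' : s.n ≤ a := (Nat.le_mul_of_pos_right _ hW0).trans hnW
  have hqq : s.q ^ κ ≤ s.q ^ (2 * κ) := Nat.pow_le_pow_right hq (by omega)
  have hnq : s.n * W * s.q ^ κ ≤ a := Nat.mul_le_mul_left _ hqq
  have hNq : s.N * s.q ^ κ ≤ a := (Nat.mul_le_mul_right _ hN).trans hnq
  have hnq' : s.n * s.q ^ κ ≤ a := by
    refine le_trans ?_ hnq
    exact Nat.mul_le_mul_right _ (Nat.le_mul_of_pos_right _ hW0)
  have hκκ : κ ≤ κ ^ 2 := Nat.le_self_pow (by norm_num) κ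
  have hκ1 : 1 ≤ κ ^ 2 := Nat.one_le_pow _ _ hκ0
  have e1 : 2 * κ * (s.n * s.q ^ κ) ≤ 2 * (κ ^ 2 * a) := by
    rw [mul_assoc]
    exact Nat.mul_le_mul_left _ (Nat.mul_le_mul hκκ hnq')
  have e2 : a ≤ κ ^ 2 * a := Nat.le_mul_of_pos_left _ hκ1
  have e3 : b ≤ κ ^ 2 * b := Nat.le_mul_of_pos_left _ hκ1
  have e4 : 16 * κ ^ 2 * (a + b) = 16 * (κ ^ 2 * a) + 16 * (κ ^ 2 * b) := by ring
  have e5 : 7 * κ ^ 2 * a = 7 * (κ ^ 2 * a) := by ring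
  rw [e4, e5]
  have e6 : 1 ≤ a := by omega
  omega

end Shape

end Algorithm

/-! ### The computation tree and the distribution of its answer -/

namespace Shape

variable {s : Shape}

open Classical in
/-- A single computation tree serves all fields and coefficients: the straight-line program of
`Good.computes_chainSum`, preceded by the random draws and followed by a zero test. Its answer is
`true` with the probability that `chainSum` vanishes at a random point. -/
theorem Good.exists_tree (hs : s.Good) {W κ : ℕ}
    (hW : ∀ l, (Finset.univ.filter fun u => s.rank u = l).card ≤ W)
    (hκ : ∀ l, (lowerNbrs s.G l).card + 1 ≤ κ) :
    ∃ t : CompTree s.Input,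
      t.cost ≤ 16 * κ ^ 2 * (s.n * W * s.q ^ (2 * κ) + s.n * W ^ 2 * s.q ^ κ) ∧
      ∀ (L : Type v) [Field L] (inp : s.Input → L), s.Valid inp →
        ∀ (S : Finset L) (hS : S.Nonempty) (b : Bool), t.run S hS inp b =
          (((Fintype.piFinset fun _ : Fin (s.n + s.N) => S).filter fun z =>
            (chainSum inp z = 0) ↔ b = true).card : ℝ≥0∞) / (S.card : ℝ≥0∞) ^ (s.n + s.N) := by
  classical
  obtain ⟨k, hk, hc⟩ := hs.computes_chainSum.{v} hW hκ
  -- where the inputs, the constants and the random scalars are found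
  set loc : Fun.{v} s → Operand s.Input := fun x =>
    if x = 0 then .zero else if x = 1 then .one
    else if h : ∃ a : s.Input, (fun e : Env.{v} s => e.inp a) = x then .input h.choose
    else if h : ∃ i : Fin (s.n + s.N), (fun e : Env.{v} s => e.z i) = x then
      .reg (h.choose : Fin (s.n + s.N))
    else .zero with hloc
  obtain ⟨t, htc, ht⟩ := hc.exists_tree (fun e : Env.{v} s => e.inp) rfl loc (s.n + s.N) (by
    intro x _ i hi
    simp only [hloc] at hi
    split_ifs at hi with h1 h2 h3 h4
    simp only [Operand.reg.injEq] at hi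
    rw [← hi]
    exact h4.choose.2)
  refine ⟨drawAll 0 (s.n + s.N) t, by rw [cost_drawAll]; omega, ?_⟩
  intro L _ inp hv S hS b
  rw [CompTree.run, runFrom_drawAll]
  congr 1
  rw [Finset.card_filter, Nat.cast_sum]
  refine Finset.sum_congr rfl fun z _ => ?_
  set e : Env.{v} s := ⟨L, inp, hv, z⟩ with he
  obtain ⟨ht0, ht1⟩ := ht e S hS (storeAt 0 z 0) (by
    intro x hx
    simp only [hloc]
    split_ifs with h1 h2 h3 h4
    · rw [h1]; rfl
    · rw [h2]; rfl
    · exact congrFun h3.choose_spec e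
    · have : storeAt 0 z (0 : ℕ → L) (h4.choose : Fin (s.n + s.N)) = z h4.choose := by
        have := h4.choose.2
        simp [storeAt]
      exact this.trans (congrFun h4.choose_spec e)
    · exfalso
      rcases hx with (h | h) | h
      · rcases h with h | h
        exacts [h1 h, h2 h]
      · exact h3 h
      · exact h4 h)
  have hrun : CompTree.runFrom S hS inp t (storeAt 0 z 0) =
      PMF.pure (decide (chainSum inp z = 0)) := by
    by_cases h0 : chainSum inp z = 0
    · rw [show decide (chainSum inp z = 0) = true by simpa using h0]
      exact ht0 h0
    · rw [show decide (chainSum inp z = 0) = false by simpa using h0]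
      exact ht1 h0
  rw [hrun, PMF.pure_apply]
  by_cases h0 : chainSum inp z = 0 <;> cases b <;> simp [h0]

end Shape

open MvPolynomial in
open Classical in
/-- A nonzero polynomial of small degree does not vanish at a random point with probability at
least `1 / 2`. -/
theorem half_le_card_ne_zero {M D : ℕ} {L : Type*} [Field L] {S : Finset L} (hS : S.Nonempty)
    {p : MvPolynomial (Fin M) L} (hp : p ≠ 0) (hD : p.totalDegree ≤ D) (hcard : 2 * D ≤ S.card) :
    (1 / 2 : ℝ≥0∞) ≤ (((Fintype.piFinset fun _ : Fin M => S).filter fun z =>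
      ¬ eval z p = 0).card : ℝ≥0∞) / (S.card : ℝ≥0∞) ^ M := by
  classical
  have hpos : 0 < S.card := hS.card_pos
  have hsz := schwartz_zippel_totalDegree hp S
  set Z := ((Fintype.piFinset fun _ : Fin M => S).filter fun z => eval z p = 0).card with hZ
  set Q := ((Fintype.piFinset fun _ : Fin M => S).filter fun z => ¬ eval z p = 0).card with hQ
  have hsum : Z + Q = S.card ^ M := by
    rw [hZ, hQ, Finset.card_filter_add_card_filter_not]
    simp
  have h1 : (2 * Z : ℕ) ≤ S.card ^ M := by
    have h2 : (Z : ℚ≥0) / (S.card : ℚ≥0) ^ M ≤ p.totalDegree / S.card := by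
      convert hsz using 2
    have hc : (0 : ℚ≥0) < S.card := by exact_mod_cast hpos
    have h3 : (p.totalDegree : ℚ≥0) / S.card ≤ 1 / 2 := by
      rw [div_le_div_iff₀ hc (by norm_num), one_mul]
      have : p.totalDegree * 2 ≤ S.card := by omega
      exact_mod_cast this
    have h4 := h2.trans h3
    rw [div_le_div_iff₀ (pow_pos hc M) (by norm_num), one_mul] at h4
    have : Z * 2 ≤ S.card ^ M := by exact_mod_cast h4
    omega
  have h2 : S.card ^ M ≤ 2 * Q := by omega
  have hS0 : ((S.card : ℝ≥0∞) ^ M) ≠ 0 := pow_ne_zero _ (by exact_mod_cast hpos.ne')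
  have hS1 : ((S.card : ℝ≥0∞) ^ M) ≠ ∞ := ENNReal.pow_ne_top (ENNReal.natCast_ne_top _)
  rw [ENNReal.le_div_iff_mul_le (.inl hS0) (.inl hS1), one_div,
    ENNReal.inv_mul_le_iff (by norm_num) (by norm_num)]
  exact_mod_cast h2

section ChainPolynomial

open MvPolynomial

variable {n N : ℕ} {L : Type*} [Field L]

theorem totalDegree_le_of_inBox {q : ℕ} {g : MvPolynomial (Fin n) L}
    (hg : InBox (fun _ => q) g) : g.totalDegree ≤ n * (q - 1) := by
  rw [totalDegree]
  refine Finset.sup_le fun e he => ?_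
  rw [Finsupp.sum_fintype _ _ fun _ => rfl]
  calc ∑ i, e i ≤ ∑ _i : Fin n, (q - 1) :=
        Finset.sum_le_sum fun i _ => Nat.le_sub_one_of_lt (hg e he i)
    _ = n * (q - 1) := by simp

/-- The weighted sum over the chains of the normal forms, as a polynomial in the random
scalars. -/
noncomputable def chainPoly (chains : Finset (Fin n → Fin N))
    (g : (Fin n → Fin N) → MvPolynomial (Fin n) L) : MvPolynomial (Fin (n + N)) L :=
  ∑ A ∈ chains, (∏ l, X (Fin.natAdd n (A l))) * rename (Fin.castAdd N) (g A)

theorem eval_chainPoly (chains : Finset (Fin n → Fin N))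
    (g : (Fin n → Fin N) → MvPolynomial (Fin n) L) (z : Fin (n + N) → L) :
    eval z (chainPoly chains g) = ∑ A ∈ chains, (∏ l, z (Fin.natAdd n (A l))) *
      eval (fun l => z (Fin.castAdd N l)) (g A) := by
  simp only [chainPoly, map_sum, map_mul, map_prod, eval_X, eval_rename]
  rfl

theorem totalDegree_chainPoly_le {q : ℕ} (hq : 0 < q) {chains : Finset (Fin n → Fin N)}
    {g : (Fin n → Fin N) → MvPolynomial (Fin n) L}
    (hg : ∀ A ∈ chains, InBox (fun _ => q) (g A)) :
    (chainPoly chains g).totalDegree ≤ n * q := by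
  refine totalDegree_finsetSum_le fun A hA => (totalDegree_mul _ _).trans ?_
  have h1 : (∏ l, X (Fin.natAdd n (A l)) : MvPolynomial (Fin (n + N)) L).totalDegree ≤ n := by
    refine (totalDegree_finsetProd _ _).trans ?_
    calc ∑ l : Fin n, (X (Fin.natAdd n (A l)) : MvPolynomial (Fin (n + N)) L).totalDegree
        ≤ ∑ _l : Fin n, 1 := Finset.sum_le_sum fun l _ => (totalDegree_X _).le
      _ = n := by simp
  have h2 := (totalDegree_rename_le (Fin.castAdd N) (g A)).trans
    (totalDegree_le_of_inBox (hg A hA))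
  calc _ ≤ n + n * (q - 1) := add_le_add h1 h2
    _ = n * (q - 1 + 1) := by ring
    _ = n * q := by rw [Nat.sub_add_cancel hq]

/-- Different chains have different monomials as weights, so that there is no cancellation
between them. -/
theorem chainPoly_ne_zero {rank : Fin N → Fin n} {chains : Finset (Fin n → Fin N)}
    (hch : ∀ A ∈ chains, ∀ l, rank (A l) = l) {g : (Fin n → Fin N) → MvPolynomial (Fin n) L}
    {A₀ : Fin n → Fin N} (hA₀ : A₀ ∈ chains) (hg : g A₀ ≠ 0) : chainPoly chains g ≠ 0 := by
  classical
  obtain ⟨e₀, he₀⟩ := ne_zero_iff.1 hg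
  set w : (Fin n → Fin N) → (Fin (n + N) →₀ ℕ) :=
    fun A => ∑ l, Finsupp.single (Fin.natAdd n (A l)) 1 with hw
  have hmon : ∀ A : Fin n → Fin N, (∏ l, X (Fin.natAdd n (A l)) : MvPolynomial (Fin (n + N)) L) =
      monomial (w A) 1 := by
    intro A
    rw [hw, monomial_sum_one]
    rfl
  refine ne_zero_iff.2 ⟨w A₀ + e₀.mapDomain (Fin.castAdd N), ?_⟩
  rw [chainPoly, coeff_sum, Finset.sum_eq_single_of_mem A₀ hA₀]
  · rw [hmon, coeff_monomial_mul, one_mul,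
      coeff_rename_mapDomain _ (Fin.castAdd_injective n N)]
    exact he₀
  · intro A hA hne
    rw [hmon, coeff_monomial_mul', if_neg]
    intro hle
    apply hne
    funext l
    have h1 : 1 ≤ w A (Fin.natAdd n (A l)) := by
      rw [hw]
      simp only [Finsupp.finsetSum_apply]
      calc 1 = (Finsupp.single (Fin.natAdd n (A l)) 1 : Fin (n + N) →₀ ℕ)
            (Fin.natAdd n (A l)) := by simp
        _ ≤ _ := Finset.single_le_sum
            (f := fun l' => (Finsupp.single (Fin.natAdd n (A l')) 1 : Fin (n + N) →₀ ℕ)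
              (Fin.natAdd n (A l))) (fun _ _ => Nat.zero_le _) (Finset.mem_univ l)
    have h2 := h1.trans (hle (Fin.natAdd n (A l)))
    rw [Finsupp.add_apply, Finsupp.mapDomain_of_notMem_range] at h2
    · rw [add_zero, hw] at h2
      simp only [Finsupp.finsetSum_apply] at h2
      obtain ⟨l', -, hl'⟩ := Finset.exists_ne_zero_of_sum_ne_zero (Nat.one_le_iff_ne_zero.1 h2)
      rw [Finsupp.single_apply_ne_zero] at hl'
      have h3 : A l = A₀ l' := Fin.natAdd_injective N n hl'.1
      have h4 : l = l' := by rw [← hch A hA l, h3, hch A₀ hA₀]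
      rw [h3, h4]
    · rintro ⟨i, hi⟩
      have := congrArg Fin.val hi
      simp at this
      omega

end ChainPolynomial

/-! ### Normal forms modulo a chain -/

section Monic

open MvPolynomial

variable {n : ℕ} {K : Type*} [Field K]

/-- The coefficient of `initialIn i f` at an exponent without `x_i` is that of `f` at the exponent
completed by the degree of `f` in `x_i`. -/
theorem isMonicIn_of_initialIn_eq_one {i : Fin n} {f : MvPolynomial (Fin n) K}
    (h : initialIn i f = 1) : IsMonicIn i (f.degreeOf i) f := by
  classical
  intro e he
  rcases he.lt_or_eq with he | he
  · have h1 : e ∉ f.support := fun h => absurd (monomial_le_degreeOf i h) (not_le.2 he)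
    rw [notMem_support_iff.1 h1, if_neg]
    rintro rfl
    simp at he
  · have h1 : f.coeff e = (initialIn i f).coeff (e.erase i) := by
      rw [initialIn, coeff_sum]
      simp only [coeff_monomial]
      rw [Finset.sum_eq_single e]
      · simp
      · intro e' he' hne
        rw [if_neg]
        intro h2
        apply hne
        rw [← Finsupp.single_add_erase i e', ← Finsupp.single_add_erase i e, h2,
          (Finset.mem_filter.1 he').2, he]
      · intro h2
        rw [if_pos rfl]
        by_contra h3
        exact h2 (Finset.mem_filter.2 ⟨mem_support_iff.2 h3, he.symm⟩)
    rw [h1, h, coeff_one]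
    refine if_congr ⟨fun h2 => ?_, fun h2 => ?_⟩ rfl rfl
    · rw [← Finsupp.single_add_erase i e, ← h2, he, add_zero]
    · rw [h2, Finsupp.erase_single]

theorem IsMainVar.degreeOf_pos {i : Fin n} {f : MvPolynomial (Fin n) K} (h : IsMainVar f i) :
    0 < f.degreeOf i := by
  obtain ⟨e, he, hi⟩ := (mem_vars_iff_mem_support i).1 h.1
  exact (Nat.pos_of_ne_zero (Finsupp.mem_support_iff.1 hi)).trans_le (monomial_le_degreeOf i he)

theorem IsMainVar.mem_supported {i : Fin n} {f : MvPolynomial (Fin n) K} (h : IsMainVar f i) :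
    f ∈ supported K {m | i ≤ m} :=
  MvPolynomial.mem_supported.2 fun m hm => h.2 m hm

theorem IsMonicIn.isMonicSupport {q d : ℕ} {Y : Set (Fin n)} {i : Fin n}
    {f : MvPolynomial (Fin n) K} (h : IsMonicIn i d f) (hd : 0 < d) (hY : f ∈ supported K Y)
    (hq : ∀ m, m ≠ i → f.degreeOf m < q) : IsMonicSupport q Y i d f.support where
  pos := hd
  lead_mem := by simp [mem_support_iff, h (Finsupp.single i d) (by simp)]
  eq_or_lt e he := by
    by_contra! h1
    rw [mem_support_iff, h e h1.2, if_neg h1.1] at he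
    exact he rfl
  mem_of_ne := mem_supported_iff_support.1 hY
  lt e he m hm := (monomial_le_degreeOf m he).trans_lt (hq m hm)

theorem IsMonicIn.eq_of_isMonicSupport {q d d' : ℕ} {Y : Set (Fin n)} {i : Fin n}
    {f : MvPolynomial (Fin n) K} (h : IsMonicIn i d f)
    (h' : IsMonicSupport q Y i d' f.support) : d' = d := by
  have h1 : d' ≤ d := by
    by_contra! h1
    have := h'.lead_mem
    rw [mem_support_iff, h _ (by simpa using h1.le), if_neg] at this
    · exact this rfl
    · intro h2
      have := DFunLike.congr_fun h2 i
      simp at this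
      omega
  rcases h'.eq_or_lt (Finsupp.single i d)
    (by simp [mem_support_iff, h (Finsupp.single i d) (by simp)]) with h2 | h2
  · have := DFunLike.congr_fun h2 i
    simp at this
    omega
  · simp at h2
    omega

theorem IsMonicIn.map {L : Type*} [Field L] (φ : K →+* L) {d : ℕ} {i : Fin n}
    {f : MvPolynomial (Fin n) K} (h : IsMonicIn i d f) :
    IsMonicIn i d (MvPolynomial.map φ f) := by
  intro e he
  rw [coeff_map, h e he]
  split_ifs <;> simp

/-- Division by monic polynomials `t_0, …, t_{n-1}`, where `t_l` involves only
`x_l, …, x_{n-1}`: the degree in `x_l` can be lowered without affecting the degrees in the greater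
variables. -/
theorem exists_inBox_sub_mem {t : Fin n → MvPolynomial (Fin n) K} {b : Fin n → ℕ}
    (ht : ∀ l, IsMonicIn l (b l) (t l)) (hs : ∀ l, t l ∈ supported K {m | l ≤ m})
    {I : Ideal (MvPolynomial (Fin n) K)} (hI : ∀ l, t l ∈ I) (g : MvPolynomial (Fin n) K) :
    ∃ g', InBox b g' ∧ g - g' ∈ I := by
  classical
  set J : Submodule K (MvPolynomial (Fin n) K) := I.restrictScalars K with hJ
  set B : ℕ → Set (Fin n →₀ ℕ) := fun k => {e | ∀ i : Fin n, (i : ℕ) < k → e i < b i} with hB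
  -- the reduction with respect to `x_l`, by induction on the degree in `x_l`
  have step : ∀ (l : Fin n) (k : ℕ), restrictSupport K (B l ∩ {e | e l < k}) ≤
      restrictSupport K (B l ∩ {e | e l < b l}) ⊔ J := by
    intro l k
    induction k with
    | zero =>
      refine le_sup_of_le_left (restrictSupport_mono _ ?_)
      rintro e ⟨-, he⟩
      simp at he
    | succ k ih =>
      rcases Nat.lt_or_ge k (b l) with hk | hk
      · refine le_sup_of_le_left (restrictSupport_mono _ ?_)
        rintro e ⟨h1, h2⟩
        exact ⟨h1, lt_of_le_of_lt (Nat.lt_succ_iff.1 h2) hk⟩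
      · conv_lhs => rw [restrictSupport_eq_span]
        rw [Submodule.span_le]
        rintro _ ⟨e, ⟨h1, h2⟩, rfl⟩
        rcases (Nat.lt_succ_iff.1 h2).lt_or_eq with h3 | h3
        · exact ih ((monomial_mem_restrictSupport (R := K)).2 (.inl ⟨h1, h3⟩))
        · -- replace `x_l ^ (b l)` by its remainder
          set a := Finsupp.single l (e l - b l) + e.erase l with ha
          have hea : e = a + Finsupp.single l (b l) := by
            rw [ha, add_right_comm, ← Finsupp.single_add, Nat.sub_add_cancel (h3 ▸ hk),
              Finsupp.single_add_erase]
          have hsum : (monomial e 1 : MvPolynomial (Fin n) K) =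
              -(monomial a 1 * (t l - X l ^ b l)) + monomial a 1 * t l := by
            rw [mul_sub, X_pow_eq_monomial, monomial_mul, one_mul, ← hea]
            ring
          simp only [SetLike.mem_coe]
          rw [hsum]
          refine Submodule.add_mem _ (ih ?_)
            (Submodule.mem_sup_right (I.mul_mem_left _ (hI l)))
          refine Submodule.neg_mem _ ?_
          intro η hη
          obtain ⟨η', hη', rfl⟩ := exists_of_mem_support_monomial_mul hη
          refine ⟨fun i hi => ?_, ?_⟩
          · have hil : i ≠ l := by rintro rfl; exact lt_irrefl _ hi
            have h4 : η' i = 0 := by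
              rcases Finset.mem_union.1 (support_sub _ _ _ hη') with h5 | h5
              · exact eq_zero_of_mem_supported (hs l) (by simpa using hi) η' h5
              · rw [X_pow_eq_monomial] at h5
                rw [Finset.mem_singleton.1 (support_monomial_subset h5),
                  Finsupp.single_eq_of_ne hil]
            have h5 : a i = e i := by rw [hea]; simp [hil]
            rw [Finsupp.add_apply, h4, add_zero, h5]
            exact h1 i hi
          · have h4 := (ht l).sub η' hη'
            have h5 : a l = k - b l := by simp [ha, h3]
            simp only [Set.mem_ofPred_eq, Finsupp.add_apply, h5]
            omega
  -- the reduction with respect to the variables `x_0, …, x_{k-1}`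
  have key : ∀ k, k ≤ n → (⊤ : Submodule K (MvPolynomial (Fin n) K)) ≤
      restrictSupport K (B k) ⊔ J := by
    intro k
    induction k with
    | zero =>
      intro _
      have : B 0 = Set.univ := by ext; simp [hB]
      rw [this, restrictSupport_univ]
      exact le_sup_left
    | succ k ih =>
      intro hk
      refine (ih (by omega)).trans (sup_le ?_ le_sup_right)
      set l : Fin n := ⟨k, hk⟩ with hl
      intro p hp
      have h1 : p ∈ restrictSupport K (B l ∩ {e | e l < p.degreeOf l + 1}) := fun e he =>
        ⟨hp he, Nat.lt_succ_of_le (monomial_le_degreeOf l he)⟩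
      have h2 : B l ∩ {e | e l < b l} ⊆ B (k + 1) := by
        rintro e ⟨h3, h4⟩ i hi
        rcases (Nat.lt_succ_iff.1 hi).lt_or_eq with h5 | h5
        · exact h3 i h5
        · obtain rfl : i = l := Fin.ext h5
          exact h4
      exact (sup_le_sup_right (restrictSupport_mono _ h2) J) (step l _ h1)
  obtain ⟨p, hp, j, hj, hpj⟩ := Submodule.mem_sup.1 (key n le_rfl (Submodule.mem_top (x := g)))
  exact ⟨p, fun e he i => hp he i i.2, by rw [← hpj, add_sub_cancel_left]; exact hj⟩

/-- `normalEval` is the value of any reduced representative. -/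
theorem normalEval_eq_of_sub_mem {t : Fin n → MvPolynomial (Fin n) K} {d : Fin n → ℕ}
    (r : Fin n → K) (ht : ∀ l, IsMonicIn l (d l) (t l))
    (hs : ∀ l, t l ∈ supported K {m | l ≤ m}) {g g' : MvPolynomial (Fin n) K} (hg' : InBox d g')
    (h : g - g' ∈ Ideal.span (Set.range t)) : normalEval t r g = eval r g' := by
  rw [← normalEval_of_inBox r ht hg', ← sub_eq_zero, ← map_sub]
  exact normalEval_eq_zero_of_mem r ht hs h

end Monic

/-! ### Cliques -/

section Cliques

variable {n : ℕ} {G : SimpleGraph (Fin n)}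

theorem mem_cliqueSet_iff {l m : Fin n} : m ∈ cliqueSet G l ↔ m ∈ insert l (lowerNbrs G l) := by
  rw [Finset.mem_insert, mem_lowerNbrs]
  rfl

theorem card_lowerNbrs_lt_cliqueNum (hG : IsPerfectElimination G) (l : Fin n) :
    (lowerNbrs G l).card + 1 ≤ G.cliqueNum := by
  rw [← Finset.card_insert_of_notMem fun h => lt_irrefl l (mem_lowerNbrs.1 h).1]
  refine SimpleGraph.IsClique.card_le_cliqueNum (t := insert l (lowerNbrs G l)) (tc := ?_)
  convert hG l using 1
  ext m
  exact mem_cliqueSet_iff.symm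

/-- With respect to a perfect elimination ordering, a maximal clique is the set `X_l` of its
greatest variable. -/
theorem exists_maximal_cliqueSet (hG : IsPerfectElimination G) (l : Fin n) :
    ∃ l', Maximal (fun s : Set (Fin n) => G.IsClique s) (cliqueSet G l') ∧
      cliqueSet G l ⊆ cliqueSet G l' := by
  obtain ⟨M, hlM, hM⟩ := Finite.exists_le_maximal (hG l)
  have hl : l ∈ M := hlM (.inl rfl)
  obtain ⟨l', hl', hmin⟩ := Set.exists_min_image M id (Set.toFinite M) ⟨l, hl⟩
  have hsub : M ⊆ cliqueSet G l' := by
    intro m hm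
    rcases (hmin m hm).eq_or_lt with h | h
    · exact .inl h.symm
    · exact .inr ⟨h, hM.1 hl' hm h.ne⟩
  have : M = cliqueSet G l' := hsub.antisymm (hM.2 (hG l') hsub)
  exact ⟨l', this ▸ hM, this ▸ hlM⟩

open MvPolynomial in
/-- Domination on the maximal cliques yields, for every `X_l` and every variable in it, a monic
polynomial of the system in the variables of `X_l`. -/
theorem IsChordallyQDominated.exists_monic {K : Type*} [Field K] (hG : IsPerfectElimination G)
    {q m : ℕ} {F : Fin m → MvPolynomial (Fin n) K}
    (hF : IsChordallyQDominated G q {g | g ∈ Set.range F ∧ IsReduced q g}) {l i : Fin n}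
    (hi : i ∈ cliqueSet G l) :
    ∃ j d, 0 < d ∧ d ≤ q ∧ IsMonicIn i d (F j) ∧
      F j ∈ supported K {m | m ∈ cliqueSet G l ∧ i ≤ m} ∧
      ∀ m, m ≠ i → (F j).degreeOf m < q := by
  obtain ⟨l', hmax, hsub⟩ := exists_maximal_cliqueSet hG l
  obtain ⟨_, ⟨⟨⟨j, rfl⟩, hred⟩, hsupp⟩, hmain, hinit, hdeg⟩ := hF l' hmax i (hsub hi)
  refine ⟨j, _, hmain.degreeOf_pos, hdeg, isMonicIn_of_initialIn_eq_one hinit, ?_,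
    hred i hmain⟩
  rw [mem_supported] at hsupp ⊢
  intro m hm
  refine ⟨?_, hmain.2 m hm⟩
  have hli : l ≤ i := by
    rcases hi with h | h
    exacts [h.ge, h.1.le]
  rcases (hli.trans (hmain.2 m hm)).eq_or_lt with h | h
  · exact .inl h.symm
  · exact .inr ⟨h, hmax.1 (hsub (.inl rfl)) (hsupp hm) h.ne⟩

end Cliques

/-! ### Inputs that satisfy the hypotheses -/

section Input

open MvPolynomial

variable {K : Type u} [Field K] {n q m N : ℕ} {G : SimpleGraph (Fin n)}
  {F : Fin m → MvPolynomial (Fin n) K} {𝒩 : ChordalNetwork K G N}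
  {f : Fin N → MvPolynomial (Fin n) K} {hs : Fin n → MvPolynomial (Fin n) K}

/-- The hypotheses on the system, the network and the summands. -/
structure IsInput (q : ℕ) (F : Fin m → MvPolynomial (Fin n) K) (𝒩 : ChordalNetwork K G N)
    (f : Fin N → MvPolynomial (Fin n) K) (hs : Fin n → MvPolynomial (Fin n) K) : Prop where
  perfect : IsPerfectElimination G
  dominated : IsChordallyQDominated G q {g | g ∈ Set.range F ∧ IsReduced q g}
  represents : 𝒩.Represents f (Set.range F)
  reduced : ∀ w, IsReduced q (f w)
  summand_supported : ∀ l, hs l ∈ supported K (cliqueSet G l)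
  summand_degree : ∀ l i, (hs l).degreeOf i < q

theorem ChordalNetwork.Represents.chainPolys_eq (h : 𝒩.Represents f (Set.range F))
    (C : Fin n → Fin N) : 𝒩.chainPolys C = Set.range fun l => f (C l) := by
  ext g
  simp only [ChordalNetwork.chainPolys, Set.mem_iUnion, (h.triangular _).1,
    Set.mem_singleton_iff, Set.mem_range, eq_comm]

/-- By Hilbert's Nullstellensatz, the ideal of a chain consists of the polynomials that vanish on
its variety. -/
theorem ChordalNetwork.Represents.mem_span_iff (h : 𝒩.Represents f (Set.range F))
    {C : Fin n → Fin N} (hC : 𝒩.IsChain C) {g : MvPolynomial (Fin n) K} :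
    g ∈ Ideal.span (Set.range fun l => f (C l)) ↔
      ∀ x ∈ ChordalNet.variety (𝒩.chainPolys C), aeval x g = 0 := by
  have h1 : Ideal.span (Set.range fun l => f (C l)) =
      vanishingIdeal K (zeroLocus (AlgebraicClosure K)
        (Ideal.span (𝒩.chainPolys C))) := by
    rw [vanishingIdeal_zeroLocus_eq_radical, (h.chain_radical C hC).radical, h.chainPolys_eq]
  have h2 : zeroLocus (AlgebraicClosure K) (Ideal.span (𝒩.chainPolys C)) =
      ChordalNet.variety (𝒩.chainPolys C) := by
    ext x
    rw [mem_zeroLocus_iff]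
    refine ⟨fun hx p hp => hx p (Ideal.subset_span hp), fun hx p hp => ?_⟩
    have h3 : Ideal.span (𝒩.chainPolys C) ≤ RingHom.ker (aeval (R := K) x) :=
      Ideal.span_le.2 fun p hp => hx p hp
    exact h3 hp
  rw [h1, h2, mem_vanishingIdeal_iff]

/-- A polynomial vanishes on the variety of the system if and only if it belongs to the ideals of
all chains. -/
theorem ChordalNetwork.Represents.forall_variety_iff (h : 𝒩.Represents f (Set.range F))
    {g : MvPolynomial (Fin n) K} : (∀ x ∈ ChordalNet.variety (Set.range F), aeval x g = 0) ↔
      ∀ C, 𝒩.IsChain C → g ∈ Ideal.span (Set.range fun l => f (C l)) := by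
  rw [← h.variety_eq]
  constructor
  · intro hg C hC
    exact (h.mem_span_iff hC).2 fun x hx => hg x ⟨C, hC, hx⟩
  · rintro hg x ⟨C, hC, hx⟩
    exact (h.mem_span_iff hC).1 (hg C hC) x hx

theorem ChordalNetwork.Represents.system_mem (h : 𝒩.Represents f (Set.range F))
    {C : Fin n → Fin N} (hC : 𝒩.IsChain C) (j : Fin m) :
    F j ∈ Ideal.span (Set.range fun l => f (C l)) :=
  h.forall_variety_iff.1 (fun _ hx => hx (F j) ⟨j, rfl⟩) C hC

theorem ChordalNetwork.Represents.isMonicIn (h : 𝒩.Represents f (Set.range F))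
    {C : Fin n → Fin N} (hC : 𝒩.IsChain C) (l : Fin n) :
    IsMonicIn l ((f (C l)).degreeOf l) (f (C l)) :=
  isMonicIn_of_initialIn_eq_one (h.chain_triangular C hC l).2

/-- Modulo the ideal of a chain, every polynomial is congruent to one that is reduced both
with respect to the chain and to the degree bound `q`. -/
theorem IsInput.exists_normalForm (h : IsInput q F 𝒩 f hs) {C : Fin n → Fin N}
    (hC : 𝒩.IsChain C) (g : MvPolynomial (Fin n) K) :
    ∃ g', InBox (fun _ => q) g' ∧ InBox (fun l => (f (C l)).degreeOf l) g' ∧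
      g - g' ∈ Ideal.span (Set.range fun l => f (C l)) := by
  have hR := h.represents
  -- in each variable, the polynomial of the chain or one of the system, of smaller degree
  have hex : ∀ l, ∃ b t, IsMonicIn l b t ∧ t ∈ supported K {m | l ≤ m} ∧
      t ∈ Ideal.span (Set.range fun l => f (C l)) ∧ b ≤ q ∧ b ≤ (f (C l)).degreeOf l := by
    intro l
    rcases le_or_gt ((f (C l)).degreeOf l) q with h1 | h1
    · exact ⟨_, f (C l), hR.isMonicIn hC l, (hR.chain_triangular C hC l).1.mem_supported,
        Ideal.subset_span ⟨l, rfl⟩, h1, le_rfl⟩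
    · obtain ⟨j, d, -, hd, h2, h3, -⟩ := h.dominated.exists_monic h.perfect
        (l := l) (i := l) (.inl rfl)
      exact ⟨d, F j, h2, supported_mono (fun m hm => hm.2) h3, hR.system_mem hC j, hd,
        hd.trans h1.le⟩
  choose b t ht hs' hI hbq hbd using hex
  obtain ⟨g', h1, h2⟩ := exists_inBox_sub_mem ht hs' hI g
  exact ⟨g', fun e he i => (h1 e he i).trans_le (hbq i),
    fun e he i => (h1 e he i).trans_le (hbd i), h2⟩

/-- The conditions on the discrete part of the input hold, provided that there is a chain. -/
theorem IsInput.good (h : IsInput q F 𝒩 f hs) (hn : 0 < n) (hC : ∃ C, 𝒩.IsChain C) :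
    (shapeOf q F 𝒩 f hs).Good where
  n_pos := hn
  q_pos := (Nat.zero_le _).trans_lt (h.summand_degree ⟨0, hn⟩ ⟨0, hn⟩)
  m_pos := by
    obtain ⟨j, -⟩ := h.dominated.exists_monic h.perfect (l := ⟨0, hn⟩) (i := ⟨0, hn⟩) (.inl rfl)
    exact j.pos
  perfect := h.perfect
  exists_chain := hC
  exists_system := by
    intro l i hi
    have hil : i ∈ cliqueSet G l := .inr (mem_lowerNbrs.1 hi)
    obtain ⟨j, d, hd, hdq, h1, h2, h3⟩ := h.dominated.exists_monic h.perfect hil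
    refine ⟨j, d, hdq, h1.isMonicSupport hd (supported_mono ?_ h2) h3⟩
    rintro m ⟨hm, him⟩
    refine ⟨?_, him⟩
    rcases hm with hm | hm
    · rw [hm] at him
      exact absurd (mem_lowerNbrs.1 hi).1 (not_lt.2 him)
    · exact mem_lowerNbrs.2 hm
  exists_node := by
    rintro v ⟨A, hA, hv⟩
    have hA' : 𝒩.IsChain A := hA
    obtain ⟨h1, h2⟩ := h.represents.chain_triangular A hA' (𝒩.rank v)
    have hv' : A (𝒩.rank v) = v := hv
    simp only [hv'] at h1 h2
    refine ⟨_, (isMonicIn_of_initialIn_eq_one h2).isMonicSupport h1.degreeOf_pos ?_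
      (h.reduced v _ h1)⟩
    refine supported_mono (fun m hm => mem_cliqueSet_iff.1 hm) (𝒩.supported v (f v) ?_)
    rw [(h.represents.triangular v).1]
    rfl
  summand := by
    intro l e he
    rw [mem_box]
    intro i
    by_cases hi : i ∈ insert l (lowerNbrs G l)
    · have := (monomial_le_degreeOf i he).trans_lt (h.summand_degree l i)
      exact this.trans_eq (if_pos hi).symm
    · have h0 := eq_zero_of_mem_supported (h.summand_supported l)
        (fun h => hi (mem_cliqueSet_iff.1 h)) e he
      exact (Nat.lt_one_iff.2 h0).trans_eq (if_neg hi).symm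

section Extension

variable {L : Type v} [Field L] [Algebra K L]

theorem nodePoly_inputOf (w : Fin N) : Shape.nodePoly (inputOf q F 𝒩 f hs L) w =
    map (algebraMap K L) (f w) :=
  (map_polyOf _ _ _).symm.trans (congrArg _ (polyOf_support (f w)))

theorem systemPoly_inputOf (j : Fin m) : Shape.systemPoly (inputOf q F 𝒩 f hs L) j =
    map (algebraMap K L) (F j) :=
  (map_polyOf _ _ _).symm.trans (congrArg _ (polyOf_support (F j)))

theorem summandPoly_inputOf (l : Fin n) : Shape.summandPoly (inputOf q F 𝒩 f hs L) l =
    map (algebraMap K L) (hs l) :=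
  (map_polyOf _ _ _).symm.trans (congrArg _ (polyOf_support (hs l)))

theorem map_mem_span_range {ι : Type*} {p : ι → MvPolynomial (Fin n) K}
    {g : MvPolynomial (Fin n) K} (hg : g ∈ Ideal.span (Set.range p)) :
    map (algebraMap K L) g ∈ Ideal.span (Set.range fun i => map (algebraMap K L) (p i)) := by
  have := Ideal.mem_map_of_mem (map (algebraMap K L)) hg
  rwa [Ideal.map_span, ← Set.range_comp] at this

/-- The conditions on the coefficients persist over every extension field. -/
theorem IsInput.valid (h : IsInput q F 𝒩 f hs) :
    (shapeOf q F 𝒩 f hs).Valid (inputOf q F 𝒩 f hs L) where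
  ne_zero j e he := (map_ne_zero (algebraMap K L)).2 (mem_support_iff.1 he)
  lead := by
    rintro v ⟨A, hA, hv⟩ Y d hd
    have h1 := h.represents.isMonicIn hA (𝒩.rank v)
    have hv' : A (𝒩.rank v) = v := hv
    rw [hv'] at h1
    have h2 : d = (f v).degreeOf (𝒩.rank v) := h1.eq_of_isMonicSupport hd
    have h3 : (f v).coeff (Finsupp.single (𝒩.rank v) d) = 1 := by
      rw [h1 _ (by simp [h2]), h2, if_pos rfl]
    exact (congrArg (algebraMap K L) h3).trans (map_one _)
  system_mem := by
    intro A hA j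
    have h1 : (fun l => Shape.nodePoly (inputOf q F 𝒩 f hs L) (A l)) =
        fun l => map (algebraMap K L) (f (A l)) := funext fun l => nodePoly_inputOf (A l)
    have h2 : Shape.systemPoly (inputOf q F 𝒩 f hs L) j ∈
        Ideal.span (Set.range fun l : Fin n => map (algebraMap K L) (f (A l))) :=
      (systemPoly_inputOf (q := q) (F := F) (𝒩 := 𝒩) (f := f) (hs := hs) (L := L) j).symm ▸
        map_mem_span_range (h.represents.system_mem hA j)
    exact h1.symm ▸ h2

open Classical in
/-- The result of the dynamic program, as a polynomial function of the random scalars. -/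
theorem IsInput.chainSum_eq (h : IsInput q F 𝒩 f hs)
    {g : (Fin n → Fin N) → MvPolynomial (Fin n) K}
    (hg : ∀ C, 𝒩.IsChain C → InBox (fun l => (f (C l)).degreeOf l) (g C) ∧
      ∑ l, hs l - g C ∈ Ideal.span (Set.range fun l => f (C l)))
    (z : Fin (n + N) → L) :
    Shape.chainSum (inputOf q F 𝒩 f hs L) z =
      eval z (chainPoly (Finset.univ.filter 𝒩.IsChain) fun C => map (algebraMap K L) (g C)) := by
  rw [eval_chainPoly]
  refine Finset.sum_congr rfl fun (C : Fin n → Fin N) hC => ?_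
  have hmem := (@Finset.mem_filter _ _ (_) _ _).1 hC |>.2
  have hC' : 𝒩.IsChain C := hmem
  refine congrArg₂ (· * ·) rfl ?_
  have h1 : (fun l => Shape.nodePoly (inputOf q F 𝒩 f hs L) (C l)) =
      fun l => map (algebraMap K L) (f (C l)) := funext fun l => nodePoly_inputOf (C l)
  have h2 : ∑ l, Shape.summandPoly (inputOf q F 𝒩 f hs L) l =
      map (algebraMap K L) (∑ l, hs l) :=
    (Finset.sum_congr rfl fun l _ => summandPoly_inputOf l).trans (map_sum _ _ _).symm
  have ht : ∀ l, IsMonicIn l ((f (C l)).degreeOf l) (map (algebraMap K L) (f (C l))) :=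
    fun l => (h.represents.isMonicIn hC' l).map _
  have hsup : ∀ l, map (algebraMap K L) (f (C l)) ∈ supported L {i : Fin n | l ≤ i} := by
    intro l
    rw [mem_supported]
    intro i hi
    exact (h.represents.chain_triangular C hC' l).1.2 i (vars_map _ _ hi)
  have hbox : InBox (fun l => (f (C l)).degreeOf l) (map (algebraMap K L) (g C)) :=
    fun e he => (hg C hC').1 e (support_map_subset _ _ he)
  have h3 := map_mem_span_range (L := L) (hg C hC').2
  rw [map_sub] at h3
  have h4 := normalEval_eq_of_sub_mem (fun l => z (Fin.castAdd N l)) ht hsup hbox h3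
  exact (congrArg₂ (fun t p => normalEval t (fun l => z (Fin.castAdd N l)) p) h1 h2).trans h4

end Extension

end Input

end ChordalNet

open ChordalNet in
theorem mainTheorem3 :
    ∃ (c : ℕ) (A : (s : Shape) → CompTree s.Input),
      ∀ (K : Type u) [Field K] (n q m N : ℕ) (G : SimpleGraph (Fin n))
        (F : Fin m → MvPolynomial (Fin n) K) (𝒩 : ChordalNetwork K G N)
        (f : Fin N → MvPolynomial (Fin n) K)
        (h : MvPolynomial (Fin n) K) (hs : Fin n → MvPolynomial (Fin n) K),
        IsPerfectElimination G →
        SupportedOn G (Set.range F) →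
        IsChordallyQDominated G q {g | g ∈ Set.range F ∧ IsReduced q g} →
        𝒩.Represents f (Set.range F) →
        (∀ w, IsReduced q (f w)) →
        h = ∑ l, hs l →
        (∀ l, hs l ∈ MvPolynomial.supported K (cliqueSet G l)) →
        (∀ l i, (hs l).degreeOf i < q) →
        (A (shapeOf q F 𝒩 f hs)).cost ≤
            c * G.cliqueNum ^ c *
              (n * 𝒩.width * q ^ (2 * G.cliqueNum) + n * 𝒩.width ^ 2 * q ^ G.cliqueNum) ∧
          ∀ (L : Type v) [Field L] [Algebra K L] (S : Finset L) (hS : S.Nonempty),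
            2 * n * q ≤ S.card →
            ((∀ x ∈ variety (Set.range F), MvPolynomial.aeval x h = 0) →
              (A (shapeOf q F 𝒩 f hs)).run S hS (inputOf q F 𝒩 f hs L) true = 1) ∧
            ((¬ ∀ x ∈ variety (Set.range F), MvPolynomial.aeval x h = 0) →
              (1 / 2 : ℝ≥0∞) ≤
                (A (shapeOf q F 𝒩 f hs)).run S hS (inputOf q F 𝒩 f hs L) false) := by
  classical
  -- for a discrete input that is not `Good`, the answer is always `true`: under the hypotheses,
  -- there is then no chain, whence `V(F)` is empty, or no variable, whence `h = 0`
  have hA : ∀ s : Shape, ∃ t : CompTree s.Input,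
      (s.Good → t.cost ≤ 16 * s.G.cliqueNum ^ 2 *
        (s.n * (Finset.univ.sup fun l => (Finset.univ.filter fun w => s.rank w = l).card) *
            s.q ^ (2 * s.G.cliqueNum) +
          s.n * (Finset.univ.sup fun l => (Finset.univ.filter fun w => s.rank w = l).card) ^ 2 *
            s.q ^ s.G.cliqueNum) ∧
        ∀ (L : Type v) [Field L] (inp : s.Input → L), s.Valid inp →
          ∀ (S : Finset L) (hS : S.Nonempty) (b : Bool), t.run S hS inp b =
            (((Fintype.piFinset fun _ : Fin (s.n + s.N) => S).filter fun z =>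
              (Shape.chainSum inp z = 0) ↔ b = true).card : ℝ≥0∞) /
                (S.card : ℝ≥0∞) ^ (s.n + s.N)) ∧
      (¬ s.Good → t = .halt true) := by
    intro s
    by_cases hs : s.Good
    · obtain ⟨t, ht⟩ := hs.exists_tree.{v}
        (fun l => Finset.le_sup (f := fun l => (Finset.univ.filter fun w => s.rank w = l).card)
          (Finset.mem_univ l))
        (fun l => card_lowerNbrs_lt_cliqueNum hs.perfect l)
      exact ⟨t, fun _ => ht, fun h => absurd hs h⟩
    · exact ⟨.halt true, fun h => absurd h hs, fun _ => rfl⟩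
  choose A hA₁ hA₂ using hA
  refine ⟨16, A, ?_⟩
  intro K _ n q m N G F 𝒩 f h hs hG _ hF hR hred hh hsupp hdeg
  have hI : IsInput q F 𝒩 f hs := ⟨hG, hF, hR, hred, hsupp, hdeg⟩
  by_cases hgood : (shapeOf q F 𝒩 f hs).Good
  · obtain ⟨hcost, hrun⟩ := hA₁ _ hgood
    have hn : 0 < n := hgood.n_pos
    have hq : 0 < q := hgood.q_pos
    refine ⟨hcost.trans ?_, ?_⟩
    · have hκ : 1 ≤ G.cliqueNum :=
        (Nat.le_add_left _ _).trans (card_lowerNbrs_lt_cliqueNum hG ⟨0, hn⟩)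
      exact Nat.mul_le_mul_right _ (Nat.mul_le_mul_left _
        (Nat.pow_le_pow_right hκ (by norm_num)))
    · intro L _ _ S hS hcard
      have hval : (shapeOf q F 𝒩 f hs).Valid (inputOf q F 𝒩 f hs L) := hI.valid
      -- the normal forms of `h`, chosen to be zero where possible
      have hex : ∀ C, ∃ g, 𝒩.IsChain C → InBox (fun _ => q) g ∧
          InBox (fun l => (f (C l)).degreeOf l) g ∧
          ∑ l, hs l - g ∈ Ideal.span (Set.range fun l => f (C l)) ∧
          (h ∈ Ideal.span (Set.range fun l => f (C l)) → g = 0) := by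
        intro C
        by_cases hC : 𝒩.IsChain C
        · by_cases hmem : h ∈ Ideal.span (Set.range fun l => f (C l))
          · exact ⟨0, fun _ => ⟨by simp [InBox], by simp [InBox], by simpa [← hh] using hmem,
              fun _ => rfl⟩⟩
          · obtain ⟨g, h1, h2, h3⟩ := hI.exists_normalForm hC (∑ l, hs l)
            exact ⟨g, fun _ => ⟨h1, h2, h3, fun h4 => absurd h4 hmem⟩⟩
        · exact ⟨0, fun h1 => absurd h1 hC⟩
      choose g hg using hex
      set P := chainPoly (Finset.univ.filter 𝒩.IsChain)
        fun C => MvPolynomial.map (algebraMap K L) (g C) with hP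
      have hchain : ∀ C ∈ Finset.univ.filter 𝒩.IsChain, 𝒩.IsChain C :=
        fun C hC => (Finset.mem_filter.1 hC).2
      have hsum : ∀ z, Shape.chainSum (inputOf q F 𝒩 f hs L) z = MvPolynomial.eval z P :=
        hI.chainSum_eq fun C hC => ⟨(hg C hC).2.1, (hg C hC).2.2.1⟩
      refine ⟨fun hvan => ?_, fun hvan => ?_⟩
      · have hP0 : P = 0 := Finset.sum_eq_zero fun C hC => by
          beta_reduce
          rw [(hg C (hchain C hC)).2.2.2 (hR.forall_variety_iff.1 hvan C (hchain C hC)),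
            map_zero, map_zero, mul_zero]
        have hsum0 : ∀ z, Shape.chainSum (inputOf q F 𝒩 f hs L) z = 0 :=
          fun z => (hsum z).trans (hP0 ▸ map_zero _)
        refine (hrun L _ hval S hS true).trans ?_
        rw [Finset.filter_true_of_mem fun z _ => iff_of_true (hsum0 z) rfl,
          Fintype.card_piFinset_const, Nat.cast_pow]
        exact ENNReal.div_self (pow_ne_zero _ (by exact_mod_cast hS.card_pos.ne'))
          (ENNReal.pow_ne_top (ENNReal.natCast_ne_top _))
      · rw [hR.forall_variety_iff] at hvan
        push Not at hvan
        obtain ⟨C, hC, hCh⟩ := hvan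
        have hgC : MvPolynomial.map (algebraMap K L) (g C) ≠ 0 := by
          rw [Ne, map_eq_zero_iff _ (MvPolynomial.map_injective _ (algebraMap K L).injective)]
          intro h0
          have h1 := (hg C hC).2.2.1
          rw [h0, sub_zero, ← hh] at h1
          exact hCh h1
        have hP0 : P ≠ 0 := chainPoly_ne_zero (rank := 𝒩.rank) (fun A hA => (hchain A hA).1)
          (Finset.mem_filter.2 ⟨Finset.mem_univ C, hC⟩) hgC
        have hPdeg : P.totalDegree ≤ n * q := totalDegree_chainPoly_le hq fun A hA e he =>
          (hg A (hchain A hA)).1 e (MvPolynomial.support_map_subset _ _ he)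
        refine (half_le_card_ne_zero hS hP0 hPdeg (by rwa [← mul_assoc])).trans_eq ?_
        refine Eq.trans ?_ (hrun L _ hval S hS false).symm
        refine congrArg₂ (· / ·) (congrArg _ (congrArg _ (Finset.filter_congr fun z _ => ?_))) rfl
        refine (not_congr (Eq.congr_left (hsum z)).symm).trans ?_
        simp
  · rw [hA₂ _ hgood]
    refine ⟨Nat.zero_le _, fun L _ _ S hS _ => ⟨fun _ => ?_, fun hne => absurd ?_ hne⟩⟩
    · simp [CompTree.run, CompTree.runFrom]
    · rw [hR.forall_variety_iff]
      intro C hC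
      rcases Nat.eq_zero_or_pos n with rfl | hn
      · rw [hh, Finset.univ_eq_empty, Finset.sum_empty]
        exact Ideal.zero_mem _
      · exact absurd (hI.good hn ⟨C, hC⟩) hgood
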